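/- Let $N\ge 1$, $p>1$, and $X=L^1(\mathbb R^N)\cap L^\infty(\mathbb R^N)$ with norm $\|f\|_X=\|f\|_1+\|f\|_\infty$. Let $\kappa,\ell$ be locally integrable on $[0,\infty)$, nonnegative and nonincreasing on $(0,\infty)$, with $\kappa(t)\to0$ as $t\to\infty$ and $\int_0^t\kappa(\tau)\ell(t-\tau)\,d\tau=1$ for all $t>0$. Let $\mathcal J:\mathbb R^N\to[0,\infty)$ be radially symmetric, nonincreasing near infinity, with $\int_{\mathbb R^N}\min\{1,|z|^2\}\mathcal J(z)\,dz<\infty$. Put $$\mathcal D_tf=\partial_t\Big(\int_0^t (f(\tau)-f(0))\kappa(t-\tau)\,d\tau\Big),\quad \mathcal L_xw(x)=\mathrm{P.V.}\!\int_{\mathbb R^N}(w(x)-w(z))\mathcal J(x-z)\,dz,$$ and let $m(\xi)=\int_{\mathbb R^N}(1-\cos(z\cdot\xi))\mathcal J(z)\,dz$ be the Fourier symbol of $\mathcal L_x$. For $\mu\ge0$ let $\varrho_1(\cdot;\mu),\varrho_2(\cdot;\mu)$ be the locally integrable solutions on $(0,\infty)$ of the Volterra equations $\varrho_1+\mu\,(\ell\star\varrho_1)=1$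 and $\varrho_2+\mu\,(\ell\star\varrho_2)=\ell$, where $(\ell\star\varrho)(t)=\int_0^t\ell(t-s)\varrho(s)\,ds$. The fundamental pair of $\mathcal D_t+\mathcal L_x$ consists of the finite positive measures $Z_t,Y_t$ on $\mathbb R^N$ $(t>0)$ whose Fourier transforms are $\widehat Z_t(\xi)=\varrho_1(t;m(\xi))$ and $\widehat Y_t(\xi)=\varrho_2(t;m(\xi))$. For $0<T\le\infty$ and nonnegative $u_0\in X$, a mild solution on $(0,T)$ of $$(\mathcal D_t+\mathcal L_x)u=u^p,\qquad u(\cdot,0)=u_0,$$ is a nonnegative $u\in C((0,T);X)$, bounded in $X$ near $t=0$, such that for every $0<t<T$ and a.e. $x\in\mathbb R^N$ $$u(x,t)=(Z_t*u_0)(x)+\int_0^t\big(Y_{t-\tau}*u^p(\cdot,\tau)\big)(x)\,d\tau .$$ **Theorem.** The fundamental pair exists and is unique. For every nonnegative $u_0\in X$ there is $T_0>0$ such that there is exactly one mild solution $u$ on $(0,T_0)$; moreover $u(t)\to u_0$ in $L^1(\mathbb R^N)$ and $u(t)-Z_t*u_0\to0$ in $X$ as $t\to0^+$ (so $u(t)\to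 u_0$ in $X$ exactly when $Z_t*u_0\to u_0$ in $L^\infty(\mathbb R^N)$). Furthermore a comparison principle holds: if $0\le u_0\le v_0$ a.e., with $u_0,v_0\in X$, and $u,v$ are mild solutions on $(0,T)$, $0<T\le\infty$, with initial values $u_0$ and $v_0$ respectively, then for every $t\in(0,T)$, $u(x,t)\le v(x,t)$ for a.e. $x$; in particular $u\le v$ a.e. in $\mathbb R^N\times(0,T)$. -/

import Mathlib

open MeasureTheory Set Filter Topology

noncomputable section

/-- Conditions on the memory kernel `κ` of the time operator
`D_t f = ∂_t (κ ⋆ (f - f 0))` and its conjugate kernel `ℓ`: both are locally integrable on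
`[0, ∞)`, nonnegative and nonincreasing on `(0, ∞)`, `κ` vanishes at infinity and `ℓ ⋆ κ = 1`. -/
structure IsMemoryKernelPair (κ ℓ : ℝ → ℝ) : Prop where
  integrableOn_kappa : ∀ T : ℝ, 0 < T → IntegrableOn κ (Ioc 0 T)
  nonneg_kappa : ∀ t : ℝ, 0 < t → 0 ≤ κ t
  antitone_kappa : AntitoneOn κ (Ioi 0)
  tendsto_kappa : Tendsto κ atTop (𝓝 0)
  integrableOn_ell : ∀ T : ℝ, 0 < T → IntegrableOn ℓ (Ioc 0 T)
  nonneg_ell : ∀ t : ℝ, 0 < t → 0 ≤ ℓ t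
  antitone_ell : AntitoneOn ℓ (Ioi 0)
  conv_eq_one : ∀ t : ℝ, 0 < t → ∫ τ in (0 : ℝ)..t, κ τ * ℓ (t - τ) = 1

/-- Conditions on the Lévy kernel `J` of the space operator
`L_x w (x) = P.V. ∫ (w x - w z) J (x - z) dz`: nonnegative, radially symmetric, nonincreasing
near infinity, with `∫ min {1, |z|²} J z dz < ∞`. -/
structure IsLevyKernel {N : ℕ} (J : EuclideanSpace ℝ (Fin N) → ℝ) : Prop where
  nonneg : ∀ z, 0 ≤ J z
  radial : ∀ z w, ‖z‖ = ‖w‖ → J z = J w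
  antitone_near_infinity : ∃ R : ℝ, ∀ z w, R ≤ ‖z‖ → ‖z‖ ≤ ‖w‖ → J w ≤ J z
  integrable : Integrable (fun z => min 1 (‖z‖ ^ 2) * J z)

/-- The Fourier symbol `m(ξ) = ∫ (1 - cos (z · ξ)) J(z) dz` of the space operator `L_x`. -/
def levySymbol {N : ℕ} (J : EuclideanSpace ℝ (Fin N) → ℝ) (ξ : EuclideanSpace ℝ (Fin N)) : ℝ :=
  ∫ z, (1 - Real.cos (inner ℝ z ξ)) * J z

/-- `ρ` is a locally integrable solution of the Volterra equation `ρ + μ (ℓ ⋆ ρ) = g` on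
`(0, ∞)`. -/
structure IsVolterraSolution (ℓ : ℝ → ℝ) (μ : ℝ) (g ρ : ℝ → ℝ) : Prop where
  integrableOn : ∀ T : ℝ, 0 < T → IntegrableOn ρ (Ioc 0 T)
  eqn : ∀ t : ℝ, 0 < t → ρ t + μ * ∫ s in (0 : ℝ)..t, ℓ (t - s) * ρ s = g t

/-- `(Z, Y)` is the fundamental pair of `D_t + L_x`: for `t > 0` the kernels `Z t` and `Y t` are
finite positive measures (they may have an atom at the origin, for instance when `J` is
integrable) whose Fourier transforms are `ρ₁(t; m(ξ))` and `ρ₂(t; m(ξ))`, where `ρ₁(·; μ)` and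
`ρ₂(·; μ)` solve `ρ₁ + μ (ℓ ⋆ ρ₁) = 1` and `ρ₂ + μ (ℓ ⋆ ρ₂) = ℓ`. -/
structure IsFundamentalPair {N : ℕ} (ℓ : ℝ → ℝ) (J : EuclideanSpace ℝ (Fin N) → ℝ)
    (Z Y : ℝ → Measure (EuclideanSpace ℝ (Fin N))) : Prop where
  finite_Z : ∀ t : ℝ, 0 < t → IsFiniteMeasure (Z t)
  finite_Y : ∀ t : ℝ, 0 < t → IsFiniteMeasure (Y t)
  fourier_Z : ∀ ξ, ∃ ρ : ℝ → ℝ, IsVolterraSolution ℓ (levySymbol J ξ) (fun _ => 1) ρ ∧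
    ∀ t : ℝ, 0 < t → charFun (Z t) ξ = (ρ t : ℂ)
  fourier_Y : ∀ ξ, ∃ ρ : ℝ → ℝ, IsVolterraSolution ℓ (levySymbol J ξ) ℓ ρ ∧
    ∀ t : ℝ, 0 < t → charFun (Y t) ξ = (ρ t : ℂ)

/-- Convolution in space, `(μ * f)(x) = ∫ f (x - y) dμ(y)`. -/
def spaceConv {N : ℕ} (μ : Measure (EuclideanSpace ℝ (Fin N)))
    (f : EuclideanSpace ℝ (Fin N) → ℝ) (x : EuclideanSpace ℝ (Fin N)) : ℝ :=
  ∫ y, f (x - y) ∂μ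

/-- Membership in `X = L¹ ∩ L^∞`. -/
def MemX {N : ℕ} (f : EuclideanSpace ℝ (Fin N) → ℝ) : Prop :=
  MemLp f 1 ∧ MemLp f ⊤

/-- The norm `‖f‖₁ + ‖f‖_∞` of `X = L¹ ∩ L^∞`. -/
def normX {N : ℕ} (f : EuclideanSpace ℝ (Fin N) → ℝ) : ENNReal :=
  eLpNorm f 1 volume + eLpNorm f ⊤ volume

/-- The time interval `(0, T)`, `T ≤ ∞`. -/
def timeInterval (T : EReal) : Set ℝ := {t | 0 < t ∧ (t : EReal) < T}

/-- `u` is a nonnegative mild solution on `(0, T)` of `(D_t + L_x) u = u ^ p` with initial value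
`u₀`: a curve in `X = L¹ ∩ L^∞`, continuous on `(0, T)` and bounded near `t = 0`, which satisfies
the Duhamel formula for every `0 < t < T` and almost every `x`. -/
structure IsMildSolution {N : ℕ} (Z Y : ℝ → Measure (EuclideanSpace ℝ (Fin N))) (p : ℝ)
    (u₀ : EuclideanSpace ℝ (Fin N) → ℝ) (T : EReal)
    (u : ℝ → EuclideanSpace ℝ (Fin N) → ℝ) : Prop where
  aestronglyMeasurable : AEStronglyMeasurable
    (fun q : ℝ × EuclideanSpace ℝ (Fin N) => u q.1 q.2)
    (((volume : Measure ℝ).restrict (timeInterval T)).prod volume)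
  memX : ∀ t ∈ timeInterval T, MemX (u t)
  nonneg : ∀ t ∈ timeInterval T, ∀ᵐ x, 0 ≤ u t x
  continuous : ∀ t ∈ timeInterval T,
    Tendsto (fun s => normX (u s - u t)) (𝓝[timeInterval T] t) (𝓝 0)
  bounded_near_zero : ∃ δ : ℝ, 0 < δ ∧ ∃ C : NNReal, ∀ t ∈ timeInterval T, t < δ →
    normX (u t) ≤ C
  duhamel : ∀ t ∈ timeInterval T, ∀ᵐ x,
    u t x = spaceConv (Z t) u₀ x +
      ∫ τ in (0 : ℝ)..t, spaceConv (Y (t - τ)) (fun y => u τ y ^ p) x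

end

/-! The kernels are extended by zero to functions `K`, `L` on the line with values in `[0, ∞]`; with
`H` the Heaviside function, the hypothesis on the kernels becomes `K ⋆ L = H`. Nonnegative
quantities are convolved without integrability side conditions, and differences are handled through
positive and negative parts.

The heart of the matter is positivity of the resolvent `r_c`, the solution of `r + c (L ⋆ r) = L`
for `c ≥ 0`. The formal solution is the alternating series of the powers of `c L ⋆`. Its even and
odd parts `Pe`, `Po` converge in an exponentially weighted `L¹` space, and convolving with `K` shows
that `u = Pe - Po` satisfies `K ⋆ u + c (H ⋆ u) = H`. A maximum principle for `u ↦ K ⋆ u + c (H ⋆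
u)`, based on monotonicity of `K` (`nonneg_of_monotoneOn_memory`), is applied to regularisations of
`u`. It shows that the primitive of `u` is nondecreasing, hence `u ≥ 0` almost everywhere
(`IsTimeKernel.ae_le_of_memory_eq`, `IsSoninePair.exists_resolvent`). Then `ρ₂(·; c) = r_c` and
`ρ₁(·; c) = K ⋆ r_c`.

For a finite symmetric measure `ν` of mass `c`, the nonnegative combination of the convolution
powers of `ν` with weights `r_c ⋆ ⋯ ⋆ r_c` has Fourier transform `ρ₂(t; c - ν̂(ξ))`. Truncating `J`
near the origin gives such measures, whose symbols converge to `m`. Since `r_c(t)` is Lipschitz in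
`c`, Lévy's continuity theorem yields probability measures `Q t` with `Y_t = L(t) Q_t`, and `Z_t = ∫
K(t - s) L(s) Q_s ds` has mass `K ⋆ L = 1` (`IsSoninePair.exists_transitionFamily`). Uniqueness of
the pair follows from uniqueness for the Volterra equations and injectivity of the Fourier transform
on finite measures.

The mild solution is the increasing limit of the Picard iterates started at zero. On a time interval
where the Lipschitz constant of `x ↦ x ^ p` times `∫ L` is at most `1/2`, the iterates stay bounded
in `X` and converge geometrically. They are continuous in time because the densities `K(t - ·) L` of
`Z_t` with respect to the family `Q` vary continuously in `L¹` (Scheffé). For comparison, `φ(s) =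
‖(u(s) - v(s))₊‖₁` satisfies `φ ≤ C (L ⋆ φ)`, and Gronwall's lemma gives `φ = 0`
(`IsMildSolution.ae_le`); uniqueness follows by applying this in both directions. Finally, `Z_t`
tends weakly to the Dirac mass at the origin and the Duhamel term is `O(∫₀ᵗ L)` in `X`, which gives
the behaviour at the initial time. -/

open scoped ENNReal NNReal

/-! ### Convolution of nonnegative functions on the half line -/

/-- A function on the time axis which vanishes for nonpositive times. -/
def Causal (f : ℝ → ℝ≥0∞) : Prop := ∀ t ≤ 0, f t = 0

/-- The extension by zero of a real kernel on `(0, ∞)` to a nonnegative function on `ℝ`. -/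
noncomputable def timeKernel (f : ℝ → ℝ) : ℝ → ℝ≥0∞ :=
  (Ioi 0).indicator fun t => ENNReal.ofReal (f t)

/-- The indicator function of `(0, ∞)`. -/
noncomputable def heaviside : ℝ → ℝ≥0∞ := (Ioi 0).indicator 1

lemma causal_timeKernel (f : ℝ → ℝ) : Causal (timeKernel f) := fun t ht => by
  simp [timeKernel, ht]

lemma timeKernel_of_pos (f : ℝ → ℝ) {t : ℝ} (ht : 0 < t) :
    timeKernel f t = ENNReal.ofReal (f t) := by simp [timeKernel, ht]

lemma timeKernel_ne_top (f : ℝ → ℝ) (t : ℝ) : timeKernel f t ≠ ∞ := by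
  by_cases h : t ∈ Ioi (0 : ℝ) <;> simp [timeKernel, h]

lemma causal_heaviside : Causal heaviside := fun t ht => by simp [heaviside, ht]

lemma heaviside_of_pos {t : ℝ} (ht : 0 < t) : heaviside t = 1 := by simp [heaviside, ht]

lemma measurable_heaviside : Measurable heaviside :=
  measurable_const.indicator measurableSet_Ioi

lemma measurable_timeKernel {f : ℝ → ℝ} (hf : AntitoneOn f (Ioi 0)) :
    Measurable (timeKernel f) := by
  have h1 : Measurable fun t : Ioi (0 : ℝ) => f t :=
    Antitone.measurable fun a b hab => hf a.2 b.2 hab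
  refine measurable_of_restrict_of_restrict_compl (measurableSet_Ioi (a := (0 : ℝ))) ?_ ?_
  · have : (Ioi (0 : ℝ)).domRestrict (timeKernel f) = fun t : Ioi (0 : ℝ) => ENNReal.ofReal (f t) := by
      ext t
      exact timeKernel_of_pos f t.2
    rw [this]
    exact h1.ennreal_ofReal
  · have : (Ioi (0 : ℝ))ᶜ.domRestrict (timeKernel f) = fun _ => 0 := by
      ext t
      exact causal_timeKernel f t (not_lt.1 t.2)
    rw [this]
    exact measurable_const

section lconvolution

variable {f g h : ℝ → ℝ≥0∞}

lemma lconv_eq_lintegral_sub (f g : ℝ → ℝ≥0∞) (t : ℝ) :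
    (f ⋆ₗ g) t = ∫⁻ s, f (t - s) * g s := by
  rw [lconvolution_comm, lconvolution_def]
  exact lintegral_congr fun s => by rw [mul_comm, neg_add_eq_sub]

lemma lconv_eq_lintegral (f g : ℝ → ℝ≥0∞) (t : ℝ) :
    (f ⋆ₗ g) t = ∫⁻ s, f s * g (t - s) := by
  rw [lconvolution_def]
  exact lintegral_congr fun s => by rw [neg_add_eq_sub]

lemma lconv_mono {f' g' : ℝ → ℝ≥0∞} (hf : f ≤ f') (hg : g ≤ g') : f ⋆ₗ g ≤ f' ⋆ₗ g' :=
  fun _ => lintegral_mono fun _ => mul_le_mul' (hf _) (hg _)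

lemma lconv_congr_right (f : ℝ → ℝ≥0∞) (hg : g =ᵐ[volume] h) : f ⋆ₗ g = f ⋆ₗ h := by
  ext t
  rw [lconv_eq_lintegral_sub, lconv_eq_lintegral_sub]
  exact lintegral_congr_ae (hg.mono fun s hs => by simp only [hs])

lemma lconv_add (hf : Measurable f) (hg : Measurable g) (h : ℝ → ℝ≥0∞) :
    f ⋆ₗ (g + h) = f ⋆ₗ g + f ⋆ₗ h := by
  ext t
  simp only [Pi.add_apply, lconv_eq_lintegral_sub, mul_add]
  exact lintegral_add_left ((hf.comp (measurable_const.sub measurable_id)).mul hg) _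

lemma add_lconv (hf : Measurable f) (hh : Measurable h) (g : ℝ → ℝ≥0∞) :
    (f + g) ⋆ₗ h = f ⋆ₗ h + g ⋆ₗ h := by
  ext t
  simp only [Pi.add_apply, lconv_eq_lintegral, add_mul]
  exact lintegral_add_left (hf.mul (hh.comp (measurable_const.sub measurable_id))) _

lemma lconv_const_smul (hf : Measurable f) (hg : Measurable g) (c : ℝ≥0∞) :
    f ⋆ₗ (c • g) = c • (f ⋆ₗ g) := by
  ext t
  simp only [Pi.smul_apply, smul_eq_mul, lconv_eq_lintegral_sub]
  rw [← lintegral_const_mul _ (by fun_prop)]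
  exact lintegral_congr fun s => by ring

lemma const_smul_lconv (hf : Measurable f) (hg : Measurable g) (c : ℝ≥0∞) :
    (c • f) ⋆ₗ g = c • (f ⋆ₗ g) := by
  rw [lconvolution_comm, lconv_const_smul hg hf, lconvolution_comm]

lemma lconv_tsum (hf : Measurable f) {G : ℕ → ℝ → ℝ≥0∞} (hG : ∀ n, Measurable (G n)) (t : ℝ) :
    (f ⋆ₗ fun s => ∑' n, G n s) t = ∑' n, (f ⋆ₗ G n) t := by
  simp only [lconv_eq_lintegral_sub, ← ENNReal.tsum_mul_left]
  exact lintegral_tsum fun n =>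
    ((hf.comp (measurable_const.sub measurable_id)).mul (hG n)).aemeasurable

lemma lintegral_lconv (hf : Measurable f) (hg : Measurable g) :
    ∫⁻ t, (f ⋆ₗ g) t = (∫⁻ t, f t) * ∫⁻ t, g t := by
  rw [lintegral_congr (lconv_eq_lintegral f g), lintegral_lintegral_swap (by fun_prop),
    ← lintegral_mul_const _ hf]
  refine lintegral_congr fun s => ?_
  rw [lintegral_const_mul _ (by fun_prop), lintegral_sub_right_eq_self g s]

lemma Causal.lconv (hf : Causal f) (hg : Causal g) : Causal (f ⋆ₗ g) := fun t ht => by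
  rw [lconv_eq_lintegral]
  refine (lintegral_congr fun s => ?_).trans lintegral_zero
  rcases le_or_gt s 0 with hs | hs
  · simp [hf s hs]
  · simp [hg (t - s) (by linarith)]

lemma Causal.add (hf : Causal f) (hg : Causal g) : Causal (f + g) := fun t ht => by
  simp [hf t ht, hg t ht]

lemma Causal.const_smul (hf : Causal f) (c : ℝ≥0∞) : Causal (c • f) := fun t ht => by
  simp [hf t ht]

lemma Causal.of_le (hf : Causal f) (h : g ≤ f) : Causal g := fun t ht =>
  le_antisymm ((h t).trans (hf t ht).le) bot_le

/-- At time `t` a causal kernel only sees the past of `g`. This localises Gronwall's lemma to times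
before `T`. -/
lemma Causal.lconv_indicator_Iio (hf : Causal f) (g : ℝ → ℝ≥0∞) {t T : ℝ} (htT : t ≤ T) :
    (f ⋆ₗ (Iio T).indicator g) t = (f ⋆ₗ g) t := by
  simp only [lconv_eq_lintegral_sub]
  refine lintegral_congr fun s => ?_
  rcases lt_or_ge s T with hs | hs
  · simp [hs]
  · simp [hf (t - s) (by linarith)]

lemma Causal.lconv_eq_setLIntegral (hf : Causal f) (hg : Causal g) (t : ℝ) :
    (f ⋆ₗ g) t = ∫⁻ s in Ioc 0 t, f (t - s) * g s := by
  rw [lconv_eq_lintegral_sub, ← lintegral_indicator measurableSet_Ioc]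
  refine lintegral_congr fun s => ?_
  by_cases hs : s ∈ Ioc 0 t
  · simp [hs]
  · rw [indicator_of_notMem hs]
    rcases le_or_gt s 0 with h0 | h0
    · simp [hg s h0]
    · have : t < s := not_le.1 fun h => hs ⟨h0, h⟩
      simp [hf (t - s) (by linarith)]

lemma Causal.setLIntegral_Iio (hf : Causal f) (t : ℝ) :
    ∫⁻ s in Iio t, f s = ∫⁻ s in Ioo 0 t, f s := by
  rw [← lintegral_indicator measurableSet_Iio, ← lintegral_indicator measurableSet_Ioo]
  refine lintegral_congr fun s => ?_
  rcases le_or_gt s 0 with h0 | h0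
  · by_cases h : s < t <;> simp [indicator, hf s h0]
  · simp [indicator, h0]

lemma heaviside_lconv (g : ℝ → ℝ≥0∞) (t : ℝ) : (heaviside ⋆ₗ g) t = ∫⁻ s in Iio t, g s := by
  rw [lconv_eq_lintegral_sub, ← lintegral_indicator measurableSet_Iio]
  refine lintegral_congr fun s => ?_
  by_cases h : s < t
  · simp [heaviside, h]
  · simp [heaviside, h]

/-- Convolutions of locally integrable functions are locally integrable. -/
lemma Causal.setLIntegral_lconv_le (hf : Causal f) (hg : Causal g) (hfm : Measurable f)
    (hgm : Measurable g) (T : ℝ) :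
    ∫⁻ t in Iio T, (f ⋆ₗ g) t ≤ (∫⁻ t in Iio T, f t) * ∫⁻ t in Iio T, g t := by
  -- Before time `T` both factors are evaluated only before `T`, so they may be truncated there; the
  -- integral of a convolution over the whole line is then a product.
  have key : ∀ t ∈ Iio T, (f ⋆ₗ g) t = ((Iio T).indicator f ⋆ₗ (Iio T).indicator g) t := by
    intro t ht
    simp only [lconv_eq_lintegral_sub]
    refine lintegral_congr fun s => ?_
    rcases le_or_gt s 0 with h0 | h0
    · by_cases h : s < T <;> simp [indicator, hg s h0]
    · rcases le_or_gt (t - s) 0 with h1 | h1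
      · by_cases h : t - s < T <;> simp [indicator, hf _ h1]
      · have h2 : t - s < T := by have := mem_Iio.1 ht; linarith
        have h3 : s < T := by have := mem_Iio.1 ht; linarith
        simp [indicator, h2, h3]
  rw [setLIntegral_congr_fun measurableSet_Iio key, ← lintegral_indicator measurableSet_Iio f,
    ← lintegral_indicator measurableSet_Iio g,
    ← lintegral_lconv (hfm.indicator measurableSet_Iio) (hgm.indicator measurableSet_Iio)]
  exact setLIntegral_le_lintegral _ _

end lconvolution

/-! ### Exponential weights -/

/-- The exponential weight `t ↦ exp (-λ t)`. -/
noncomputable def expWeight (lam t : ℝ) : ℝ≥0∞ := ENNReal.ofReal (Real.exp (-lam * t))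

lemma measurable_expWeight (lam : ℝ) : Measurable (expWeight lam) := by
  unfold expWeight; fun_prop

lemma expWeight_ne_zero (lam t : ℝ) : expWeight lam t ≠ 0 := by
  simp [expWeight, Real.exp_pos]

/-- The weight is multiplicative, `e(t) = e(t - s) e(s)`. Weighted integrals therefore behave like a
Laplace transform and turn convolutions into products. -/
lemma expWeight_mul_lconv {f g : ℝ → ℝ≥0∞} (lam : ℝ) (hf : Measurable f) (hg : Measurable g) :
    expWeight lam * (f ⋆ₗ g) = (expWeight lam * f) ⋆ₗ (expWeight lam * g) := by
  ext t
  simp only [Pi.mul_apply, lconv_eq_lintegral_sub]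
  rw [← lintegral_const_mul _ (by fun_prop)]
  refine lintegral_congr fun s => ?_
  have : expWeight lam t = expWeight lam (t - s) * expWeight lam s := by
    rw [expWeight, expWeight, expWeight, ← ENNReal.ofReal_mul (Real.exp_pos _).le, ← Real.exp_add]
    congr 2; ring
  rw [this]; ring

lemma lintegral_expWeight_mul_lconv {f g : ℝ → ℝ≥0∞} (lam : ℝ) (hf : Measurable f)
    (hg : Measurable g) : ∫⁻ t, expWeight lam t * (f ⋆ₗ g) t =
      (∫⁻ t, expWeight lam t * f t) * ∫⁻ t, expWeight lam t * g t := by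
  have := lintegral_lconv ((measurable_expWeight lam).mul hf) ((measurable_expWeight lam).mul hg)
  rw [← expWeight_mul_lconv lam hf hg] at this
  exact this

/-- A function with a finite exponential moment has finite integrals over left half-lines. -/
lemma setLIntegral_Iio_lt_top_of_expWeight {f : ℝ → ℝ≥0∞} {lam : ℝ}
    (hlam : 0 ≤ lam) (h : ∫⁻ t, expWeight lam t * f t < ∞) (T : ℝ) : ∫⁻ t in Iio T, f t < ∞ := by
  have h1 : ∫⁻ t in Iio T, f t ≤
      ENNReal.ofReal (Real.exp (lam * T)) * ∫⁻ t, expWeight lam t * f t := by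
    rw [← lintegral_const_mul' _ _ ENNReal.ofReal_ne_top]
    refine (lintegral_mono_ae ?_).trans (setLIntegral_le_lintegral (Iio T) _)
    filter_upwards [ae_restrict_mem measurableSet_Iio] with t ht
    rw [← mul_assoc, expWeight, ← ENNReal.ofReal_mul (Real.exp_pos _).le, ← Real.exp_add]
    refine le_mul_of_one_le_left bot_le ?_
    rw [ENNReal.one_le_ofReal, Real.one_le_exp_iff]
    have := mem_Iio.1 ht
    nlinarith
  exact h1.trans_lt (ENNReal.mul_lt_top ENNReal.ofReal_lt_top h)

/-- A locally integrable kernel which is bounded at infinity has arbitrarily small exponential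
moments. -/
lemma tendsto_lintegral_expWeight {f : ℝ → ℝ≥0∞} (hf : Causal f) (hfm : Measurable f)
    (h1 : ∫⁻ t in Iio 1, f t < ∞) {C : ℝ≥0∞} (hC : C ≠ ∞) (h2 : ∀ t, 1 ≤ t → f t ≤ C) :
    Tendsto (fun n : ℕ => ∫⁻ t, expWeight n t * f t) atTop (𝓝 0) := by
  -- The weight of rate one provides the majorant: before time one it is at most one where `f` lives
  -- and `f` is integrable, afterwards `f ≤ C` and the exponential is integrable.
  have hbound : ∫⁻ t, expWeight 1 t * f t ≠ ∞ := by
    rw [← lintegral_add_compl _ (measurableSet_Iio (a := (1 : ℝ))), compl_Iio]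
    refine ENNReal.add_ne_top.2 ⟨?_, ?_⟩
    · refine (lt_of_le_of_lt (lintegral_mono fun t => ?_) h1).ne
      rcases le_or_gt t 0 with ht | ht
      · simp [hf t ht]
      · refine mul_le_of_le_one_left bot_le ?_
        rw [expWeight, ENNReal.ofReal_le_one, Real.exp_le_one_iff]
        linarith
    · have h3 : ∫⁻ t in Ici 1, expWeight 1 t < ∞ := by
        have := (integrableOn_exp_neg_Ioi (1 : ℝ)).lintegral_lt_top
        rw [setLIntegral_congr Ioi_ae_eq_Ici] at this
        simpa [expWeight] using this
      refine (lt_of_le_of_lt (b := C * ∫⁻ t in Ici 1, expWeight 1 t) ?_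
        (ENNReal.mul_lt_top hC.lt_top h3)).ne
      rw [← lintegral_const_mul _ (measurable_expWeight 1)]
      refine lintegral_mono_ae ?_
      filter_upwards [ae_restrict_mem measurableSet_Ici] with t ht
      rw [mul_comm]
      gcongr
      exact h2 t ht
  have := tendsto_lintegral_filter_of_dominated_convergence (μ := volume) (l := atTop)
    (F := fun (n : ℕ) t => expWeight n t * f t) (f := fun _ => 0)
    (fun t => expWeight 1 t * f t)
    (Eventually.of_forall fun n => (measurable_expWeight _).mul hfm)
    ?_ hbound ?_
  · simpa using this
  · filter_upwards [eventually_ge_atTop 1] with n hn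
    refine Eventually.of_forall fun t => ?_
    rcases le_or_gt t 0 with ht | ht
    · simp [hf t ht]
    · gcongr
      refine ENNReal.ofReal_le_ofReal (Real.exp_le_exp.2 ?_)
      have : (1 : ℝ) ≤ n := by exact_mod_cast hn
      nlinarith
  · have hfin : ∀ᵐ t, expWeight 1 t * f t < ∞ :=
      ae_lt_top ((measurable_expWeight _).mul hfm) hbound
    filter_upwards [hfin] with t ht
    rcases le_or_gt t 0 with h0 | h0
    · simp [hf t h0]
    · have hft : f t ≠ ∞ := fun h => by
        rw [h, ENNReal.mul_top (expWeight_ne_zero _ _)] at ht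
        exact lt_irrefl _ ht
      have : Tendsto (fun n : ℕ => expWeight n t) atTop (𝓝 0) := by
        have h3 : Tendsto (fun n : ℕ => Real.exp (-(n : ℝ) * t)) atTop (𝓝 0) := by
          refine Real.tendsto_exp_atBot.comp ?_
          have : Tendsto (fun n : ℕ => (n : ℝ) * t) atTop atTop :=
            tendsto_natCast_atTop_atTop.atTop_mul_const h0
          refine (tendsto_neg_atTop_atBot.comp this).congr fun n => ?_
          simp
        simpa [expWeight] using ENNReal.tendsto_ofReal h3
      simpa using ENNReal.Tendsto.mul_const this (Or.inr hft)

/-- Kernels which are locally integrable and bounded away from the origin. -/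
structure IsTimeKernel (L : ℝ → ℝ≥0∞) : Prop where
  causal : Causal L
  measurable : Measurable L
  ne_top : ∀ t, L t ≠ ∞
  anti : AntitoneOn L (Ioi 0)
  lintegral_lt_top : ∀ T, ∫⁻ t in Iio T, L t < ∞

/-- A large rate makes convolution with `L` a strict contraction of the weighted `L¹` space.
Gronwall's lemma and the Neumann series rest on this. -/
lemma IsTimeKernel.exists_expWeight {L : ℝ → ℝ≥0∞} (hL : IsTimeKernel L) {ε : ℝ≥0∞}
    (hε : 0 < ε) : ∃ n : ℕ, ∫⁻ t, expWeight n t * L t < ε :=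
  ((tendsto_lintegral_expWeight hL.causal hL.measurable (hL.lintegral_lt_top 1) (hL.ne_top 1)
    fun t ht => hL.anti (by simp) (mem_Ioi.2 (by linarith)) ht).eventually_lt_const hε).exists

/-- **Gronwall's lemma** for Volterra inequalities. -/
lemma IsTimeKernel.gronwall {L φ : ℝ → ℝ≥0∞} (hL : IsTimeKernel L) (hφ : Causal φ)
    (hφm : Measurable φ) {T : ℝ} (hfin : ∫⁻ t in Iio T, φ t < ∞) {C : ℝ≥0∞} (hC : C ≠ ∞)
    (h : ∀ᵐ t, t < T → φ t ≤ C * (L ⋆ₗ φ) t) : ∀ᵐ t, t < T → φ t = 0 := by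
  -- With `C + 1` in place of `C` the bound also makes sense for `C = 0`, and `C / (C + 1) < 1`.
  obtain ⟨n, hn⟩ := hL.exists_expWeight (ε := (C + 1)⁻¹)
    (ENNReal.inv_pos.2 (ENNReal.add_ne_top.2 ⟨hC, ENNReal.one_ne_top⟩))
  set ψ := (Iio T).indicator φ with hψ
  have hψm : Measurable ψ := hφm.indicator measurableSet_Iio
  set I := ∫⁻ t, expWeight n t * ψ t with hI
  have hIfin : I ≠ ∞ := by
    refine (lt_of_le_of_lt (lintegral_mono fun t => ?_)
      ((lintegral_indicator measurableSet_Iio φ).trans_lt hfin)).ne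
    rcases le_or_gt t 0 with ht | ht
    · simp [hψ, indicator, hφ t ht]
    · refine mul_le_of_le_one_left bot_le ?_
      rw [expWeight, ENNReal.ofReal_le_one, Real.exp_le_one_iff]
      have : (0 : ℝ) ≤ n := n.cast_nonneg
      nlinarith
  -- The weighted integral `I` of the truncation is finite and bounded by itself times a factor
  -- below one, so it vanishes.
  have hle : I ≤ C * ((∫⁻ t, expWeight n t * L t) * I) := by
    rw [hI, ← lintegral_expWeight_mul_lconv n hL.measurable hψm,
      ← lintegral_const_mul _ (by
        have := hL.measurable
        have := measurable_expWeight n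
        fun_prop)]
    refine lintegral_mono_ae ?_
    filter_upwards [h] with t ht
    by_cases htT : t < T
    · rw [hψ, hL.causal.lconv_indicator_Iio φ htT.le, indicator_of_mem (mem_Iio.2 htT),
        mul_left_comm]
      gcongr
      exact ht htT
    · simp [hψ, htT]
  have hI0 : I = 0 := by
    by_contra hne
    have h1 : C * ∫⁻ t, expWeight n t * L t < 1 := by
      calc C * ∫⁻ t, expWeight n t * L t ≤ C * (C + 1)⁻¹ := by gcongr
        _ < 1 := by
          rw [← div_eq_mul_inv]
          refine ENNReal.div_lt_of_lt_mul ?_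
          rw [one_mul]
          exact ENNReal.lt_add_right hC one_ne_zero
    have h2 : C * ((∫⁻ t, expWeight n t * L t) * I) < 1 * I := by
      rw [← mul_assoc]
      exact ENNReal.mul_lt_mul_left hne hIfin h1
    rw [one_mul] at h2
    exact absurd (hle.trans_lt h2) (lt_irrefl _)
  have := (lintegral_eq_zero_iff ((measurable_expWeight n).mul hψm)).1 hI0
  filter_upwards [this] with t ht htT
  have h3 : expWeight n t * ψ t = 0 := ht
  rcases mul_eq_zero.1 h3 with h4 | h4
  · exact absurd h4 (expWeight_ne_zero _ _)
  · simpa [hψ, htT] using h4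

/-! ### Neumann series -/

/-- The terms `f ⋆ ⋯ ⋆ f ⋆ g` of the Neumann series of `P = g + f ⋆ P`. -/
noncomputable def neumannTerm (f g : ℝ → ℝ≥0∞) : ℕ → ℝ → ℝ≥0∞
  | 0 => g
  | n + 1 => f ⋆ₗ neumannTerm f g n

section neumann

variable {f g : ℝ → ℝ≥0∞}

lemma measurable_neumannTerm (hf : Measurable f) (hg : Measurable g) (n : ℕ) :
    Measurable (neumannTerm f g n) := by
  induction n with
  | zero => exact hg
  | succ n ih => exact measurable_lconvolution _ hf ih

lemma causal_neumannTerm (hf : Causal f) (hg : Causal g) (n : ℕ) :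
    Causal (neumannTerm f g n) := by
  induction n with
  | zero => exact hg
  | succ n ih => exact hf.lconv ih

/-- The Neumann series of the equation `P = g + f ⋆ P`. -/
noncomputable def neumannSeries (f g : ℝ → ℝ≥0∞) (t : ℝ) : ℝ≥0∞ := ∑' n, neumannTerm f g n t

lemma measurable_neumannSeries (hf : Measurable f) (hg : Measurable g) :
    Measurable (neumannSeries f g) :=
  Measurable.tsum fun n => measurable_neumannTerm hf hg n

lemma causal_neumannSeries (hf : Causal f) (hg : Causal g) : Causal (neumannSeries f g) :=
  fun t ht => by simp [neumannSeries, causal_neumannTerm hf hg _ t ht]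

lemma neumannSeries_eq (hf : Measurable f) (hg : Measurable g) :
    neumannSeries f g = g + f ⋆ₗ neumannSeries f g := by
  ext t
  have : (f ⋆ₗ neumannSeries f g) t = ∑' n, neumannTerm f g (n + 1) t :=
    lconv_tsum hf (measurable_neumannTerm hf hg) t
  rw [Pi.add_apply, this, neumannSeries, tsum_eq_zero_add' ENNReal.summable]
  rfl

/-- The weighted integrals of the terms form a geometric series. The Neumann series is thus
integrable as soon as the weighted integral of `f` is below one and that of `g` is finite. -/
lemma lintegral_expWeight_neumannSeries (hf : Measurable f) (hg : Measurable g) (lam : ℝ) :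
    ∫⁻ t, expWeight lam t * neumannSeries f g t =
      (1 - ∫⁻ t, expWeight lam t * f t)⁻¹ * ∫⁻ t, expWeight lam t * g t := by
  have hterm : ∀ n, ∫⁻ t, expWeight lam t * neumannTerm f g n t =
      (∫⁻ t, expWeight lam t * f t) ^ n * ∫⁻ t, expWeight lam t * g t := by
    intro n
    induction n with
    | zero => simp [neumannTerm]
    | succ n ih =>
      rw [neumannTerm, lintegral_expWeight_mul_lconv lam hf (measurable_neumannTerm hf hg n), ih]
      ring
  simp only [neumannSeries, ← ENNReal.tsum_mul_left]
  rw [lintegral_tsum fun n => (show Measurable fun t => expWeight lam t * neumannTerm f g n t from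
    (measurable_expWeight lam).mul (measurable_neumannTerm hf hg n)).aemeasurable]
  simp_rw [hterm]
  rw [ENNReal.tsum_mul_right, ENNReal.tsum_geometric]

end neumann

/-! ### A maximum principle for memory operators -/

/-- If `κ ⋆ u + c (1 ⋆ u)` is nondecreasing for a Lipschitz function `u` vanishing at the origin,
then `u` is nonnegative. -/
lemma nonneg_of_monotoneOn_memory {κ u F : ℝ → ℝ} {T c Λ : ℝ} (hκi : IntegrableOn κ (Ioc 0 T))
    (hκ0 : ∀ t, 0 < t → 0 ≤ κ t) (hκ : AntitoneOn κ (Ioi 0)) (hΛ : 0 ≤ Λ)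
    (hu : ∀ s ∈ Icc 0 T, ∀ t ∈ Icc 0 T, |u s - u t| ≤ Λ * |s - t|) (hu0 : u 0 = 0) (hc : 0 < c)
    (hF : MonotoneOn F (Icc 0 T))
    (heq : ∀ t ∈ Icc 0 T, (∫ s in (0 : ℝ)..t, κ s * u (t - s)) + c * ∫ s in (0 : ℝ)..t, u s = F t) :
    ∀ t ∈ Icc 0 T, 0 ≤ u t := by
  by_contra! hneg
  obtain ⟨t₁, ht₁, hut₁⟩ := hneg
  have huc : ContinuousOn u (Icc 0 T) := by
    have : LipschitzOnWith ⟨Λ, hΛ⟩ u (Icc 0 T) := LipschitzOnWith.of_dist_le_mul fun s hs t ht => by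
      exact hu s hs t ht
    exact this.continuousOn
  obtain ⟨t₀, ht₀, hmin⟩ := isCompact_Icc.exists_isMinOn ⟨t₁, ht₁⟩ huc
  set m := -u t₀ with hm
  have hmpos : 0 < m := by have := hmin ht₁; simp only [mem_ofPred_eq] at this; linarith
  have hge : ∀ s ∈ Icc 0 T, -m ≤ u s := fun s hs => by
    have := hmin hs; simp only [mem_ofPred_eq] at this; linarith
  have ht₀pos : 0 < t₀ := ht₀.1.lt_of_ne fun h => by rw [hm, ← h, hu0] at hmpos; simp at hmpos
  have hκI : ∀ a b, 0 ≤ a → a ≤ b → b ≤ T → IntervalIntegrable κ volume a b := by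
    intro a b ha hab hb
    rw [intervalIntegrable_iff_integrableOn_Ioc_of_le hab]
    exact hκi.mono_set (Ioc_subset_Ioc ha hb)
  have huI : ∀ a b, 0 ≤ a → a ≤ b → b ≤ T → IntervalIntegrable u volume a b := by
    intro a b ha hab hb
    refine ContinuousOn.intervalIntegrable ?_
    rw [uIcc_of_le hab]
    exact huc.mono (Icc_subset_Icc ha hb)
  set K : ℝ → ℝ := fun h => ∫ s in (0 : ℝ)..h, κ s with hK
  -- Compare `F` at the minimum point `t₀` and at `t₀ - h`. In the memory term at `t₀`, the ages `s
  -- < h` contribute at most `(-m + Λ h) K(h)`. The remaining ages, compared with the memory term at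
  -- `t₀ - h`, contribute at most `m K(h)` because `κ` decreases and `u ≥ -m`. The terms `m K(h)`
  -- cancel and leave `Λ h K(h)`, while the zero-order term contributes at most `c h (-m + Λ h)`. As
  -- `F` does not decrease, division by `h` gives the claim.
  have main : ∀ h ∈ Ioo 0 t₀, c * (m - Λ * h) ≤ Λ * K h := by
    intro h hh
    have hT := ht₀.2
    have huh : ∀ s ∈ Icc (0 : ℝ) h, u (t₀ - s) ≤ -m + Λ * h := by
      intro s hs
      have h1 := hu (t₀ - s) ⟨by linarith [hs.2, hh.2], by linarith [hs.1]⟩ t₀ ht₀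
      have h2 : |t₀ - s - t₀| = s := by rw [sub_sub_cancel_left, abs_neg, abs_of_nonneg hs.1]
      rw [h2] at h1
      have h3 := (abs_le.1 h1).2
      have h4 : Λ * s ≤ Λ * h := mul_le_mul_of_nonneg_left hs.2 hΛ
      linarith
    have hprod : ∀ a b, 0 ≤ a → a ≤ b → b ≤ t₀ →
        IntervalIntegrable (fun s => κ s * u (t₀ - s)) volume a b := by
      intro a b ha hab hb
      refine (hκI a b ha hab (hb.trans hT)).mul_continuousOn ?_
      rw [uIcc_of_le hab]
      refine huc.comp (continuous_const.sub continuous_id).continuousOn fun s hs => ?_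
      exact ⟨by linarith [hs.2], by linarith [hs.1]⟩
    have hsplit : (∫ s in (0 : ℝ)..t₀, κ s * u (t₀ - s)) =
        (∫ s in (0 : ℝ)..h, κ s * u (t₀ - s)) +
          ∫ s in (0 : ℝ)..(t₀ - h), κ (s + h) * u (t₀ - h - s) := by
      rw [← intervalIntegral.integral_add_adjacent_intervals (hprod 0 h le_rfl hh.1.le hh.2.le)
        (hprod h t₀ hh.1.le hh.2.le le_rfl)]
      congr 1
      have := intervalIntegral.integral_comp_add_right (a := 0) (b := t₀ - h)
        (fun s => κ s * u (t₀ - s)) h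
      rw [zero_add, sub_add_cancel] at this
      rw [← this]
      refine intervalIntegral.integral_congr fun s _ => ?_
      simp only [sub_sub, add_comm h s]
    have hκs : IntervalIntegrable (fun s => κ (s + h)) volume 0 (t₀ - h) := by
      have := (hκI h t₀ hh.1.le hh.2.le hT).comp_add_right h
      simpa using this
    have hu' : ContinuousOn (fun s => u (t₀ - h - s)) (uIcc 0 (t₀ - h)) := by
      rw [uIcc_of_le (by linarith [hh.2])]
      refine huc.comp (continuous_const.sub continuous_id).continuousOn fun s hs => ?_
      exact ⟨by linarith [hs.2], by linarith [hs.1, hh.1]⟩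
    have hκ' := hκI 0 (t₀ - h) le_rfl (by linarith [hh.2]) (by linarith [hh.1])
    have h1 : (∫ s in (0 : ℝ)..h, κ s * u (t₀ - s)) ≤ (-m + Λ * h) * K h := by
      rw [mul_comm, hK, ← intervalIntegral.integral_mul_const]
      refine intervalIntegral.integral_mono_on_of_le_Ioo hh.1.le (hprod 0 h le_rfl hh.1.le hh.2.le)
        ((hκI 0 h le_rfl hh.1.le (hh.2.le.trans hT)).mul_const _) fun s hs => ?_
      exact mul_le_mul_of_nonneg_left (huh s (Ioo_subset_Icc_self hs)) (hκ0 s hs.1)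
    have h2 : (∫ s in (0 : ℝ)..(t₀ - h), κ (s + h) * u (t₀ - h - s)) -
        (∫ s in (0 : ℝ)..(t₀ - h), κ s * u (t₀ - h - s)) ≤ m * K h := by
      rw [← intervalIntegral.integral_sub (hκs.mul_continuousOn hu') (hκ'.mul_continuousOn hu')]
      have h3 : (∫ s in (0 : ℝ)..(t₀ - h), (κ (s + h) * u (t₀ - h - s) - κ s * u (t₀ - h - s))) ≤
          ∫ s in (0 : ℝ)..(t₀ - h), (κ (s + h) - κ s) * (-m) := by
        refine intervalIntegral.integral_mono_on_of_le_Ioo (by linarith [hh.2])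
          ((hκs.mul_continuousOn hu').sub (hκ'.mul_continuousOn hu'))
          ((hκs.sub hκ').mul_const _) fun s hs => ?_
        rw [← sub_mul]
        have ha : κ (s + h) ≤ κ s :=
          hκ (mem_Ioi.2 hs.1) (mem_Ioi.2 (by linarith [hs.1, hh.1])) (by linarith [hh.1])
        exact mul_le_mul_of_nonpos_left
          (hge _ ⟨by linarith [hs.2], by linarith [hs.1, hh.1]⟩) (by linarith)
      refine h3.trans ?_
      rw [intervalIntegral.integral_mul_const, intervalIntegral.integral_sub hκs hκ',
        intervalIntegral.integral_comp_add_right (fun s => κ s) h, zero_add, sub_add_cancel]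
      -- The integral of `κ(s + h) - κ(s)` telescopes to the integral of `κ` over the last window
      -- `(t₀ - h, t₀)` minus `K(h)`, and the former is nonnegative.
      have e1 := intervalIntegral.integral_add_adjacent_intervals
        (hκI 0 h le_rfl hh.1.le (hh.2.le.trans hT)) (hκI h t₀ hh.1.le hh.2.le hT)
      have e2 := intervalIntegral.integral_add_adjacent_intervals hκ'
        (hκI (t₀ - h) t₀ (by linarith [hh.2]) (by linarith [hh.1]) hT)
      have e3 : 0 ≤ ∫ s in (t₀ - h)..t₀, κ s :=
        intervalIntegral.integral_nonneg_of_ae_restrict (by linarith [hh.1]) (by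
          filter_upwards [ae_restrict_mem measurableSet_Icc] with s hs
          exact hκ0 s (by linarith [hs.1, hh.2]))
      simp only [hK]
      nlinarith
    have h4 : F (t₀ - h) ≤ F t₀ :=
      hF ⟨by linarith [hh.2], by linarith [hh.1]⟩ ht₀ (by linarith [hh.1])
    rw [← heq t₀ ht₀, ← heq (t₀ - h) ⟨by linarith [hh.2], by linarith [hh.1]⟩, hsplit,
      ← intervalIntegral.integral_add_adjacent_intervals
        (huI 0 (t₀ - h) le_rfl (by linarith [hh.2]) (by linarith [hh.1]))
        (huI (t₀ - h) t₀ (by linarith [hh.2]) (by linarith [hh.1]) hT)] at h4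
    have h5 : (∫ s in (t₀ - h)..t₀, u s) ≤ h * (-m + Λ * h) := by
      have : (∫ s in (t₀ - h)..t₀, u s) ≤ ∫ s in (t₀ - h)..t₀, (-m + Λ * h) := by
        refine intervalIntegral.integral_mono_on_of_le_Ioo (by linarith [hh.1])
          (huI (t₀ - h) t₀ (by linarith [hh.2]) (by linarith [hh.1]) hT)
          intervalIntegrable_const fun s hs => ?_
        have := huh (t₀ - s) ⟨by linarith [hs.2], by linarith [hs.1]⟩
        rwa [sub_sub_cancel] at this
      rwa [intervalIntegral.integral_const, smul_eq_mul, sub_sub_cancel] at this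
    have h6 : c * (∫ s in (t₀ - h)..t₀, u s) ≤ c * (h * (-m + Λ * h)) :=
      mul_le_mul_of_nonneg_left h5 hc.le
    have h7 : h * (c * (m - Λ * h)) ≤ h * (Λ * K h) := by nlinarith
    exact le_of_mul_le_mul_left h7 hh.1
  -- Integrability of `κ` at the origin gives `K(h) → 0`, so `main` becomes `c m ≤ 0` in the limit,
  -- a contradiction.
  have hKlim : Tendsto K (𝓝[Ioo 0 t₀] 0) (𝓝 0) := by
    have h1 : ContinuousOn K (Icc 0 t₀) := by
      have := intervalIntegral.continuousOn_primitive_interval (μ := volume) (f := κ)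
        (a := 0) (b := t₀) (by
          rw [uIcc_of_le ht₀pos.le, integrableOn_Icc_iff_integrableOn_Ioc]
          exact hκi.mono_set (Ioc_subset_Ioc_right ht₀.2))
      rwa [uIcc_of_le ht₀pos.le] at this
    have h2 := h1 0 ⟨le_rfl, ht₀pos.le⟩
    have h3 : K 0 = 0 := by simp [hK]
    rw [ContinuousWithinAt, h3] at h2
    exact h2.mono_left (nhdsWithin_mono _ Ioo_subset_Icc_self)
  have hid : Tendsto (fun h : ℝ => h) (𝓝[Ioo 0 t₀] 0) (𝓝 0) := nhdsWithin_le_nhds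
  have : (𝓝[Ioo 0 t₀] (0 : ℝ)).NeBot := left_nhdsWithin_Ioo_neBot ht₀pos
  have hlim := le_of_tendsto_of_tendsto ((tendsto_const_nhds.sub (hid.const_mul Λ)).const_mul c)
    (hKlim.const_mul Λ) (eventually_nhdsWithin_of_forall main)
  simp only [mul_zero, sub_zero] at hlim
  nlinarith [mul_pos hc hmpos]

/-! ### Real-valued convolutions -/

section toReal

variable {f g : ℝ → ℝ≥0∞}

lemma integrable_toReal_mul_toReal (hfm : Measurable f)
    (hgm : Measurable g) {t : ℝ} (h : (f ⋆ₗ g) t ≠ ∞) :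
    Integrable (fun s => (f s).toReal * (g (t - s)).toReal) := by
  rw [lconv_eq_lintegral] at h
  have := integrable_toReal_of_lintegral_ne_top (μ := volume) (f := fun s => f s * g (t - s))
    (by fun_prop) h
  simpa [ENNReal.toReal_mul] using this

lemma Causal.integral_mul_toReal (hf : Causal f) (hg : Causal g) (hfm : Measurable f)
    (hgm : Measurable g) {t : ℝ} (ht : 0 ≤ t) (h : (f ⋆ₗ g) t ≠ ∞) :
    ∫ s in (0 : ℝ)..t, (f s).toReal * (g (t - s)).toReal = ((f ⋆ₗ g) t).toReal := by
  have h1 : ∫ s in (0 : ℝ)..t, (f s).toReal * (g (t - s)).toReal =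
      ∫ s, (f s).toReal * (g (t - s)).toReal := by
    rw [intervalIntegral.integral_of_le ht]
    refine setIntegral_eq_integral_of_forall_compl_eq_zero fun s hs => ?_
    rcases le_or_gt s 0 with h0 | h0
    · simp [hf s h0]
    · have : t < s := not_le.1 fun h => hs ⟨h0, h⟩
      simp [hg (t - s) (by linarith)]
  rw [h1, lconv_eq_lintegral] at *
  rw [← integral_toReal (by fun_prop) (ae_lt_top (by fun_prop) h)]
  simp [ENNReal.toReal_mul]

end toReal

/-! ### Primitives of nonnegative functions -/

lemma Causal.le_heaviside {G : ℝ → ℝ≥0∞} (hG : Causal G) (hG1 : ∀ t, G t ≤ 1) : G ≤ heaviside := by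
  intro t
  rcases le_or_gt t 0 with h | h
  · simp [hG t h]
  · simpa [heaviside_of_pos h] using hG1 t

lemma heaviside_lconv_mono (f : ℝ → ℝ≥0∞) : Monotone (heaviside ⋆ₗ f) := fun s t hst => by
  rw [heaviside_lconv, heaviside_lconv]
  exact lintegral_mono_set (Iio_subset_Iio hst)

lemma heaviside_lconv_eq_add (f : ℝ → ℝ≥0∞) {s t : ℝ} (hst : s ≤ t) :
    (heaviside ⋆ₗ f) t = (heaviside ⋆ₗ f) s + ∫⁻ x in Ico s t, f x := by
  rw [heaviside_lconv, heaviside_lconv, ← lintegral_union measurableSet_Ico, Iio_union_Ico_eq_Iio hst]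
  exact (Iio_disjoint_Ici le_rfl).mono_right Ico_subset_Ici_self

lemma setLIntegral_Ico_le_of_le {f : ℝ → ℝ≥0∞} {s t : ℝ} {C : ℝ≥0∞} (hC : ∀ x < t, f x ≤ C) :
    ∫⁻ x in Ico s t, f x ≤ C * ENNReal.ofReal (t - s) := by
  calc ∫⁻ x in Ico s t, f x ≤ ∫⁻ _ in Ico s t, C :=
        setLIntegral_mono measurable_const fun x hx => hC x hx.2
    _ = C * ENNReal.ofReal (t - s) := by simp

lemma Causal.heaviside_lconv_le {f : ℝ → ℝ≥0∞} (hf : Causal f) {t : ℝ} {C : ℝ≥0∞}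
    (hC : ∀ x < t, f x ≤ C) : (heaviside ⋆ₗ f) t ≤ C * ENNReal.ofReal t := by
  rcases le_or_gt t 0 with h | h
  · simp [causal_heaviside.lconv hf t h]
  · rw [heaviside_lconv_eq_add f h.le, causal_heaviside.lconv hf 0 le_rfl, zero_add]
    simpa using setLIntegral_Ico_le_of_le (s := 0) hC

lemma Causal.heaviside_lconv_ne_top {f : ℝ → ℝ≥0∞} (hf : Causal f) {t : ℝ} {C : ℝ≥0∞}
    (hC : ∀ x < t, f x ≤ C) (hCt : C ≠ ∞) : (heaviside ⋆ₗ f) t ≠ ∞ :=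
  ((hf.heaviside_lconv_le hC).trans_lt (ENNReal.mul_lt_top hCt.lt_top ENNReal.ofReal_lt_top)).ne

/-- Only continuity from below of the measure with density `f` is used, so no finiteness is needed.
-/
lemma tendsto_heaviside_lconv_left (f : ℝ → ℝ≥0∞) (t : ℝ) :
    Tendsto (fun n : ℕ => (heaviside ⋆ₗ f) (t - 1 / (n + 1))) atTop
      (𝓝 ((heaviside ⋆ₗ f) t)) := by
  simp_rw [heaviside_lconv]
  have h1 : ∀ x : ℝ, ∫⁻ s in Iio x, f s = (volume.withDensity f) (Iio x) := fun x =>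
    (withDensity_apply f measurableSet_Iio).symm
  simp_rw [h1]
  have h2 : Iio t = ⋃ n : ℕ, Iio (t - 1 / ((n : ℝ) + 1)) := by
    ext x
    simp only [mem_Iio, mem_iUnion]
    refine ⟨fun hx => ?_, fun ⟨n, hn⟩ => hn.trans (sub_lt_self _ (by positivity))⟩
    obtain ⟨n, hn⟩ := exists_nat_one_div_lt (sub_pos.2 hx)
    exact ⟨n, by linarith⟩
  rw [h2]
  refine tendsto_measure_iUnion_atTop fun m n hmn => Iio_subset_Iio ?_
  have : (1 : ℝ) / (n + 1) ≤ 1 / (m + 1) := by gcongr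
  linarith

lemma Causal.integral_toReal {f : ℝ → ℝ≥0∞} (hf : Causal f) (hfm : Measurable f) {t : ℝ}
    (ht : 0 ≤ t) (h : (heaviside ⋆ₗ f) t ≠ ∞) :
    ∫ s in (0 : ℝ)..t, (f s).toReal = ((heaviside ⋆ₗ f) t).toReal := by
  rw [heaviside_lconv, hf.setLIntegral_Iio, setLIntegral_congr Ioo_ae_eq_Ioc] at *
  rw [intervalIntegral.integral_of_le ht,
    MeasureTheory.integral_toReal hfm.aemeasurable (ae_lt_top hfm h)]

lemma Causal.intervalIntegrable_toReal {f : ℝ → ℝ≥0∞} (hf : Causal f) (hfm : Measurable f) {t : ℝ}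
    (ht : 0 ≤ t) (h : (heaviside ⋆ₗ f) t ≠ ∞) :
    IntervalIntegrable (fun s => (f s).toReal) volume 0 t := by
  rw [heaviside_lconv, hf.setLIntegral_Iio, setLIntegral_congr Ioo_ae_eq_Ioc] at h
  rw [intervalIntegrable_iff_integrableOn_Ioc_of_le ht]
  exact integrable_toReal_of_lintegral_ne_top hfm.aemeasurable h

/-- Supplies the Lipschitz hypothesis of the maximum principle. -/
lemma abs_toReal_heaviside_lconv_sub_le {a : ℝ → ℝ≥0∞} {T : ℝ} {C : ℝ≥0∞}
    (hC : ∀ x < T, a x ≤ C) (hCt : C ≠ ∞) (hfin : ∀ t ≤ T, (heaviside ⋆ₗ a) t ≠ ∞) {s t : ℝ}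
    (hs : s ≤ T) (ht : t ≤ T) :
    |((heaviside ⋆ₗ a) s).toReal - ((heaviside ⋆ₗ a) t).toReal| ≤ C.toReal * |s - t| := by
  wlog hst : s ≤ t generalizing s t
  · rw [abs_sub_comm, abs_sub_comm s t]
    exact this ht hs (not_le.1 hst).le
  have h1 := heaviside_lconv_eq_add a hst
  have h2 : ∫⁻ x in Ico s t, a x ≤ C * ENNReal.ofReal (t - s) :=
    setLIntegral_Ico_le_of_le fun x hx => hC x (hx.trans_le ht)
  have h3 : ∫⁻ x in Ico s t, a x ≠ ∞ :=
    (h2.trans_lt (ENNReal.mul_lt_top hCt.lt_top ENNReal.ofReal_lt_top)).ne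
  have h4 := ENNReal.toReal_mono (ENNReal.mul_ne_top hCt ENNReal.ofReal_ne_top) h2
  rw [ENNReal.toReal_mul, ENNReal.toReal_ofReal (sub_nonneg.2 hst)] at h4
  rw [h1, ENNReal.toReal_add (hfin s hs) h3, sub_add_cancel_left, abs_neg, abs_sub_comm s t,
    abs_of_nonneg ENNReal.toReal_nonneg, abs_of_nonneg (sub_nonneg.2 hst)]
  exact h4

/-! ### Sonine pairs and their resolvents -/

/-- A pair of time kernels with `K ⋆ L = 1`. -/
structure IsSoninePair (K L : ℝ → ℝ≥0∞) : Prop where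
  left : IsTimeKernel K
  right : IsTimeKernel L
  lconv_eq : K ⋆ₗ L = heaviside

/-! ### Comparison for the equation `K ⋆ u + c (1 ⋆ u) = F`. -/

section comparison

variable {K Pe Po G₁ G₂ : ℝ → ℝ≥0∞} {c : ℝ≥0}

/-- Comparison of the positive and negative parts of the solution of a memory equation. -/
lemma IsTimeKernel.lconv_add_lconv_le (hK : IsTimeKernel K) (hc : 0 < c)
    (hPe : Causal Pe) (hPo : Causal Po) (hPem : Measurable Pe) (hPom : Measurable Po)
    (hPei : ∀ T, ∫⁻ t in Iio T, Pe t < ∞) (hPoi : ∀ T, ∫⁻ t in Iio T, Po t < ∞)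
    (he : K ⋆ₗ Pe = heaviside + (c : ℝ≥0∞) • (heaviside ⋆ₗ Po))
    (ho : K ⋆ₗ Po = (c : ℝ≥0∞) • (heaviside ⋆ₗ Pe))
    (hG₁ : Causal G₁) (hG₂ : Causal G₂) (hG₁m : Measurable G₁) (hG₂m : Measurable G₂)
    (hG₁1 : ∀ t, G₁ t ≤ 1) (hG₂1 : ∀ t, G₂ t ≤ 1) (hG : heaviside ⋆ₗ G₂ ≤ heaviside ⋆ₗ G₁) :
    Po ⋆ₗ (heaviside ⋆ₗ G₁) + Pe ⋆ₗ (heaviside ⋆ₗ G₂) ≤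
      Pe ⋆ₗ (heaviside ⋆ₗ G₁) + Po ⋆ₗ (heaviside ⋆ₗ G₂) := by
  have hHm := measurable_heaviside
  have hH := causal_heaviside
  have hKm := hK.measurable
  have hX₁m : Measurable (heaviside ⋆ₗ G₁) := by fun_prop
  have hX₂m : Measurable (heaviside ⋆ₗ G₂) := by fun_prop
  have hX₁ : Causal (heaviside ⋆ₗ G₁) := hH.lconv hG₁
  have hX₂ : Causal (heaviside ⋆ₗ G₂) := hH.lconv hG₂
  -- The maximum principle is applied to `A - B = (Pe - Po) ⋆ H ⋆ (G₁ - G₂)`, with all terms sorted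
  -- by sign. The extra convolution with `H ⋆ G` makes this function Lipschitz, which `Pe - Po`
  -- itself need not be.
  set A := Pe ⋆ₗ (heaviside ⋆ₗ G₁) + Po ⋆ₗ (heaviside ⋆ₗ G₂) with hA
  set B := Po ⋆ₗ (heaviside ⋆ₗ G₁) + Pe ⋆ₗ (heaviside ⋆ₗ G₂) with hB
  have hAm : Measurable A := by rw [hA]; fun_prop
  have hBm : Measurable B := by rw [hB]; fun_prop
  have hAc : Causal A := (hPe.lconv hX₁).add (hPo.lconv hX₂)
  have hBc : Causal B := (hPo.lconv hX₁).add (hPe.lconv hX₂)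
  have heX : ∀ X, Measurable X → K ⋆ₗ (Pe ⋆ₗ X) =
      heaviside ⋆ₗ X + (c : ℝ≥0∞) • (heaviside ⋆ₗ (Po ⋆ₗ X)) := fun X hX => by
    rw [lconvolution_assoc hKm hPem hX, he, add_lconv hHm hX,
      const_smul_lconv (by fun_prop) hX, lconvolution_assoc hHm hPom hX]
  have hoX : ∀ X, Measurable X → K ⋆ₗ (Po ⋆ₗ X) = (c : ℝ≥0∞) • (heaviside ⋆ₗ (Pe ⋆ₗ X)) :=
    fun X hX => by
      rw [lconvolution_assoc hKm hPom hX, ho, const_smul_lconv (by fun_prop) hX,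
        lconvolution_assoc hHm hPem hX]
  -- Subtracting the two identities gives `K ⋆ (A - B) + c H ⋆ (A - B) = H ⋆ (H ⋆ G₁ - H ⋆ G₂)`, a
  -- primitive of a nonnegative function.
  have hKA : K ⋆ₗ A = heaviside ⋆ₗ (heaviside ⋆ₗ G₁) + (c : ℝ≥0∞) • (heaviside ⋆ₗ B) := by
    rw [hA, lconv_add hKm (by fun_prop), heX _ hX₁m, hoX _ hX₂m, hB,
      lconv_add hHm (by fun_prop), smul_add, add_assoc]
  have hKB : K ⋆ₗ B = heaviside ⋆ₗ (heaviside ⋆ₗ G₂) + (c : ℝ≥0∞) • (heaviside ⋆ₗ A) := by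
    rw [hB, lconv_add hKm (by fun_prop), heX _ hX₂m, hoX _ hX₁m, hA,
      lconv_add hHm (by fun_prop), smul_add, add_left_comm]
  intro T
  rcases le_or_gt T 0 with hT | hT
  · rw [hBc T hT]; exact bot_le
  set C := (∫⁻ t in Iio T, Pe t) + ∫⁻ t in Iio T, Po t with hC
  have hCt : C ≠ ∞ := (ENNReal.add_lt_top.2 ⟨hPei T, hPoi T⟩).ne
  have hbound : ∀ P : ℝ → ℝ≥0∞, ∀ G, Causal G → (∀ t, G t ≤ 1) → ∀ x < T,
      (P ⋆ₗ G) x ≤ ∫⁻ t in Iio T, P t := fun P G hGc hG1 x hx =>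
    calc (P ⋆ₗ G) x ≤ (P ⋆ₗ heaviside) x := lconv_mono le_rfl (hGc.le_heaviside hG1) x
      _ = ∫⁻ t in Iio x, P t := by rw [lconvolution_comm, heaviside_lconv]
      _ ≤ _ := lintegral_mono_set (Iio_subset_Iio hx.le)
  -- Moving `H` to the outside exhibits `A` and `B` as primitives of functions bounded before `T`.
  have hshift : ∀ P G : ℝ → ℝ≥0∞, Measurable P → Measurable G →
      P ⋆ₗ (heaviside ⋆ₗ G) = heaviside ⋆ₗ (P ⋆ₗ G) := fun P G hP hG' => by
    rw [lconvolution_assoc hP hHm hG', lconvolution_comm (f := P), ← lconvolution_assoc hHm hP hG']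
  have hAa : A = heaviside ⋆ₗ (Pe ⋆ₗ G₁ + Po ⋆ₗ G₂) := by
    rw [hA, lconv_add hHm (by fun_prop), hshift _ _ hPem hG₁m, hshift _ _ hPom hG₂m]
  have hBb : B = heaviside ⋆ₗ (Po ⋆ₗ G₁ + Pe ⋆ₗ G₂) := by
    rw [hB, lconv_add hHm (by fun_prop), hshift _ _ hPom hG₁m, hshift _ _ hPem hG₂m]
  have haC : ∀ x < T, (Pe ⋆ₗ G₁ + Po ⋆ₗ G₂) x ≤ C := fun x hx =>
    add_le_add (hbound Pe G₁ hG₁ hG₁1 x hx) (hbound Po G₂ hG₂ hG₂1 x hx)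
  have hbC : ∀ x < T, (Po ⋆ₗ G₁ + Pe ⋆ₗ G₂) x ≤ C := fun x hx =>
    (add_le_add (hbound Po G₁ hG₁ hG₁1 x hx) (hbound Pe G₂ hG₂ hG₂1 x hx)).trans
      (add_comm _ _).le
  have hac : Causal (Pe ⋆ₗ G₁ + Po ⋆ₗ G₂) := (hPe.lconv hG₁).add (hPo.lconv hG₂)
  have hbc : Causal (Po ⋆ₗ G₁ + Pe ⋆ₗ G₂) := (hPo.lconv hG₁).add (hPe.lconv hG₂)
  have hAle : ∀ t ≤ T, A t ≤ C * ENNReal.ofReal T := fun t ht => by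
    rw [hAa]
    exact (hac.heaviside_lconv_le fun x hx => haC x (hx.trans_le ht)).trans (by gcongr)
  have hBle : ∀ t ≤ T, B t ≤ C * ENNReal.ofReal T := fun t ht => by
    rw [hBb]
    exact (hbc.heaviside_lconv_le fun x hx => hbC x (hx.trans_le ht)).trans (by gcongr)
  have hCT : C * ENNReal.ofReal T ≠ ∞ := ENNReal.mul_ne_top hCt ENNReal.ofReal_ne_top
  have hAt : ∀ t ≤ T, A t ≠ ∞ := fun t ht => ((hAle t ht).trans_lt hCT.lt_top).ne
  have hBt : ∀ t ≤ T, B t ≠ ∞ := fun t ht => ((hBle t ht).trans_lt hCT.lt_top).ne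
  have hHA : ∀ t ≤ T, (heaviside ⋆ₗ A) t ≠ ∞ := fun t ht =>
    hAc.heaviside_lconv_ne_top (fun x hx => hAle x (hx.le.trans ht)) hCT
  have hHB : ∀ t ≤ T, (heaviside ⋆ₗ B) t ≠ ∞ := fun t ht =>
    hBc.heaviside_lconv_ne_top (fun x hx => hBle x (hx.le.trans ht)) hCT
  have hXle : ∀ G, Causal G → (∀ t, G t ≤ 1) → ∀ t ≤ T, (heaviside ⋆ₗ G) t ≤ ENNReal.ofReal T :=
    fun G hGc hG1 t ht => by
      refine (hGc.heaviside_lconv_le (C := 1) fun x _ => hG1 x).trans ?_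
      rw [one_mul]
      exact ENNReal.ofReal_le_ofReal ht
  have hHX : ∀ G, Causal G → (∀ t, G t ≤ 1) → ∀ t ≤ T, (heaviside ⋆ₗ (heaviside ⋆ₗ G)) t ≠ ∞ :=
    fun G hGc hG1 t ht => (hH.lconv hGc).heaviside_lconv_ne_top
      (fun x hx => hXle G hGc hG1 x (hx.le.trans ht)) ENNReal.ofReal_ne_top
  have hKAt : ∀ t ≤ T, (K ⋆ₗ A) t ≠ ∞ := fun t ht => by
    rw [hKA]
    exact ENNReal.add_ne_top.2 ⟨hHX G₁ hG₁ hG₁1 t ht, ENNReal.mul_ne_top ENNReal.coe_ne_top (hHB t ht)⟩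
  have hKBt : ∀ t ≤ T, (K ⋆ₗ B) t ≠ ∞ := fun t ht => by
    rw [hKB]
    exact ENNReal.add_ne_top.2 ⟨hHX G₂ hG₂ hG₂1 t ht, ENNReal.mul_ne_top ENNReal.coe_ne_top (hHA t ht)⟩
  have hmax := nonneg_of_monotoneOn_memory (κ := fun s => (K s).toReal)
    (u := fun t => (A t).toReal - (B t).toReal)
    (F := fun t => ((heaviside ⋆ₗ (heaviside ⋆ₗ G₁)) t).toReal -
      ((heaviside ⋆ₗ (heaviside ⋆ₗ G₂)) t).toReal) (T := T) (c := c) (Λ := C.toReal + C.toReal)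
    ?_ (fun t _ => ENNReal.toReal_nonneg)
    (fun s hs t ht hst => ENNReal.toReal_mono (hK.ne_top s) (hK.anti hs ht hst)) (by positivity)
    ?_ (by simp [hAc 0 le_rfl, hBc 0 le_rfl]) (by exact_mod_cast hc) ?_ ?_ T ⟨hT.le, le_rfl⟩
  · have h1 : (B T).toReal ≤ (A T).toReal := by simpa using hmax
    exact (ENNReal.toReal_le_toReal (hBt T le_rfl) (hAt T le_rfl)).1 h1
  · have h1 := hK.lintegral_lt_top T
    rw [hK.causal.setLIntegral_Iio, setLIntegral_congr Ioo_ae_eq_Ioc] at h1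
    exact integrable_toReal_of_lintegral_ne_top hKm.aemeasurable h1.ne
  · intro s hs t ht
    have h1 := abs_toReal_heaviside_lconv_sub_le haC hCt (fun t ht => hAa ▸ hAt t ht) hs.2 ht.2
    have h2 := abs_toReal_heaviside_lconv_sub_le hbC hCt (fun t ht => hBb ▸ hBt t ht) hs.2 ht.2
    rw [← hAa] at h1
    rw [← hBb] at h2
    calc |(A s).toReal - (B s).toReal - ((A t).toReal - (B t).toReal)|
        = |((A s).toReal - (A t).toReal) - ((B s).toReal - (B t).toReal)| := by congr 1; ring
      _ ≤ |(A s).toReal - (A t).toReal| + |(B s).toReal - (B t).toReal| := abs_sub _ _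
      _ ≤ _ := by rw [add_mul]; exact add_le_add h1 h2
  · intro s hs t ht hst
    have key : ∀ G, Causal G → (∀ t, G t ≤ 1) → ∫⁻ x in Ico s t, (heaviside ⋆ₗ G) x ≠ ∞ :=
      fun G hGc hG1 => by
        have := hHX G hGc hG1 t ht.2
        rw [heaviside_lconv_eq_add _ hst] at this
        exact (ENNReal.add_ne_top.1 this).2
    have h1 : ∫⁻ x in Ico s t, (heaviside ⋆ₗ G₂) x ≤ ∫⁻ x in Ico s t, (heaviside ⋆ₗ G₁) x :=
      lintegral_mono fun x => hG x
    have h2 := ENNReal.toReal_mono (key G₁ hG₁ hG₁1) h1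
    simp only [heaviside_lconv_eq_add (heaviside ⋆ₗ G₁) hst,
      heaviside_lconv_eq_add (heaviside ⋆ₗ G₂) hst]
    rw [ENNReal.toReal_add (hHX G₁ hG₁ hG₁1 s hs.2) (key G₁ hG₁ hG₁1),
      ENNReal.toReal_add (hHX G₂ hG₂ hG₂1 s hs.2) (key G₂ hG₂ hG₂1)]
    linarith
  · intro t ht
    have h1 : ∫ s in (0 : ℝ)..t, (K s).toReal * ((A (t - s)).toReal - (B (t - s)).toReal) =
        ((K ⋆ₗ A) t).toReal - ((K ⋆ₗ B) t).toReal := by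
      simp_rw [mul_sub]
      rw [intervalIntegral.integral_sub
        (integrable_toReal_mul_toReal hKm hAm (hKAt t ht.2)).intervalIntegrable
        (integrable_toReal_mul_toReal hKm hBm (hKBt t ht.2)).intervalIntegrable,
        hK.causal.integral_mul_toReal hAc hKm hAm ht.1 (hKAt t ht.2),
        hK.causal.integral_mul_toReal hBc hKm hBm ht.1 (hKBt t ht.2)]
    have h2 : ∫ s in (0 : ℝ)..t, ((A s).toReal - (B s).toReal) =
        ((heaviside ⋆ₗ A) t).toReal - ((heaviside ⋆ₗ B) t).toReal := by
      rw [intervalIntegral.integral_sub (hAc.intervalIntegrable_toReal hAm ht.1 (hHA t ht.2))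
        (hBc.intervalIntegrable_toReal hBm ht.1 (hHB t ht.2)),
        hAc.integral_toReal hAm ht.1 (hHA t ht.2), hBc.integral_toReal hBm ht.1 (hHB t ht.2)]
    rw [h1, h2, hKA, hKB]
    simp only [Pi.add_apply, Pi.smul_apply, smul_eq_mul]
    rw [ENNReal.toReal_add (hHX G₁ hG₁ hG₁1 t ht.2)
        (ENNReal.mul_ne_top ENNReal.coe_ne_top (hHB t ht.2)),
      ENNReal.toReal_add (hHX G₂ hG₂ hG₂1 t ht.2)
        (ENNReal.mul_ne_top ENNReal.coe_ne_top (hHA t ht.2)), ENNReal.toReal_mul,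
      ENNReal.toReal_mul, ENNReal.coe_toReal]
    ring

end comparison

lemma Monotone.nonneg_of_hasDerivAt {f : ℝ → ℝ} (hf : Monotone f) {x f' : ℝ}
    (h : HasDerivAt f f' x) : 0 ≤ f' := by
  refine _root_.ge_of_tendsto (hasDerivAt_iff_tendsto_slope.1 h) (eventually_nhdsWithin_of_forall ?_)
  intro y _
  rw [slope_def_field]
  rcases le_total x y with hxy | hxy
  · exact div_nonneg (sub_nonneg.2 (hf hxy)) (sub_nonneg.2 hxy)
  · exact div_nonneg_of_nonpos (sub_nonpos.2 (hf hxy)) (sub_nonpos.2 hxy)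

lemma heaviside_lconv_indicator_Ioo (b h x : ℝ) :
    (heaviside ⋆ₗ (Ioo b (b + h)).indicator 1) x = ENNReal.ofReal (min (b + h) x - b) := by
  rw [heaviside_lconv, lintegral_indicator_one measurableSet_Ioo,
    Measure.restrict_apply measurableSet_Ioo, Ioo_inter_Iio, Real.volume_Ioo]

/-- Together with the lower bound below, this traps the integral of a monotone function over a
window of length `h` between `h` times its values at the two ends, so the windows can be shrunk to
points. -/
lemma Monotone.lconv_indicator_Ioo_le {V : ℝ → ℝ≥0∞} (hV : Monotone V) (b h t : ℝ) :
    (V ⋆ₗ (Ioo b (b + h)).indicator 1) t ≤ V (t - b) * ENNReal.ofReal h := by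
  rw [lconv_eq_lintegral_sub]
  calc ∫⁻ s, V (t - s) * (Ioo b (b + h)).indicator 1 s
      ≤ ∫⁻ s, V (t - b) * (Ioo b (b + h)).indicator 1 s := by
        refine lintegral_mono fun s => ?_
        by_cases hs : s ∈ Ioo b (b + h)
        · simpa [hs] using hV (by linarith [hs.1])
        · simp [hs]
    _ = _ := by
      rw [lintegral_const_mul _ (measurable_one.indicator measurableSet_Ioo),
        lintegral_indicator_one measurableSet_Ioo, Real.volume_Ioo, add_sub_cancel_left]

lemma Monotone.le_lconv_indicator_Ioo {V : ℝ → ℝ≥0∞} (hV : Monotone V) (b h t : ℝ) :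
    V (t - b - h) * ENNReal.ofReal h ≤ (V ⋆ₗ (Ioo b (b + h)).indicator 1) t := by
  rw [lconv_eq_lintegral_sub]
  calc V (t - b - h) * ENNReal.ofReal h = ∫⁻ s, V (t - b - h) * (Ioo b (b + h)).indicator 1 s := by
        rw [lintegral_const_mul _ (measurable_one.indicator measurableSet_Ioo),
          lintegral_indicator_one measurableSet_Ioo, Real.volume_Ioo, add_sub_cancel_left]
    _ ≤ _ := by
        refine lintegral_mono fun s => ?_
        by_cases hs : s ∈ Ioo b (b + h)
        · simpa [hs] using hV (by linarith [hs.2])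
        · simp [hs]

/-! ### Positivity and existence of the resolvent. -/

section positivity

variable {K L Pe Po : ℝ → ℝ≥0∞} {c : ℝ≥0}

/-- The solution `Pe - Po` of a memory equation with a nondecreasing right-hand side is
nonnegative. -/
lemma IsTimeKernel.ae_le_of_memory_eq (hK : IsTimeKernel K) (hc : 0 < c)
    (hPe : Causal Pe) (hPo : Causal Po) (hPem : Measurable Pe) (hPom : Measurable Po)
    (hPei : ∀ T, ∫⁻ t in Iio T, Pe t < ∞) (hPoi : ∀ T, ∫⁻ t in Iio T, Po t < ∞)
    (he : K ⋆ₗ Pe = heaviside + (c : ℝ≥0∞) • (heaviside ⋆ₗ Po))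
    (ho : K ⋆ₗ Po = (c : ℝ≥0∞) • (heaviside ⋆ₗ Pe)) : Po ≤ᵐ[volume] Pe := by
  set Ve := heaviside ⋆ₗ Pe with hVe
  set Vo := heaviside ⋆ₗ Po with hVo
  have hVet : ∀ t, Ve t ≠ ∞ := fun t => by rw [hVe, heaviside_lconv]; exact (hPei t).ne
  have hVot : ∀ t, Vo t ≠ ∞ := fun t => by rw [hVo, heaviside_lconv]; exact (hPoi t).ne
  have hVem : Monotone Ve := heaviside_lconv_mono Pe
  have hVom : Monotone Vo := heaviside_lconv_mono Po
  -- In terms of signed values this says that the primitive `Ve - Vo` of `Pe - Po` is nondecreasing.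
  have key : ∀ t b : ℝ, 0 ≤ b → Ve (t - b) + Vo t ≤ Ve t + Vo (t - b) := by
    intro t b hb
    -- The comparison is used with the windows `(0, h)` and `(b, b + h)`, the earlier of which has
    -- the larger primitive. Monotonicity of `Ve` and `Vo` separately replaces window integrals by
    -- endpoint values, at the price of the shift by `h` on the left; left continuity removes it as
    -- `h → 0`.
    have step : ∀ h : ℝ, 0 < h → Ve (t - b - h) + Vo (t - h) ≤ Ve t + Vo (t - b) := by
      intro h hh
      have hcausal : ∀ b : ℝ, 0 ≤ b → Causal ((Ioo b (b + h)).indicator 1) := fun b hb s hs =>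
        indicator_of_notMem (fun h' => by linarith [h'.1]) _
      have hmeas : ∀ b : ℝ, Measurable ((Ioo b (b + h)).indicator (1 : ℝ → ℝ≥0∞)) := fun b =>
        measurable_one.indicator measurableSet_Ioo
      have hle1 : ∀ b s : ℝ, (Ioo b (b + h)).indicator (1 : ℝ → ℝ≥0∞) s ≤ 1 := fun b s =>
        indicator_le_self' (f := 1) (fun _ _ => zero_le) s
      have h1 := hK.lconv_add_lconv_le hc hPe hPo hPem hPom hPei hPoi he ho (hcausal 0 le_rfl)
        (hcausal b hb) (hmeas 0) (hmeas b) (hle1 0) (hle1 b) (fun x => by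
          rw [heaviside_lconv_indicator_Ioo, heaviside_lconv_indicator_Ioo]
          refine ENNReal.ofReal_le_ofReal ?_
          rcases le_total (b + h) x with hx | hx
          · rw [min_eq_left hx, min_eq_left (by linarith)]; linarith
          · rw [min_eq_right hx]
            rcases le_total (0 + h) x with hx' | hx'
            · rw [min_eq_left hx']; linarith
            · rw [min_eq_right hx']; linarith) t
      have hassoc : ∀ P G : ℝ → ℝ≥0∞, Measurable P → Measurable G →
          P ⋆ₗ (heaviside ⋆ₗ G) = (heaviside ⋆ₗ P) ⋆ₗ G := fun P G hP hG => by
        rw [lconvolution_assoc hP measurable_heaviside hG, lconvolution_comm (f := P)]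
      rw [hassoc _ _ hPom (hmeas 0), hassoc _ _ hPem (hmeas b), hassoc _ _ hPem (hmeas 0),
        hassoc _ _ hPom (hmeas b)] at h1
      have h2 := (add_le_add (hVom.le_lconv_indicator_Ioo 0 h t)
        (hVem.le_lconv_indicator_Ioo b h t)).trans (h1.trans
        (add_le_add (hVem.lconv_indicator_Ioo_le 0 h t) (hVom.lconv_indicator_Ioo_le b h t)))
      rw [← add_mul, ← add_mul, sub_zero] at h2
      have h3 := (ENNReal.mul_le_mul_iff_left (ENNReal.ofReal_pos.2 hh).ne' ENNReal.ofReal_ne_top).1 h2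
      rwa [add_comm] at h3
    have hlim : Tendsto (fun n : ℕ => Ve (t - b - 1 / (n + 1)) + Vo (t - 1 / (n + 1))) atTop
        (𝓝 (Ve (t - b) + Vo t)) :=
      (tendsto_heaviside_lconv_left Pe (t - b)).add (tendsto_heaviside_lconv_left Po t)
    exact le_of_tendsto' hlim fun n => step _ (by positivity)
  have hmono : Monotone fun t => (Ve t).toReal - (Vo t).toReal := by
    intro s t hst
    have h1 := key t (t - s) (sub_nonneg.2 hst)
    rw [sub_sub_cancel] at h1
    have h2 := ENNReal.toReal_mono (ENNReal.add_ne_top.2 ⟨hVet t, hVot s⟩) h1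
    rw [ENNReal.toReal_add (hVet _) (hVot _), ENNReal.toReal_add (hVet _) (hVot _)] at h2
    simp only
    linarith
  have hloc : ∀ P : ℝ → ℝ≥0∞, Measurable P → (∀ T, ∫⁻ t in Iio T, P t < ∞) →
      LocallyIntegrable fun s => (P s).toReal := fun P hP hPi x =>
    ⟨Iio (x + 1), Iio_mem_nhds (by linarith),
      integrable_toReal_of_lintegral_ne_top hP.aemeasurable (hPi _).ne⟩
  have hfin : ∀ P : ℝ → ℝ≥0∞, Measurable P → (∀ T, ∫⁻ t in Iio T, P t < ∞) → ∀ᵐ t, P t < ∞ := by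
    intro P hP hPi
    have h1 : ∀ n : ℕ, ∀ᵐ t, t ∈ Iio (n : ℝ) → P t < ∞ := fun n =>
      (ae_restrict_iff' measurableSet_Iio).1 (ae_lt_top hP (hPi n).ne)
    filter_upwards [ae_all_iff.2 h1] with t ht
    obtain ⟨n, hn⟩ := exists_nat_gt t
    exact ht n hn
  -- By Lebesgue differentiation `Pe - Po` is almost everywhere the derivative of a nondecreasing
  -- function.
  filter_upwards [LocallyIntegrable.ae_hasDerivAt_integral
      ((hloc Pe hPem hPei).sub (hloc Po hPom hPoi)),
    hfin Pe hPem hPei, hfin Po hPom hPoi] with t ht hte hto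
  rcases le_or_gt t 0 with h0 | h0
  · simp [hPo t h0]
  have hd : HasDerivAt (fun t => (Ve t).toReal - (Vo t).toReal)
      ((Pe t).toReal - (Po t).toReal) t := by
    refine (ht 0).congr_of_eventuallyEq ?_
    filter_upwards [Ioi_mem_nhds h0] with x hx
    have hx0 : 0 ≤ x := (mem_Ioi.1 hx).le
    simp only [Pi.sub_apply]
    rw [intervalIntegral.integral_sub (hPe.intervalIntegrable_toReal hPem hx0 (hVet x))
      (hPo.intervalIntegrable_toReal hPom hx0 (hVot x)), hPe.integral_toReal hPem hx0 (hVet x),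
      hPo.integral_toReal hPom hx0 (hVot x)]
  have := hmono.nonneg_of_hasDerivAt hd
  exact (ENNReal.toReal_le_toReal hto.ne hte.ne).1 (sub_nonneg.1 this)

/-- A time kernel is continuous at almost every time. -/
lemma IsTimeKernel.ae_continuousAt (hL : IsTimeKernel L) : ∀ᵐ t, ContinuousAt L t := by
  have h1 : ∀ᵐ t : ℝ, t ∉ {x ∈ Ioi (0 : ℝ) | ¬ContinuousWithinAt L (Ioi 0) x} :=
    (hL.anti.countable_not_continuousWithinAt).ae_notMem volume
  have h2 : ∀ᵐ t : ℝ, t ≠ 0 := by simp [ae_iff, measure_singleton]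
  filter_upwards [h1, h2] with t ht ht0
  rcases lt_or_gt_of_ne ht0 with h | h
  · have : L =ᶠ[𝓝 t] fun _ => 0 := by
      filter_upwards [Iio_mem_nhds h] with x hx using hL.causal x (mem_Iio.1 hx).le
    exact continuousAt_const.congr this.symm
  · have : ContinuousWithinAt L (Ioi 0) t := by
      by_contra hcon
      exact ht ⟨h, hcon⟩
    exact this.continuousAt (Ioi_mem_nhds h)

lemma IsTimeKernel.ae_tendsto_comp_sub (hL : IsTimeKernel L) (t : ℝ) :
    ∀ᵐ s, Tendsto (fun t' => L (t' - s)) (𝓝 t) (𝓝 (L (t - s))) := by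
  have h1 : ∀ᵐ s, ContinuousAt L (t - s) :=
    (quasiMeasurePreserving_sub_left volume t).ae hL.ae_continuousAt
  filter_upwards [h1] with s hs
  exact hs.tendsto.comp ((continuous_id.sub continuous_const).tendsto' _ _ rfl)

/-- An inequality `c (L ⋆ ρ) ≤ L` which holds almost everywhere holds everywhere. -/
lemma IsTimeKernel.smul_lconv_le_of_ae {ρ : ℝ → ℝ≥0∞} (hL : IsTimeKernel L) (hρ : Causal ρ)
    (hρm : Measurable ρ) (h : ∀ᵐ t, c * (L ⋆ₗ ρ) t ≤ L t) (t : ℝ) : c * (L ⋆ₗ ρ) t ≤ L t := by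
  rcases le_or_gt t 0 with ht | ht
  · simp [hL.causal.lconv hρ t ht]
  -- Approach `t` from the right through times at which the inequality holds. There the right-hand
  -- sides are at most `L t` by monotonicity, and Fatou's lemma with almost everywhere continuity of
  -- `L` controls the left-hand side.
  obtain ⟨u, -, hut, hulim⟩ : ∃ u : ℕ → ℝ, True ∧
      (∀ n, t < u n ∧ c * (L ⋆ₗ ρ) (u n) ≤ L (u n)) ∧ Tendsto u atTop (𝓝 t) := by
    have hd : ∀ n : ℕ, ∃ x ∈ Ioo t (t + 1 / (n + 1)), c * (L ⋆ₗ ρ) x ≤ L x := by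
      intro n
      have hpos : (0 : ℝ) < 1 / (n + 1) := by positivity
      have hne : (volume.restrict (Ioo t (t + 1 / ((n : ℝ) + 1)))) ≠ 0 := by
        rw [Ne, Measure.restrict_eq_zero, Real.volume_Ioo, ENNReal.ofReal_eq_zero, not_le]
        linarith
      have : (ae (volume.restrict (Ioo t (t + 1 / ((n : ℝ) + 1))))).NeBot := ae_neBot.2 hne
      obtain ⟨x, hx1, hx2⟩ :=
        ((ae_restrict_mem (μ := volume) (s := Ioo t (t + 1 / ((n : ℝ) + 1)))
          measurableSet_Ioo).and (ae_restrict_of_ae h)).exists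
      exact ⟨x, hx1, hx2⟩
    choose u hu1 hu2 using hd
    refine ⟨u, trivial, fun n => ⟨(hu1 n).1, hu2 n⟩, ?_⟩
    refine tendsto_of_tendsto_of_tendsto_of_le_of_le tendsto_const_nhds
      (by simpa using tendsto_one_div_add_atTop_nhds_zero_nat.const_add t)
      (fun n => (hu1 n).1.le) fun n => (hu1 n).2.le
  have hle : ∀ n, c * (L ⋆ₗ ρ) (u n) ≤ L t := fun n =>
    (hut n).2.trans (hL.anti (mem_Ioi.2 ht) (mem_Ioi.2 (ht.trans (hut n).1)) (hut n).1.le)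
  have hLm := hL.measurable
  calc c * (L ⋆ₗ ρ) t = ∫⁻ s, c * (L (t - s) * ρ s) := by
        rw [lconv_eq_lintegral_sub, lintegral_const_mul _ (by fun_prop)]
    _ ≤ ∫⁻ s, liminf (fun n => c * (L (u n - s) * ρ s)) atTop := by
        refine lintegral_mono_ae ?_
        filter_upwards [hL.ae_tendsto_comp_sub t] with s hs
        have h1 : Tendsto (fun n => L (u n - s)) atTop (𝓝 (L (t - s))) := hs.comp hulim
        -- Multiplication by `∞` is discontinuous at zero, so this case is separate: if `L (t - s) ≠
        -- 0`, the factors `L (u n - s)` are eventually nonzero and the products agree.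
        rcases eq_or_ne (ρ s) ∞ with hρs | hρs
        · rcases eq_or_ne (L (t - s)) 0 with h0 | h0
          · simp [h0]
          · have h2 : ∀ᶠ n in atTop, L (u n - s) ≠ 0 := h1.eventually_ne h0
            refine le_liminf_of_le (by isBoundedDefault) ?_
            filter_upwards [h2] with n hn
            simp [hρs, ENNReal.mul_top hn, ENNReal.mul_top h0]
        · have h2 : Tendsto (fun n => c * (L (u n - s) * ρ s)) atTop (𝓝 (c * (L (t - s) * ρ s))) :=
            ENNReal.Tendsto.const_mul (ENNReal.Tendsto.mul_const h1 (Or.inr hρs))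
              (Or.inr ENNReal.coe_ne_top)
          rw [h2.liminf_eq]
    _ ≤ liminf (fun n => ∫⁻ s, c * (L (u n - s) * ρ s)) atTop :=
        lintegral_liminf_le fun n => by fun_prop
    _ ≤ L t := by
        refine liminf_le_of_le (by isBoundedDefault) fun b hb => ?_
        obtain ⟨n, hn⟩ := hb.exists
        refine hn.trans ((le_of_eq ?_).trans (hle n))
        rw [lconv_eq_lintegral_sub, lintegral_const_mul _ (by fun_prop)]

/-- Existence of a nonnegative resolvent: `r + c (L ⋆ r) = L`. -/
lemma IsSoninePair.exists_resolvent (h : IsSoninePair K L) (c : ℝ≥0) :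
    ∃ r : ℝ → ℝ≥0∞, Measurable r ∧ r + (c : ℝ≥0∞) • (L ⋆ₗ r) = L := by
  have hLm := h.right.measurable
  have hLc := h.right.causal
  rcases eq_or_ne c 0 with rfl | hc
  · exact ⟨L, hLm, by simp⟩
  obtain ⟨n, hn⟩ := h.right.exists_expWeight (ε := (c : ℝ≥0∞)⁻¹) (by simp)
  -- Two steps of the alternating iteration `r ↦ L - c (L ⋆ r)` are taken at once, so that all signs
  -- agree: `Pe` collects the even terms and `Po` the odd ones.
  set f : ℝ → ℝ≥0∞ := (c : ℝ≥0∞) • (L ⋆ₗ ((c : ℝ≥0∞) • L)) with hf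
  have hfm : Measurable f := by rw [hf]; fun_prop
  have hfc : Causal f := (hLc.lconv (hLc.const_smul _)).const_smul _
  set Pe := neumannSeries f L with hPe
  have hPem : Measurable Pe := measurable_neumannSeries hfm hLm
  have hPec : Causal Pe := causal_neumannSeries hfc hLc
  set Po := (c : ℝ≥0∞) • (L ⋆ₗ Pe) with hPo
  have hPom : Measurable Po := by rw [hPo]; fun_prop
  have hPoc : Causal Po := (hLc.lconv hPec).const_smul _
  have hPeq : Pe = L + (c : ℝ≥0∞) • (L ⋆ₗ Po) := by
    conv_lhs => rw [hPe, neumannSeries_eq hfm hLm]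
    rw [hf, ← hPe, hPo, const_smul_lconv (by fun_prop) hPem, lconv_const_smul hLm hLm,
      const_smul_lconv (by fun_prop) hPem, lconv_const_smul hLm (by fun_prop),
      lconvolution_assoc hLm hLm hPem]
  have hcq : (c : ℝ≥0∞) * ∫⁻ t, expWeight n t * L t < 1 := by
    have := ENNReal.mul_lt_mul_left (by simpa using hc) ENNReal.coe_ne_top hn (a := (c : ℝ≥0∞))
    rw [mul_comm] at this
    refine this.trans_le ?_
    rw [ENNReal.inv_mul_cancel (by simpa using hc) ENNReal.coe_ne_top]
  have hLw : ∫⁻ t, expWeight n t * L t < ∞ := hn.trans_le le_top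
  have hmom : ∀ g : ℝ → ℝ≥0∞, Measurable g → ∫⁻ t, expWeight n t * ((c : ℝ≥0∞) • (L ⋆ₗ g)) t =
      (c * ∫⁻ t, expWeight n t * L t) * ∫⁻ t, expWeight n t * g t := by
    intro g hg
    have hw := measurable_expWeight n
    rw [mul_assoc, ← lintegral_expWeight_mul_lconv n hLm hg, ← lintegral_const_mul _ (by fun_prop)]
    exact lintegral_congr fun t => by simp only [Pi.smul_apply, smul_eq_mul]; ring
  have hPew : ∫⁻ t, expWeight n t * Pe t < ∞ := by
    rw [hPe, lintegral_expWeight_neumannSeries hfm hLm, hf, hmom _ (by fun_prop)]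
    refine ENNReal.mul_lt_top ?_ hLw
    rw [ENNReal.inv_lt_top]
    refine tsub_pos_of_lt ?_
    have : ∫⁻ t, expWeight n t * ((c : ℝ≥0∞) • L) t = c * ∫⁻ t, expWeight n t * L t := by
      have hw := measurable_expWeight n
      rw [← lintegral_const_mul _ (by fun_prop)]
      exact lintegral_congr fun t => by simp only [Pi.smul_apply, smul_eq_mul]; ring
    rw [this]
    exact (mul_le_of_le_one_right bot_le hcq.le).trans_lt hcq
  have hPow : ∫⁻ t, expWeight n t * Po t < ∞ := by
    rw [hPo, hmom _ hPem]
    exact ENNReal.mul_lt_top (hcq.trans ENNReal.one_lt_top) hPew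
  have hPei := setLIntegral_Iio_lt_top_of_expWeight n.cast_nonneg hPew
  have hPoi := setLIntegral_Iio_lt_top_of_expWeight n.cast_nonneg hPow
  have hHm := measurable_heaviside
  have hKm := h.left.measurable
  -- Convolving with `K` and using `K ⋆ L = H` removes `L` from the equations and brings them into
  -- the form of the positivity lemma.
  have he : K ⋆ₗ Pe = heaviside + (c : ℝ≥0∞) • (heaviside ⋆ₗ Po) := by
    conv_lhs => rw [hPeq]
    rw [lconv_add hKm hLm, h.lconv_eq, lconv_const_smul hKm (by fun_prop),
      lconvolution_assoc hKm hLm hPom, h.lconv_eq]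
  have ho : K ⋆ₗ Po = (c : ℝ≥0∞) • (heaviside ⋆ₗ Pe) := by
    rw [hPo, lconv_const_smul hKm (by fun_prop), lconvolution_assoc hKm hLm hPem, h.lconv_eq]
  have hle := h.left.ae_le_of_memory_eq (pos_iff_ne_zero.2 hc) hPec hPoc hPem hPom hPei hPoi he ho
  set ρ := fun t => Pe t - Po t with hρ
  have hρm : Measurable ρ := hPem.sub hPom
  have hρc : Causal ρ := hPec.of_le fun t => tsub_le_self
  have hPefin : ∀ᵐ t, Pe t < ∞ := by
    have hw := measurable_expWeight n
    filter_upwards [ae_lt_top (by fun_prop) hPew.ne] with t ht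
    refine lt_top_iff_ne_top.2 fun h0 => ?_
    rw [h0, ENNReal.mul_top (expWeight_ne_zero _ _)] at ht
    exact lt_irrefl _ ht
  have hρeq : ρ + Po =ᵐ[volume] Pe := by
    filter_upwards [hle] with t ht using tsub_add_cancel_of_le ht
  have hae : ∀ᵐ t, ρ t + c * (L ⋆ₗ ρ) t = L t := by
    have h1 : (c : ℝ≥0∞) • (L ⋆ₗ ρ) + (c : ℝ≥0∞) • (L ⋆ₗ Po) = Po := by
      rw [← smul_add, ← lconv_add hLm hρm, lconv_congr_right L hρeq]
    filter_upwards [hρeq, hPefin, hle] with t ht hfin hlt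
    have h2 : c * (L ⋆ₗ ρ) t + c * (L ⋆ₗ Po) t = Po t := congrFun h1 t
    have h3 : Pe t = L t + c * (L ⋆ₗ Po) t := congrFun hPeq t
    have h4 : ρ t + Po t = Pe t := ht
    have h5 : c * (L ⋆ₗ Po) t ≠ ∞ :=
      ((le_add_self.trans h3.ge).trans_lt hfin).ne
    rw [← h2, h3, ← add_assoc] at h4
    exact (ENNReal.add_left_inj h5).1 h4
  have hall := h.right.smul_lconv_le_of_ae hρc hρm (hae.mono fun t ht => le_add_self.trans ht.le)
  -- So far `ρ` solves the equation only almost everywhere. Redefining it through the equation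
  -- changes a null set, hence no convolution, and gives a solution at every time.
  refine ⟨fun t => L t - c * (L ⋆ₗ ρ) t, by fun_prop, ?_⟩
  have hrρ : (fun t => L t - c * (L ⋆ₗ ρ) t) =ᵐ[volume] ρ := by
    filter_upwards [hae] with t ht
    have : c * (L ⋆ₗ ρ) t ≠ ∞ := ((hall t).trans_lt (h.right.ne_top t).lt_top).ne
    rw [← ht, ENNReal.add_sub_cancel_right this]
  rw [lconv_congr_right L hrρ]
  ext t
  exact tsub_add_cancel_of_le (hall t)

end positivity

/-! ### Properties of the resolvent -/

/-- The nonnegative resolvent `r` of a time kernel `L`, solving `r + c (L ⋆ r) = L`. -/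
noncomputable def volterraResolvent (L : ℝ → ℝ≥0∞) (c : ℝ≥0) : ℝ → ℝ≥0∞ :=
  Classical.epsilon fun r => Measurable r ∧ r + (c : ℝ≥0∞) • (L ⋆ₗ r) = L

lemma ae_lt_top_of_setLIntegral_Iio {P : ℝ → ℝ≥0∞} (hP : Measurable P)
    (hPi : ∀ T, ∫⁻ t in Iio T, P t < ∞) : ∀ᵐ t, P t < ∞ := by
  have h1 : ∀ n : ℕ, ∀ᵐ t, t ∈ Iio (n : ℝ) → P t < ∞ := fun n =>
    (ae_restrict_iff' measurableSet_Iio).1 (ae_lt_top hP (hPi n).ne)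
  filter_upwards [ae_all_iff.2 h1] with t ht
  obtain ⟨n, hn⟩ := exists_nat_gt t
  exact ht n hn

/-- Split at `s = t / 2`: on each half one of the factors is at most `L (t / 2)` by monotonicity,
and the other is integrable. Finiteness at every time makes the Lipschitz bound for the resolvent in
its parameter meaningful pointwise. -/
lemma IsTimeKernel.lconv_self_ne_top {L : ℝ → ℝ≥0∞} (hL : IsTimeKernel L) (t : ℝ) :
    (L ⋆ₗ L) t ≠ ∞ := by
  rcases le_or_gt t 0 with ht | ht
  · simp [hL.causal.lconv hL.causal t ht]
  have hLm := hL.measurable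
  have hle : (L ⋆ₗ L) t ≤ L (t / 2) * ((L ⋆ₗ heaviside) t + (heaviside ⋆ₗ L) t) := by
    have hHm := measurable_heaviside
    simp only [lconv_eq_lintegral_sub]
    rw [← lintegral_add_left (by fun_prop), ← lintegral_const_mul _ (by fun_prop)]
    refine lintegral_mono fun s => ?_
    rcases le_or_gt s 0 with hs | hs
    · simp [hL.causal s hs]
    rcases le_or_gt (t - s) 0 with hts | hts
    · simp [hL.causal _ hts]
    rw [heaviside_of_pos hs, heaviside_of_pos hts, mul_one, one_mul, mul_add]
    rcases le_total s (t / 2) with h | h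
    · refine le_trans ?_ le_add_self
      gcongr
      exact hL.anti (mem_Ioi.2 (by linarith)) (mem_Ioi.2 hts) (by linarith)
    · refine le_trans ?_ le_self_add
      rw [mul_comm]
      gcongr
      exact hL.anti (mem_Ioi.2 (by linarith)) (mem_Ioi.2 hs) h
  refine (hle.trans_lt (ENNReal.mul_lt_top (hL.ne_top _).lt_top ?_)).ne
  rw [lconvolution_comm, heaviside_lconv]
  exact ENNReal.add_lt_top.2 ⟨hL.lintegral_lt_top t, hL.lintegral_lt_top t⟩

namespace IsSoninePair

variable {K L : ℝ → ℝ≥0∞} (h : IsSoninePair K L)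
include h

lemma resolvent_spec (c : ℝ≥0) :
    Measurable (volterraResolvent L c) ∧ volterraResolvent L c + (c : ℝ≥0∞) • (L ⋆ₗ volterraResolvent L c) = L :=
  Classical.epsilon_spec (h.exists_resolvent c)

lemma measurable_resolvent (c : ℝ≥0) : Measurable (volterraResolvent L c) := (h.resolvent_spec c).1

lemma resolvent_eq (c : ℝ≥0) : volterraResolvent L c + (c : ℝ≥0∞) • (L ⋆ₗ volterraResolvent L c) = L :=
  (h.resolvent_spec c).2

lemma resolvent_le (c : ℝ≥0) : volterraResolvent L c ≤ L := fun t =>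
  le_self_add.trans (congrFun (h.resolvent_eq c) t).le

lemma causal_resolvent (c : ℝ≥0) : Causal (volterraResolvent L c) := h.right.causal.of_le (h.resolvent_le c)

lemma resolvent_ne_top (c : ℝ≥0) (t : ℝ) : volterraResolvent L c t ≠ ∞ :=
  ((h.resolvent_le c t).trans_lt (h.right.ne_top t).lt_top).ne

/-- The absolute difference `φ` of two solutions satisfies `φ ≤ c (L ⋆ φ)`, so it vanishes almost
everywhere by Gronwall's lemma. The convolutions then coincide, and the equation gives equality at
every time. -/
lemma eq_resolvent {c : ℝ≥0} {X : ℝ → ℝ≥0∞} (hX : Measurable X)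
    (heq : X + (c : ℝ≥0∞) • (L ⋆ₗ X) = L) : X = volterraResolvent L c := by
  have hLm := h.right.measurable
  have step : ∀ X Y : ℝ → ℝ≥0∞, Measurable X → Measurable Y → X + (c : ℝ≥0∞) • (L ⋆ₗ X) = L →
      Y + (c : ℝ≥0∞) • (L ⋆ₗ Y) = L → ∀ t, X t - Y t ≤ c * (L ⋆ₗ (Y - X)) t := by
    intro X Y hX hY hXe hYe t
    have h1 : (L ⋆ₗ Y) t ≤ (L ⋆ₗ X) t + (L ⋆ₗ (Y - X)) t := by
      rw [← Pi.add_apply, ← lconv_add hLm hX]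
      exact lconv_mono le_rfl (fun s => le_add_tsub) t
    have h2 : X t + c * (L ⋆ₗ X) t = L t := congrFun hXe t
    have h3 : Y t + c * (L ⋆ₗ Y) t = L t := congrFun hYe t
    have h4 : c * (L ⋆ₗ X) t ≠ ∞ := ((le_add_self.trans h2.le).trans_lt (h.right.ne_top t).lt_top).ne
    rw [tsub_le_iff_left, ← ENNReal.add_le_add_iff_right h4, h2, ← h3, add_assoc, ← mul_add,
      add_comm ((L ⋆ₗ (Y - X)) t)]
    gcongr
  set r := volterraResolvent L c with hr
  have hrm := h.measurable_resolvent c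
  have hXL : X ≤ L := fun t => le_self_add.trans (congrFun heq t).le
  set φ : ℝ → ℝ≥0∞ := (X - r) + (r - X) with hφ
  have hφm : Measurable φ := (hX.sub hrm).add (hrm.sub hX)
  have hφL : φ ≤ L + L := add_le_add (fun t => tsub_le_self.trans (hXL t))
    fun t => tsub_le_self.trans (h.resolvent_le c t)
  have hφ0 : ∀ T : ℝ, ∀ᵐ t, t < T → φ t = 0 := fun T => by
    refine h.right.gronwall ((h.right.causal.add h.right.causal).of_le hφL) hφm (C := c) ?_
      ENNReal.coe_ne_top (Eventually.of_forall fun t _ => ?_)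
    · refine (lintegral_mono fun t => hφL t).trans_lt ?_
      simp only [Pi.add_apply]
      rw [lintegral_add_left hLm]
      exact ENNReal.add_lt_top.2 ⟨h.right.lintegral_lt_top T, h.right.lintegral_lt_top T⟩
    · have hrX : Measurable (r - X) := hrm.sub hX
      rw [hφ, add_comm (X - r), lconv_add hLm hrX, Pi.add_apply, Pi.add_apply, mul_add, add_comm]
      exact add_le_add (step X r hX hrm heq (h.resolvent_eq c) t)
        (step r X hrm hX (h.resolvent_eq c) heq t)
  have hXr : X =ᵐ[volume] r := by
    filter_upwards [ae_all_iff.2 fun n : ℕ => hφ0 n] with t ht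
    obtain ⟨n, hn⟩ := exists_nat_gt t
    have := ht n hn
    simp only [hφ, Pi.add_apply, Pi.sub_apply, add_eq_zero, tsub_eq_zero_iff_le] at this
    exact le_antisymm this.1 this.2
  have h1 : X + (c : ℝ≥0∞) • (L ⋆ₗ r) = r + (c : ℝ≥0∞) • (L ⋆ₗ r) := by
    rw [← lconv_congr_right L hXr, heq, lconv_congr_right L hXr, h.resolvent_eq c]
  ext t
  have h2 : X t + c * (L ⋆ₗ r) t = r t + c * (L ⋆ₗ r) t := congrFun h1 t
  have h3 : r t + c * (L ⋆ₗ r) t = L t := congrFun (h.resolvent_eq c) t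
  exact (ENNReal.add_left_inj ((le_add_self.trans h3.le).trans_lt (h.right.ne_top t).lt_top).ne).1 h2

lemma resolvent_zero : volterraResolvent L 0 = L := (h.eq_resolvent h.right.measurable (by simp)).symm

/-- The resolvent identity. -/
lemma resolvent_add (c d : ℝ≥0) :
    volterraResolvent L (c + d) + (d : ℝ≥0∞) • (volterraResolvent L c ⋆ₗ volterraResolvent L (c + d)) = volterraResolvent L c := by
  have hLm := h.right.measurable
  have h1 := h.measurable_resolvent c
  have h2 := h.measurable_resolvent (c + d)
  -- By uniqueness it is enough that the left-hand side solves the equation with parameter `c`.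
  refine h.eq_resolvent (by fun_prop) ?_
  have e1 := h.resolvent_eq c
  have e2 := h.resolvent_eq (c + d)
  set r := volterraResolvent L c
  set r' := volterraResolvent L (c + d)
  rw [lconv_add hLm h2, lconv_const_smul hLm (by fun_prop), lconvolution_assoc hLm h1 h2]
  have e3 : r ⋆ₗ r' + (c : ℝ≥0∞) • ((L ⋆ₗ r) ⋆ₗ r') = L ⋆ₗ r' := by
    rw [← const_smul_lconv (by fun_prop) h2, ← add_lconv h1 h2, e1]
  calc _ = r' + (c : ℝ≥0∞) • (L ⋆ₗ r') + (d : ℝ≥0∞) • (r ⋆ₗ r' + (c : ℝ≥0∞) • ((L ⋆ₗ r) ⋆ₗ r')) := by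
        simp only [smul_add, smul_smul, mul_comm (d : ℝ≥0∞) c]
        abel
    _ = L := by
        rw [e3, add_assoc, ← add_smul, ← ENNReal.coe_add, e2]

/-- By the resolvent identity the difference is `(d - c) r_c ⋆ r_d` for `c ≤ d`, and both factors
are at most `L`. This continuity in the parameter allows symbols to pass to the limit. -/
lemma abs_resolvent_sub_le (c d : ℝ≥0) (t : ℝ) :
    |(volterraResolvent L c t).toReal - (volterraResolvent L d t).toReal| ≤
      |(c : ℝ) - d| * ((L ⋆ₗ L) t).toReal := by
  wlog hcd : c ≤ d generalizing c d
  · rw [abs_sub_comm, abs_sub_comm (c : ℝ)]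
    exact this d c (not_le.1 hcd).le
  obtain ⟨e, rfl⟩ := exists_add_of_le hcd
  have h1 := congrFun (h.resolvent_add c e) t
  simp only [Pi.add_apply, Pi.smul_apply, smul_eq_mul] at h1
  have h2 : (volterraResolvent L c ⋆ₗ volterraResolvent L (c + e)) t ≤ (L ⋆ₗ L) t :=
    lconv_mono (h.resolvent_le c) (h.resolvent_le (c + e)) t
  have h3 := h.right.lconv_self_ne_top t
  have h4 : (volterraResolvent L c ⋆ₗ volterraResolvent L (c + e)) t ≠ ∞ := (h2.trans_lt h3.lt_top).ne
  rw [← h1, ENNReal.toReal_add (h.resolvent_ne_top _ t) (ENNReal.mul_ne_top ENNReal.coe_ne_top h4),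
    add_sub_cancel_left, abs_of_nonneg ENNReal.toReal_nonneg, ENNReal.toReal_mul,
    ENNReal.coe_toReal, NNReal.coe_add, sub_add_cancel_left, abs_neg, abs_of_nonneg e.coe_nonneg]
  exact mul_le_mul_of_nonneg_left (ENNReal.toReal_mono h3 h2) e.2

lemma kernel_lconv_resolvent (c : ℝ≥0) :
    K ⋆ₗ volterraResolvent L c + (c : ℝ≥0∞) • (heaviside ⋆ₗ volterraResolvent L c) = heaviside := by
  have hLm := h.right.measurable
  have hKm := h.left.measurable
  have hrm := h.measurable_resolvent c
  rw [← h.lconv_eq, ← lconvolution_assoc hKm hLm hrm, ← lconv_const_smul hKm (by fun_prop),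
    ← lconv_add hKm hrm, h.resolvent_eq c]

/-- Identifies `K ⋆ r_c` as the solution `ρ₁(·; c)` of the Volterra equation with right-hand side
one. -/
lemma lconv_kernel_lconv_resolvent (c : ℝ≥0) :
    K ⋆ₗ volterraResolvent L c + (c : ℝ≥0∞) • (L ⋆ₗ (K ⋆ₗ volterraResolvent L c)) = heaviside := by
  rw [lconvolution_assoc h.right.measurable h.left.measurable (h.measurable_resolvent c),
    lconvolution_comm (f := L), h.lconv_eq, h.kernel_lconv_resolvent c]

lemma kernel_lconv_resolvent_le (c : ℝ≥0) : K ⋆ₗ volterraResolvent L c ≤ heaviside := fun t =>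
  le_self_add.trans (congrFun (h.kernel_lconv_resolvent c) t).le

end IsSoninePair

/-! ### Uniqueness for complex Volterra equations -/

lemma IsTimeKernel.lintegral_Ioc_lt_top {L : ℝ → ℝ≥0∞} (hL : IsTimeKernel L) (T : ℝ) :
    ∫⁻ t in Ioc 0 T, L t < ∞ := by
  rw [← setLIntegral_congr Ioo_ae_eq_Ioc, ← hL.causal.setLIntegral_Iio]
  exact hL.lintegral_lt_top T

section volterra

variable {L : ℝ → ℝ≥0∞} {σ τ : ℝ → ℂ}

/-- A causal measurable representative of the absolute value of a locally integrable function. -/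
lemma exists_causal_enorm (hσ : ∀ T : ℝ, 0 < T → IntegrableOn σ (Ioc 0 T)) :
    ∃ φ : ℝ → ℝ≥0∞, Causal φ ∧ Measurable φ ∧ (∀ T, ∫⁻ t in Iio T, φ t < ∞) ∧
      ∀ᵐ t, 0 < t → φ t = ‖σ t‖ₑ := by
  have hU : (⋃ n : ℕ, Ioc (0 : ℝ) n) = Ioi 0 := by
    ext x
    simp only [mem_iUnion, mem_Ioc, mem_Ioi]
    refine ⟨fun ⟨n, hn⟩ => hn.1, fun hx => ?_⟩
    obtain ⟨n, hn⟩ := exists_nat_gt x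
    exact ⟨n, hx, hn.le⟩
  have hm : AEStronglyMeasurable σ (volume.restrict (Ioi 0)) := by
    rw [← hU, aestronglyMeasurable_iUnion_iff]
    intro n
    rcases n.eq_zero_or_pos with rfl | hn
    · simp
    · exact (hσ n (by exact_mod_cast hn)).aestronglyMeasurable
  have hae : ∀ᵐ t, 0 < t → (Ioi (0 : ℝ)).indicator (fun t => ‖hm.mk σ t‖ₑ) t = ‖σ t‖ₑ := by
    filter_upwards [(ae_restrict_iff' measurableSet_Ioi).1 hm.ae_eq_mk] with t ht h0
    rw [indicator_of_mem (mem_Ioi.2 h0), ht h0]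
  have hc : Causal ((Ioi (0 : ℝ)).indicator fun t => ‖hm.mk σ t‖ₑ) := fun t ht => by simp [ht]
  refine ⟨_, hc, hm.stronglyMeasurable_mk.measurable.enorm.indicator measurableSet_Ioi,
    fun T => ?_, hae⟩
  rw [hc.setLIntegral_Iio]
  rcases le_or_gt T 0 with hT | hT
  · simp [hT]
  · rw [setLIntegral_congr Ioo_ae_eq_Ioc, setLIntegral_congr_fun_ae measurableSet_Ioc
      (hae.mono fun t ht h => ht h.1)]
    exact (hσ T hT).2

lemma IsTimeKernel.enorm_integral_le (hL : IsTimeKernel L) {φ : ℝ → ℝ≥0∞} (hφ : Causal φ)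
    (h : ∀ᵐ t, 0 < t → φ t = ‖σ t‖ₑ) {t : ℝ} (ht : 0 < t) :
    ‖∫ s in (0 : ℝ)..t, ((L (t - s)).toReal : ℂ) * σ s‖ₑ ≤ (L ⋆ₗ φ) t := by
  rw [intervalIntegral.integral_of_le ht.le, hL.causal.lconv_eq_setLIntegral hφ]
  refine (enorm_integral_le_lintegral_enorm _).trans
    (setLIntegral_mono_ae' measurableSet_Ioc ?_)
  filter_upwards [h] with s hs hst
  rw [enorm_mul, hs hst.1]
  refine mul_le_mul' (le_of_eq ?_) le_rfl
  rw [← ofReal_norm, Complex.norm_real, Real.norm_of_nonneg ENNReal.toReal_nonneg,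
    ENNReal.ofReal_toReal (hL.ne_top _)]

/-- A Bochner integral without integrability defaults to zero, so splitting the integral of a
difference needs this. For a merely locally integrable solution Tonelli's theorem gives it at almost
every time, which suffices for Gronwall's lemma. -/
lemma IsTimeKernel.ae_intervalIntegrable (hL : IsTimeKernel L)
    (hσ : ∀ T : ℝ, 0 < T → IntegrableOn σ (Ioc 0 T)) :
    ∀ᵐ t, 0 < t → IntervalIntegrable (fun s => ((L (t - s)).toReal : ℂ) * σ s) volume 0 t := by
  obtain ⟨φ, hφ, hφm, hφi, hφσ⟩ := exists_causal_enorm hσ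
  have hLm := hL.measurable
  have h1 : ∀ᵐ t, (L ⋆ₗ φ) t < ∞ :=
    ae_lt_top_of_setLIntegral_Iio (by fun_prop) fun T =>
      (hL.causal.setLIntegral_lconv_le hφ hLm hφm T).trans_lt
        (ENNReal.mul_lt_top (hL.lintegral_lt_top T) (hφi T))
  filter_upwards [h1] with t ht h0
  rw [intervalIntegrable_iff_integrableOn_Ioc_of_le h0.le]
  refine ⟨?_, ?_⟩
  · refine AEStronglyMeasurable.mul ?_ (hσ t h0).aestronglyMeasurable
    exact (Complex.measurable_ofReal.comp
      (hLm.comp (measurable_const.sub measurable_id)).ennreal_toReal).aestronglyMeasurable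
  · rw [hL.causal.lconv_eq_setLIntegral hφ] at ht
    refine lt_of_le_of_lt (setLIntegral_mono_ae' measurableSet_Ioc ?_) ht
    filter_upwards [hφσ] with s hs hst
    rw [enorm_mul, hs hst.1]
    refine mul_le_mul' (le_of_eq ?_) le_rfl
    rw [← ofReal_norm, Complex.norm_real, Real.norm_of_nonneg ENNReal.toReal_nonneg,
      ENNReal.ofReal_toReal (hL.ne_top _)]

/-- Gronwall's lemma applied to `|σ - τ|` gives equality almost everywhere. The integral terms then
agree at every time, and so do the solutions. -/
lemma IsTimeKernel.volterra_unique (hL : IsTimeKernel L)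
    (hσ : ∀ T : ℝ, 0 < T → IntegrableOn σ (Ioc 0 T))
    (hτ : ∀ T : ℝ, 0 < T → IntegrableOn τ (Ioc 0 T)) {μ : ℂ} {g : ℝ → ℂ}
    (hσe : ∀ t, 0 < t → σ t + μ * ∫ s in (0 : ℝ)..t, ((L (t - s)).toReal : ℂ) * σ s = g t)
    (hτe : ∀ t, 0 < t → τ t + μ * ∫ s in (0 : ℝ)..t, ((L (t - s)).toReal : ℂ) * τ s = g t)
    {t : ℝ} (ht : 0 < t) : σ t = τ t := by
  obtain ⟨φ, hφ, hφm, hφi, hφd⟩ := exists_causal_enorm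
    (σ := fun t => σ t - τ t) fun T hT => (hσ T hT).sub (hτ T hT)
  have hφ0 : ∀ T : ℝ, ∀ᵐ t, t < T → φ t = 0 := fun T => by
    refine hL.gronwall hφ hφm (hφi T) (C := ‖μ‖ₑ) enorm_ne_top ?_
    filter_upwards [hφd, hL.ae_intervalIntegrable hσ, hL.ae_intervalIntegrable hτ]
      with t h1 h2 h3 _
    rcases le_or_gt t 0 with h0 | h0
    · simp [hφ t h0]
    rw [h1 h0]
    have e : σ t - τ t =
        -(μ * ∫ s in (0 : ℝ)..t, ((L (t - s)).toReal : ℂ) * (σ s - τ s)) := by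
      simp_rw [mul_sub]
      rw [intervalIntegral.integral_sub (h2 h0) (h3 h0), mul_sub]
      linear_combination hσe t h0 - hτe t h0
    rw [e, enorm_neg, enorm_mul]
    gcongr
    exact hL.enorm_integral_le hφ hφd h0
  have hae : ∀ᵐ s, 0 < s → σ s = τ s := by
    filter_upwards [ae_all_iff.2 fun n : ℕ => hφ0 n, hφd] with s hs hsd h0
    obtain ⟨n, hn⟩ := exists_nat_gt s
    have h1 := hsd h0
    rw [hs n hn, eq_comm, enorm_eq_zero] at h1
    exact sub_eq_zero.1 h1
  have hint : ∫ s in (0 : ℝ)..t, ((L (t - s)).toReal : ℂ) * σ s =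
      ∫ s in (0 : ℝ)..t, ((L (t - s)).toReal : ℂ) * τ s := by
    refine intervalIntegral.integral_congr_ae ?_
    filter_upwards [hae] with s hs hst
    rw [uIoc_of_le ht.le] at hst
    rw [hs hst.1]
  have := (hσe t ht).trans (hτe t ht).symm
  rw [hint] at this
  exact add_right_cancel this

end volterra

/-! ### From real kernels to time kernels -/

namespace IsMemoryKernelPair

variable {κ ℓ : ℝ → ℝ} (h : IsMemoryKernelPair κ ℓ)
include h

lemma isSoninePair : IsSoninePair (timeKernel κ) (timeKernel ℓ) := by
  have key : ∀ f : ℝ → ℝ, (∀ T : ℝ, 0 < T → IntegrableOn f (Ioc 0 T)) → AntitoneOn f (Ioi 0) →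
      IsTimeKernel (timeKernel f) := fun f hfi hfa =>
    { causal := causal_timeKernel f
      measurable := measurable_timeKernel hfa
      ne_top := timeKernel_ne_top f
      anti := fun s hs t ht hst => by
        rw [timeKernel_of_pos f hs, timeKernel_of_pos f ht]
        exact ENNReal.ofReal_le_ofReal (hfa hs ht hst)
      lintegral_lt_top := fun T => by
        rcases le_or_gt T 0 with hT | hT
        · rw [(causal_timeKernel f).setLIntegral_Iio, Ioo_eq_empty (not_lt.2 hT)]; simp
        · rw [(causal_timeKernel f).setLIntegral_Iio, setLIntegral_congr Ioo_ae_eq_Ioc,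
            setLIntegral_congr_fun measurableSet_Ioc fun t ht => timeKernel_of_pos f ht.1]
          exact (hfi T hT).lintegral_lt_top }
  have hK := key κ h.integrableOn_kappa h.antitone_kappa
  have hL := key ℓ h.integrableOn_ell h.antitone_ell
  refine ⟨hK, hL, ?_⟩
  ext t
  rcases le_or_gt t 0 with ht | ht
  · rw [hK.causal.lconv hL.causal t ht, causal_heaviside t ht]
  have hconv := h.conv_eq_one t ht
  -- The integral equals one, so it is not the default value of a nonintegrable function.
  have hint : IntervalIntegrable (fun s => κ s * ℓ (t - s)) volume 0 t := by
    by_contra hcon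
    rw [intervalIntegral.integral_undef hcon] at hconv
    exact zero_ne_one hconv
  rw [intervalIntegrable_iff_integrableOn_Ioo_of_le ht.le] at hint
  rw [intervalIntegral.integral_of_le ht.le, integral_Ioc_eq_integral_Ioo] at hconv
  rw [heaviside_of_pos ht, lconvolution_comm, hL.causal.lconv_eq_setLIntegral hK.causal,
    setLIntegral_congr Ioo_ae_eq_Ioc.symm, ← ENNReal.ofReal_one, ← hconv,
    ofReal_integral_eq_lintegral_ofReal hint]
  · refine setLIntegral_congr_fun measurableSet_Ioo fun s hs => ?_
    rw [timeKernel_of_pos ℓ (sub_pos.2 hs.2), timeKernel_of_pos κ hs.1,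
      ENNReal.ofReal_mul (h.nonneg_kappa s hs.1), mul_comm]
  · filter_upwards [ae_restrict_mem measurableSet_Ioo] with s hs
    exact mul_nonneg (h.nonneg_kappa s hs.1) (h.nonneg_ell _ (sub_pos.2 hs.2))

lemma toReal_ell {t : ℝ} (ht : 0 < t) : (timeKernel ℓ t).toReal = ℓ t := by
  rw [timeKernel_of_pos ℓ ht, ENNReal.toReal_ofReal (h.nonneg_ell t ht)]

lemma intervalIntegral_ell {t : ℝ} (ht : 0 < t) (f : ℝ → ℂ) :
    ∫ s in (0 : ℝ)..t, ((ℓ (t - s) : ℝ) : ℂ) * f s =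
      ∫ s in (0 : ℝ)..t, ((timeKernel ℓ (t - s)).toReal : ℂ) * f s := by
  rw [intervalIntegral.integral_of_le ht.le, intervalIntegral.integral_of_le ht.le,
    integral_Ioc_eq_integral_Ioo, integral_Ioc_eq_integral_Ioo]
  refine setIntegral_congr_fun measurableSet_Ioo fun s hs => ?_
  rw [h.toReal_ell (sub_pos.2 hs.2)]

end IsMemoryKernelPair

/-! ### Passage from `[0, ∞]`-valued to complex-valued solutions. -/

section volterra

variable {K L : ℝ → ℝ≥0∞}

/-- Nonnegative solutions of Volterra equations give complex solutions. -/
lemma IsTimeKernel.volterra_toReal (hL : IsTimeKernel L) {X g : ℝ → ℝ≥0∞} {c : ℝ≥0}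
    (hX : Causal X) (hXm : Measurable X) (h : X + (c : ℝ≥0∞) • (L ⋆ₗ X) = g) {t : ℝ} (ht : 0 < t)
    (hfin : (L ⋆ₗ X) t ≠ ∞) (hXt : X t ≠ ∞) :
    ((X t).toReal : ℂ) + c * ∫ s in (0 : ℝ)..t, ((L (t - s)).toReal : ℂ) * ((X s).toReal : ℂ) =
      ((g t).toReal : ℂ) := by
  have h1 := hX.integral_mul_toReal hL.causal hXm hL.measurable ht.le (t := t) (by
    rwa [lconvolution_comm])
  have h2 : ∫ s in (0 : ℝ)..t, ((L (t - s)).toReal : ℂ) * ((X s).toReal : ℂ) =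
      (((L ⋆ₗ X) t).toReal : ℂ) := by
    rw [lconvolution_comm, ← h1, ← intervalIntegral.integral_ofReal]
    refine intervalIntegral.integral_congr fun s _ => ?_
    push_cast
    ring
  have h3 : X t + c * (L ⋆ₗ X) t = g t := congrFun h t
  rw [h2, ← h3, ENNReal.toReal_add hXt (ENNReal.mul_ne_top ENNReal.coe_ne_top hfin),
    ENNReal.toReal_mul, ENNReal.coe_toReal]
  push_cast
  rfl

lemma Causal.integrableOn_toReal {X : ℝ → ℝ≥0∞} (hXm : Measurable X) (hL : IsTimeKernel L)
    (hXL : X ≤ L) (T : ℝ) : IntegrableOn (fun t => ((X t).toReal : ℂ)) (Ioc 0 T) :=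
  (integrable_toReal_of_lintegral_ne_top hXm.aemeasurable
    ((lintegral_mono hXL).trans_lt (hL.lintegral_Ioc_lt_top T)).ne).ofReal

lemma IsTimeKernel.heaviside (h : IsSoninePair K L) : IsTimeKernel heaviside where
  causal := causal_heaviside
  measurable := measurable_heaviside
  ne_top t := by by_cases ht : t ∈ Ioi (0 : ℝ) <;> simp [_root_.heaviside, ht]
  anti s hs t ht _ := by rw [heaviside_of_pos hs, heaviside_of_pos ht]
  lintegral_lt_top T := by
    rw [← h.lconv_eq]
    exact (h.left.causal.setLIntegral_lconv_le h.right.causal h.left.measurable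
      h.right.measurable T).trans_lt
        (ENNReal.mul_lt_top (h.left.lintegral_lt_top T) (h.right.lintegral_lt_top T))

lemma IsSoninePair.lconv_resolvent_ne_top (h : IsSoninePair K L) (c : ℝ≥0) (t : ℝ) :
    (L ⋆ₗ volterraResolvent L c) t ≠ ∞ :=
  ((lconv_mono le_rfl (h.resolvent_le c) t).trans_lt (h.right.lconv_self_ne_top t).lt_top).ne

end volterra

/-! ### Compound Poisson approximations -/

section poisson

variable {E : Type*} [NormedAddCommGroup E] [InnerProductSpace ℝ E] [FiniteDimensional ℝ E]
  [MeasurableSpace E] [BorelSpace E]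

/-- Convolution powers of a measure. -/
noncomputable def convPow (ν : Measure E) : ℕ → Measure E
  | 0 => Measure.dirac 0
  | n + 1 => ν ∗ convPow ν n

instance isFiniteMeasure_convPow (ν : Measure E) [IsFiniteMeasure ν] (n : ℕ) :
    IsFiniteMeasure (convPow ν n) := by
  induction n with
  | zero => rw [convPow]; infer_instance
  | succ n ih => rw [convPow]; infer_instance

lemma charFun_convPow (ν : Measure E) [IsFiniteMeasure ν] (n : ℕ) (ξ : E) :
    charFun (convPow ν n) ξ = charFun ν ξ ^ n := by
  induction n with
  | zero => simp [convPow, charFun_dirac]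
  | succ n ih => rw [convPow, charFun_conv, ih, pow_succ']

lemma convPow_univ (ν : Measure E) [IsFiniteMeasure ν] (n : ℕ) :
    convPow ν n univ = ν univ ^ n := by
  induction n with
  | zero => simp [convPow]
  | succ n ih =>
    rw [convPow, Measure.conv, Measure.map_apply measurable_add .univ, preimage_univ,
      ← univ_prod_univ, Measure.prod_prod, ih, pow_succ']

/-- The measures with Fourier transforms `ρ₂(t; c - ν̂(ξ))`, where `c = ν(E)`. -/
noncomputable def compoundPoisson (L : ℝ → ℝ≥0∞) (c : ℝ≥0) (ν : Measure E) (t : ℝ) : Measure E :=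
  -- With `r` the resolvent at `c`, the equation with parameter `c - a` becomes `ρ = r + a (r ⋆ ρ)`.
  -- Its Neumann series has coefficient `r ⋆ ⋯ ⋆ r` (`n + 1` factors) at `a ^ n`, and for `a =
  -- ν̂(ξ)` the power `a ^ n` is the transform of the `n`-th convolution power.
  Measure.sum fun n =>
    neumannTerm (volterraResolvent L c) (volterraResolvent L c) n t • convPow ν n

namespace IsSoninePair

variable {K L : ℝ → ℝ≥0∞} (h : IsSoninePair K L) {c : ℝ≥0} {ν : Measure E} [IsFiniteMeasure ν]
include h

lemma measurable_resolventTerm (c : ℝ≥0) (n : ℕ) :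
    Measurable (neumannTerm (volterraResolvent L c) (volterraResolvent L c) n) :=
  measurable_neumannTerm (h.measurable_resolvent c) (h.measurable_resolvent c) n

lemma causal_resolventTerm (c : ℝ≥0) (n : ℕ) :
    Causal (neumannTerm (volterraResolvent L c) (volterraResolvent L c) n) :=
  causal_neumannTerm (h.causal_resolvent c) (h.causal_resolvent c) n

lemma resolventTerm_succ (c : ℝ≥0) (n : ℕ) :
    neumannTerm (volterraResolvent L c) (volterraResolvent L c) (n + 1) + (c : ℝ≥0∞) •
      (L ⋆ₗ neumannTerm (volterraResolvent L c) (volterraResolvent L c) (n + 1)) =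
      L ⋆ₗ neumannTerm (volterraResolvent L c) (volterraResolvent L c) n := by
  have hr := h.measurable_resolvent c
  have hL := h.right.measurable
  have hR := h.measurable_resolventTerm c n
  rw [neumannTerm, lconvolution_assoc hL hr hR, ← const_smul_lconv (by fun_prop) hR,
    ← add_lconv hr hR, h.resolvent_eq c]

/-- A telescoping identity with nonnegative remainder. Dropping the remainder bounds the total mass
of the compound Poisson measure by `L t`. -/
lemma sum_resolventTerm (c : ℝ≥0) (m : ℕ) (t : ℝ) :
    (∑ n ∈ Finset.range (m + 1), (c : ℝ≥0∞) ^ n *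
      neumannTerm (volterraResolvent L c) (volterraResolvent L c) n t) + (c : ℝ≥0∞) ^ (m + 1) *
      (L ⋆ₗ neumannTerm (volterraResolvent L c) (volterraResolvent L c) m) t = L t := by
  induction m with
  | zero => simpa [neumannTerm] using congrFun (h.resolvent_eq c) t
  | succ m ih =>
    have h1 := congrFun (h.resolventTerm_succ c m) t
    simp only [Pi.add_apply, Pi.smul_apply, smul_eq_mul] at h1
    rw [Finset.sum_range_succ, add_assoc, pow_succ (c : ℝ≥0∞) (m + 1), mul_assoc, ← mul_add, h1, ih]

lemma tsum_resolventTerm_le (c : ℝ≥0) (t : ℝ) :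
    ∑' n, (c : ℝ≥0∞) ^ n * neumannTerm (volterraResolvent L c) (volterraResolvent L c) n t ≤
      L t := by
  refine ENNReal.tsum_le_of_sum_range_le fun m => ?_
  refine le_trans ?_ (h.sum_resolventTerm c m t).le
  refine le_trans ?_ le_self_add
  exact Finset.sum_le_sum_of_subset (Finset.range_mono (Nat.le_succ m))

lemma tsum_lconv_resolventTerm_le (c : ℝ≥0) (t : ℝ) :
    ∑' n, (c : ℝ≥0∞) ^ n *
      (L ⋆ₗ neumannTerm (volterraResolvent L c) (volterraResolvent L c) n) t ≤ (L ⋆ₗ L) t := by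
  have hL := h.right.measurable
  have hR := h.measurable_resolventTerm c
  calc _ = ∑' n, (L ⋆ₗ ((c : ℝ≥0∞) ^ n •
        neumannTerm (volterraResolvent L c) (volterraResolvent L c) n)) t := by
        refine tsum_congr fun n => ?_
        rw [lconv_const_smul hL (hR n), Pi.smul_apply, smul_eq_mul]
    _ = (L ⋆ₗ fun s => ∑' n, ((c : ℝ≥0∞) ^ n •
        neumannTerm (volterraResolvent L c) (volterraResolvent L c) n) s) t :=
        (lconv_tsum hL (fun n => (hR n).const_smul _) t).symm
    _ ≤ _ := lconv_mono le_rfl (fun s => h.tsum_resolventTerm_le c s) t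

lemma compoundPoisson_univ_le (hc : ν univ = c) (t : ℝ) : compoundPoisson L c ν t univ ≤ L t := by
  rw [compoundPoisson, Measure.sum_apply _ .univ]
  refine le_trans (le_of_eq (tsum_congr fun n => ?_)) (h.tsum_resolventTerm_le c t)
  rw [Measure.smul_apply, convPow_univ, hc, smul_eq_mul, mul_comm]

lemma isFiniteMeasure_compoundPoisson (hc : ν univ = c) (t : ℝ) :
    IsFiniteMeasure (compoundPoisson L c ν t) :=
  ⟨(h.compoundPoisson_univ_le hc t).trans_lt (h.right.ne_top t).lt_top⟩

lemma hasSum_charFun_compoundPoisson (hc : ν univ = c) (t : ℝ) (ξ : E) :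
    HasSum (fun n => ((neumannTerm (volterraResolvent L c) (volterraResolvent L c) n t).toReal : ℂ) *
      charFun ν ξ ^ n) (charFun (compoundPoisson L c ν t) ξ) := by
  have hfin := h.isFiniteMeasure_compoundPoisson hc t
  have hint : Integrable (fun x : E => Complex.exp (inner ℝ x ξ * Complex.I))
      (compoundPoisson L c ν t) := by
    refine Integrable.mono' (integrable_const (1 : ℝ)) (by fun_prop) (Eventually.of_forall fun x => ?_)
    rw [Complex.norm_exp_ofReal_mul_I]
  have := hasSum_integral_measure hint
  simp only [integral_smul_measure, ← charFun_apply, charFun_convPow] at this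
  unfold compoundPoisson
  simpa [Complex.real_smul] using this

lemma measurable_compoundPoisson (c : ℝ≥0) (ν : Measure E) : Measurable (compoundPoisson L c ν) := by
  refine Measure.measurable_of_measurable_coe _ fun s hs => ?_
  simp only [compoundPoisson, Measure.sum_apply _ hs, Measure.smul_apply, smul_eq_mul]
  exact Measurable.tsum fun n => (h.measurable_resolventTerm c n).mul_const _

/-- The Fourier transform of the Poisson kernel solves the Volterra equation with parameter
`c - ν̂(ξ)`. -/
lemma charFun_compoundPoisson_volterra (hc : ν univ = c) (ξ : E) {t : ℝ} (ht : 0 < t) :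
    charFun (compoundPoisson L c ν t) ξ + ((c : ℂ) - charFun ν ξ) *
      ∫ s in (0 : ℝ)..t, ((L (t - s)).toReal : ℂ) * charFun (compoundPoisson L c ν s) ξ =
      ((L t).toReal : ℂ) := by
  -- For `c ≠ 0` the individual terms inherit finiteness from the series weighted by `c ^ n`; for `c
  -- = 0` the measure vanishes and only the term `n = 0` is left.
  rcases eq_or_ne c 0 with rfl | hc0
  · have hν : ν = 0 := Measure.measure_univ_eq_zero.1 (by simpa using hc)
    have h1 := (h.hasSum_charFun_compoundPoisson hc t ξ).unique
      (hasSum_single 0 fun n hn => by simp [hν, hn])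
    rw [h1]
    simp [hν, neumannTerm, h.resolvent_zero]
  set R := neumannTerm (volterraResolvent L c) (volterraResolvent L c) with hR
  set a := charFun ν ξ with ha
  have hac : ‖a‖ ≤ c := by
    refine (norm_charFun_le ξ).trans (le_of_eq ?_)
    rw [Measure.real, hc, ENNReal.coe_toReal]
  have hL := h.right
  have hLm := hL.measurable
  have hRm : ∀ n, Measurable (R n) := h.measurable_resolventTerm c
  have hRc : ∀ n, Causal (R n) := h.causal_resolventTerm c
  have hcn : ∀ n : ℕ, (c : ℝ≥0∞) ^ n ≠ 0 := fun n => pow_ne_zero _ (by simpa using hc0)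
  have hR_ne : ∑' n, (c : ℝ≥0∞) ^ n * R n t ≠ ∞ :=
    ((h.tsum_resolventTerm_le c t).trans_lt (hL.ne_top t).lt_top).ne
  have hLR_ne : ∑' n, (c : ℝ≥0∞) ^ n * (L ⋆ₗ R n) t ≠ ∞ :=
    ((h.tsum_lconv_resolventTerm_le c t).trans_lt (hL.lconv_self_ne_top t).lt_top).ne
  have hRt : ∀ n, R n t ≠ ∞ := fun n htop => by
    have := ENNReal.ne_top_of_tsum_ne_top hR_ne n
    rw [htop, ENNReal.mul_top (hcn n)] at this
    exact this rfl
  have hLRt : ∀ n, (L ⋆ₗ R n) t ≠ ∞ := fun n htop => by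
    have := ENNReal.ne_top_of_tsum_ne_top hLR_ne n
    rw [htop, ENNReal.mul_top (hcn n)] at this
    exact this rfl
  set q : ℕ → ℝ := fun n => ((L ⋆ₗ R n) t).toReal with hq
  have hRL : ∀ n, (R n ⋆ₗ L) t ≠ ∞ := fun n => by rw [lconvolution_comm]; exact hLRt n
  have hint : ∀ n, Integrable (fun s => (L (t - s)).toReal * (R n s).toReal) := fun n => by
    simpa only [mul_comm] using integrable_toReal_mul_toReal (hRm n) hLm (hRL n)
  have hqint : ∀ n, ∫ s in Ioc 0 t, (L (t - s)).toReal * (R n s).toReal = q n := fun n => by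
    change _ = ((L ⋆ₗ R n) t).toReal
    rw [lconvolution_comm, ← (hRc n).integral_mul_toReal hL.causal (hRm n) hLm ht.le (hRL n),
      intervalIntegral.integral_of_le ht.le]
    simp only [mul_comm]
  have hsq : Summable fun n => (c : ℝ) ^ n * q n := by
    simpa [ENNReal.toReal_mul] using ENNReal.summable_toReal hLR_ne
  have hnorm : ∀ n s, ‖((L (t - s)).toReal : ℂ) * ((R n s).toReal * a ^ n)‖ =
      (L (t - s)).toReal * (R n s).toReal * ‖a‖ ^ n := fun n s => by
    rw [norm_mul, norm_mul, norm_pow, Complex.norm_real, Complex.norm_real,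
      Real.norm_of_nonneg ENNReal.toReal_nonneg, Real.norm_of_nonneg ENNReal.toReal_nonneg, mul_assoc]
  have hFint : ∀ n, Integrable (fun s => ((L (t - s)).toReal : ℂ) * ((R n s).toReal * a ^ n))
      (volume.restrict (Ioc 0 t)) := fun n => by
    have := ((hint n).ofReal (𝕜 := ℂ)).mul_const (a ^ n)
    refine (this.congr (Eventually.of_forall fun s => ?_)).restrict
    simp only [RCLike.ofReal_mul, Complex.coe_algebraMap, mul_assoc]
  -- Since `‖a‖ ≤ c`, the integrals of the norms are dominated by the summable `c ^ n * q n`, so sum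
  -- and integral may be exchanged.
  have hI := hasSum_integral_of_summable_integral_norm hFint (by
    refine Summable.of_nonneg_of_le (fun n => integral_nonneg fun _ => norm_nonneg _)
      (fun n => ?_) hsq
    simp only [hnorm]
    rw [integral_mul_const, hqint, mul_comm]
    exact mul_le_mul_of_nonneg_right (pow_le_pow_left₀ (norm_nonneg _) hac n)
      ENNReal.toReal_nonneg)
  have hI1 : ∀ n, ∫ s in Ioc 0 t, ((L (t - s)).toReal : ℂ) * ((R n s).toReal * a ^ n) =
      (q n : ℂ) * a ^ n := fun n => by
    rw [← hqint n, ← integral_complex_ofReal, ← integral_mul_const]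
    refine integral_congr_ae (Eventually.of_forall fun s => ?_)
    simp only [Complex.ofReal_mul, mul_assoc]
  have hI2 : ∀ s, ∑' n, ((L (t - s)).toReal : ℂ) * ((R n s).toReal * a ^ n) =
      ((L (t - s)).toReal : ℂ) * charFun (compoundPoisson L c ν s) ξ := fun s =>
    ((h.hasSum_charFun_compoundPoisson hc s ξ).mul_left _).tsum_eq
  simp only [hI1, hI2] at hI
  rw [← intervalIntegral.integral_of_le ht.le] at hI
  set Q := ∫ s in (0 : ℝ)..t, ((L (t - s)).toReal : ℂ) * charFun (compoundPoisson L c ν s) ξ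
  have hS := h.hasSum_charFun_compoundPoisson hc t ξ
  have e0 : ((R 0 t).toReal : ℂ) + c * q 0 = (L t).toReal := by
    have h1 : (R 0 t + c * (L ⋆ₗ R 0) t).toReal = (L t).toReal :=
      congrArg ENNReal.toReal (congrFun (h.resolvent_eq c) t)
    rw [ENNReal.toReal_add (hRt 0) (ENNReal.mul_ne_top ENNReal.coe_ne_top (hLRt 0)),
      ENNReal.toReal_mul, ENNReal.coe_toReal] at h1
    exact_mod_cast h1
  have e1 : ∀ n, ((R (n + 1) t).toReal : ℂ) + c * q (n + 1) = q n := fun n => by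
    have h1 : (R (n + 1) t + c * (L ⋆ₗ R (n + 1)) t).toReal = ((L ⋆ₗ R n) t).toReal :=
      congrArg ENNReal.toReal (congrFun (h.resolventTerm_succ c n) t)
    rw [ENNReal.toReal_add (hRt (n + 1)) (ENNReal.mul_ne_top ENNReal.coe_ne_top (hLRt (n + 1))),
      ENNReal.toReal_mul, ENNReal.coe_toReal] at h1
    exact_mod_cast h1
  -- The coefficients `R n + c q n` equal `L t` for `n = 0` and `q (n - 1)` afterwards. The tail of
  -- the series therefore sums to `a Q`, which gives `Ŷ + c Q = L + a Q`.
  have hT : HasSum (fun n => (((R n t).toReal : ℂ) + c * q n) * a ^ n)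
      (charFun (compoundPoisson L c ν t) ξ + c * Q) := by
    refine (hS.add (hI.mul_left (c : ℂ))).congr_fun fun n => ?_
    ring
  have hT' : HasSum (fun n => (((R (n + 1) t).toReal : ℂ) + c * q (n + 1)) * a ^ (n + 1))
      (a * Q) := by
    refine (hI.mul_left a).congr_fun fun n => ?_
    rw [e1, pow_succ]
    ring
  have h2 := ((hasSum_nat_add_iff' 1).2 hT).unique hT'
  rw [Finset.sum_range_one, pow_zero, mul_one, e0] at h2
  linear_combination h2

end IsSoninePair

end poisson

/-! ### Lévy's continuity theorem and measurability of limits -/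

section levy

open BoundedContinuousFunction

variable {E : Type*} [NormedAddCommGroup E] [InnerProductSpace ℝ E] [FiniteDimensional ℝ E]
  [MeasurableSpace E] [BorelSpace E]

/-- Lévy's continuity theorem, including the existence of the limit. -/
lemma exists_probabilityMeasure_of_tendsto_charFun {μ : ℕ → ProbabilityMeasure E} {f : E → ℂ}
    (hf : ContinuousAt f 0)
    (h : ∀ ξ, Tendsto (fun n => charFun (μ n : Measure E) ξ) atTop (𝓝 (f ξ))) :
    ∃ μ₀ : ProbabilityMeasure E, (∀ ξ, charFun (μ₀ : Measure E) ξ = f ξ) ∧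
      Tendsto μ atTop (𝓝 μ₀) := by
  have htight : IsTightMeasureSet (range fun n => (μ n : Measure E)) :=
    isTightMeasureSet_of_tendsto_charFun hf h
  have hcomp : IsCompact (closure (range μ)) := by
    refine isCompact_closure_of_isTightMeasureSet ?_
    have : {((ν : ProbabilityMeasure E) : Measure E) | ν ∈ range μ} =
        range fun n => (μ n : Measure E) := by ext; simp
    rwa [this]
  -- Tightness gives a limit along an ultrafilter finer than `atTop`. Its characteristic function
  -- must be `f`, and then characteristic functions give convergence of the whole sequence.
  let U : Ultrafilter ℕ := Ultrafilter.of atTop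
  have hU : (U : Filter ℕ) ≤ atTop := Ultrafilter.of_le atTop
  obtain ⟨μ₀, -, hμ₀⟩ := hcomp.ultrafilter_le_nhds (U.map μ)
    (by
      refine le_principal_iff.2 (mem_of_superset ?_ subset_closure)
      exact Ultrafilter.mem_coe.2 (Ultrafilter.mem_map.2 (by
        rw [preimage_range]; exact Filter.univ_mem (f := (U : Filter ℕ)))))
  have hchar : ∀ ξ, charFun (μ₀ : Measure E) ξ = f ξ := by
    intro ξ
    have h1 : Tendsto μ U (𝓝 μ₀) := hμ₀
    rw [ProbabilityMeasure.tendsto_iff_forall_integral_rclike_tendsto ℂ] at h1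
    have h2 := h1 (innerProbChar ξ)
    simp only [← charFun_eq_integral_innerProbChar] at h2
    exact tendsto_nhds_unique h2 ((h ξ).mono_left hU)
  refine ⟨μ₀, hchar, ProbabilityMeasure.tendsto_of_tendsto_charFun fun ξ => ?_⟩
  rw [hchar]
  exact h ξ

/-- A family of probability measures is measurable if the integrals of all bounded continuous
functions are measurable. -/
lemma measurable_of_measurable_lintegral {α : Type*} [MeasurableSpace α] {X : Type*}
    [PseudoEMetricSpace X] [MeasurableSpace X] [BorelSpace X] {μ : α → Measure X}
    [∀ a, IsProbabilityMeasure (μ a)]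
    (h : ∀ g : X →ᵇ ℝ≥0, Measurable fun a => ∫⁻ x, g x ∂μ a) : Measurable μ := by
  -- Closed sets form a generating π-system, and the measure of a closed set is the limit of the
  -- integrals of its thickened indicators, which are bounded and continuous.
  refine Measurable.measure_of_isPiSystem_of_isProbabilityMeasure (S := {s | IsClosed s})
    (by rw [BorelSpace.measurable_eq (α := X), borel_eq_generateFrom_isClosed])
    isPiSystem_isClosed fun F hF => ?_
  refine measurable_of_tendsto_metrizable (fun n : ℕ =>
    h (thickenedIndicator (δ := 1 / ((n : ℝ) + 1)) (by positivity) F)) ?_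
  rw [tendsto_pi_nhds]
  exact fun a => tendsto_lintegral_thickenedIndicator_of_isClosed (μ a) hF (fun n => by positivity)
    tendsto_one_div_add_atTop_nhds_zero_nat

end levy

/-! ### The transition family -/

section transition

open BoundedContinuousFunction

variable {E : Type*} [NormedAddCommGroup E] [InnerProductSpace ℝ E] [FiniteDimensional ℝ E]
  [MeasurableSpace E] [BorelSpace E] {K L : ℝ → ℝ≥0∞}

/-- Both sides solve the Volterra equation with parameter `μ` and right-hand side `L`, and locally
integrable solutions are unique. -/
lemma IsSoninePair.charFun_compoundPoisson (h : IsSoninePair K L) {c μ : ℝ≥0} {ν : Measure E}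
    [IsFiniteMeasure ν] (hc : ν univ = c) {ξ : E} (hμ : (c : ℂ) - charFun ν ξ = (μ : ℂ)) {t : ℝ}
    (ht : 0 < t) :
    charFun (compoundPoisson L c ν t) ξ = ((volterraResolvent L μ t).toReal : ℂ) := by
  refine h.right.volterra_unique (μ := μ) (g := fun t => ((L t).toReal : ℂ))
    (σ := fun t => charFun (compoundPoisson L c ν t) ξ)
    (τ := fun t => ((volterraResolvent L μ t).toReal : ℂ)) (fun T _ => ?_)
    (fun T _ => Causal.integrableOn_toReal (h.measurable_resolvent μ) h.right (h.resolvent_le μ) T)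
    (fun t ht => ?_) (fun t ht => ?_) ht
  · have hLi := integrable_toReal_of_lintegral_ne_top h.right.measurable.aemeasurable
      (h.right.lintegral_Ioc_lt_top T).ne
    refine Integrable.mono' hLi ?_ (Eventually.of_forall fun t => ?_)
    · refine (measurable_of_tendsto_metrizable (f := fun m t => ∑ n ∈ Finset.range m,
        ((neumannTerm (volterraResolvent L c) (volterraResolvent L c) n t).toReal : ℂ) *
          charFun ν ξ ^ n) (fun m => ?_) ?_).aestronglyMeasurable
      · refine Finset.measurable_fun_sum _ fun n _ => ?_
        exact (Complex.measurable_ofReal.comp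
          (h.measurable_resolventTerm c n).ennreal_toReal).mul_const _
      · rw [tendsto_pi_nhds]
        exact fun t => (h.hasSum_charFun_compoundPoisson hc t ξ).tendsto_sum_nat
    · have := h.isFiniteMeasure_compoundPoisson hc t
      exact (norm_charFun_le ξ).trans
        (ENNReal.toReal_mono (h.right.ne_top t) (h.compoundPoisson_univ_le hc t))
  · rw [← hμ]
    exact h.charFun_compoundPoisson_volterra hc ξ ht
  · exact h.right.volterra_toReal (h.causal_resolvent μ) (h.measurable_resolvent μ)
      (h.resolvent_eq μ) ht (h.lconv_resolvent_ne_top μ t) (h.resolvent_ne_top μ t)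

lemma IsSoninePair.continuous_resolvent (h : IsSoninePair K L) (t : ℝ) :
    Continuous fun c : ℝ≥0 => (volterraResolvent L c t).toReal := by
  refine continuous_iff_continuousAt.2 fun c => ?_
  rw [ContinuousAt, tendsto_iff_norm_sub_tendsto_zero]
  have h1 : Tendsto (fun d : ℝ≥0 => |(d : ℝ) - c| * ((L ⋆ₗ L) t).toReal) (𝓝 c) (𝓝 0) := by
    have : Continuous fun d : ℝ≥0 => |(d : ℝ) - c| * ((L ⋆ₗ L) t).toReal := by fun_prop
    simpa using this.tendsto c
  exact squeeze_zero (fun _ => norm_nonneg _) (fun d => h.abs_resolvent_sub_le d c t) h1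

/-- A measurable family `Q` of probability measures such that `L t • Q t` has the Fourier
transform `ρ₂(t; m(ξ))`. -/
structure IsTransitionFamily (L : ℝ → ℝ≥0∞) (m : E → ℝ≥0) (Q : ℝ → Measure E) : Prop where
  measurable : Measurable Q
  isProbabilityMeasure : ∀ t, IsProbabilityMeasure (Q t)
  charFun_eq : ∀ t, 0 < t → ∀ ξ,
    ((L t).toReal : ℂ) * charFun (Q t) ξ = ((volterraResolvent L (m ξ) t).toReal : ℂ)

/-- For fixed `t` the compound Poisson measures divided by `L t` are probability measures, and their
transforms converge because the resolvent is continuous in its parameter; Lévy's theorem provides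
the limit `Q t`. Measurability in `t` survives because integrals of bounded continuous functions
converge pointwise. -/
lemma IsSoninePair.exists_transitionFamily (h : IsSoninePair K L) {m : E → ℝ≥0}
    (hm : ContinuousAt m 0) {ν : ℕ → Measure E} [∀ n, IsFiniteMeasure (ν n)] {c : ℕ → ℝ≥0}
    (hc : ∀ n, ν n univ = c n) {mn : ℕ → E → ℝ≥0}
    (hmn : ∀ n ξ, (c n : ℂ) - charFun (ν n) ξ = (mn n ξ : ℂ))
    (hlim : ∀ ξ, Tendsto (fun n => mn n ξ) atTop (𝓝 (m ξ))) :
    ∃ Q : ℝ → Measure E, IsTransitionFamily L m Q := by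
  have hchar : ∀ n t, 0 < t → ∀ ξ, charFun (compoundPoisson L (c n) (ν n) t) ξ =
      ((volterraResolvent L (mn n ξ) t).toReal : ℂ) := fun n t ht ξ =>
    h.charFun_compoundPoisson (hc n) (hmn n ξ) ht
  have hmn0 : ∀ n, mn n 0 = 0 := fun n => by
    have h1 := hmn n 0
    rw [charFun_zero, Measure.real, hc n, ENNReal.coe_toReal, sub_self] at h1
    exact_mod_cast h1.symm
  -- At `ξ = 0` the symbol vanishes and the resolvent is `L`, so the upper bound for the mass is
  -- attained.
  have hmass : ∀ n t, 0 < t → compoundPoisson L (c n) (ν n) t univ = L t := fun n t ht => by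
    have hfin := h.isFiniteMeasure_compoundPoisson (hc n) t
    have h1 := hchar n t ht 0
    rw [charFun_zero, hmn0, h.resolvent_zero] at h1
    have h2 : (compoundPoisson L (c n) (ν n) t).real univ = (L t).toReal := by exact_mod_cast h1
    exact (ENNReal.toReal_eq_toReal_iff' (measure_ne_top _ _) (h.right.ne_top t)).1 h2
  have hpos : ∀ t, L t ≠ 0 → 0 < t := fun t ht => by
    by_contra hcon
    exact ht (h.right.causal t (not_lt.1 hcon))
  have hprob : ∀ n t, L t ≠ 0 →
      IsProbabilityMeasure ((L t)⁻¹ • compoundPoisson L (c n) (ν n) t) := fun n t ht => ⟨by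
    rw [Measure.smul_apply, hmass n t (hpos t ht), smul_eq_mul,
      ENNReal.inv_mul_cancel ht (h.right.ne_top t)]⟩
  have hex : ∀ t, L t ≠ 0 → ∃ μ₀ : ProbabilityMeasure E,
      (∀ ξ, charFun (μ₀ : Measure E) ξ =
        ((L t).toReal : ℂ)⁻¹ * ((volterraResolvent L (m ξ) t).toReal : ℂ)) ∧
      ∀ g : E →ᵇ ℝ≥0, Tendsto (fun n => (L t)⁻¹ * ∫⁻ x, g x ∂compoundPoisson L (c n) (ν n) t) atTop
        (𝓝 (∫⁻ x, g x ∂(μ₀ : Measure E))) := by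
    intro t ht
    have hcont := h.continuous_resolvent t
    obtain ⟨μ₀, h1, h2⟩ := exists_probabilityMeasure_of_tendsto_charFun
      (μ := fun n => ⟨(L t)⁻¹ • compoundPoisson L (c n) (ν n) t, hprob n t ht⟩)
      (f := fun ξ => ((L t).toReal : ℂ)⁻¹ * ((volterraResolvent L (m ξ) t).toReal : ℂ)) (by
        refine ContinuousAt.mul continuousAt_const ?_
        exact Complex.continuous_ofReal.continuousAt.comp (hcont.continuousAt.comp hm)) (fun ξ => by
        have h3 : ∀ n, charFun ((L t)⁻¹ • compoundPoisson L (c n) (ν n) t) ξ =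
            ((L t).toReal : ℂ)⁻¹ * ((volterraResolvent L (mn n ξ) t).toReal : ℂ) := fun n => by
          rw [charFun_apply, integral_smul_measure, ← charFun_apply, hchar n t (hpos t ht),
            ENNReal.toReal_inv, Complex.real_smul, Complex.ofReal_inv]
        simp only [ProbabilityMeasure.coe_mk, h3]
        refine Tendsto.const_mul _ ?_
        exact (Complex.continuous_ofReal.tendsto _).comp ((hcont.tendsto _).comp (hlim ξ)))
    refine ⟨μ₀, h1, fun g => ?_⟩
    have h3 := ProbabilityMeasure.tendsto_iff_forall_lintegral_tendsto.1 h2 g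
    simpa [lintegral_smul_measure] using h3
  have : Nonempty (ProbabilityMeasure E) := ⟨⟨Measure.dirac 0, inferInstance⟩⟩
  choose! P hP1 hP2 using hex
  classical
  -- Where `L t = 0` the measure `Q t` carries no weight; the Dirac mass merely keeps the family
  -- Markovian.
  let Q : ℝ → Measure E := fun t => if L t = 0 then Measure.dirac 0 else (P t : Measure E)
  have hQprob : ∀ t, IsProbabilityMeasure (Q t) := fun t => by
    by_cases ht : L t = 0
    · simp only [Q, ht, if_true]; infer_instance
    · simp only [Q, ht, if_false]; infer_instance
  refine ⟨Q, ?_, hQprob, fun t ht ξ => ?_⟩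
  · refine measurable_of_measurable_lintegral fun g => ?_
    have hs : MeasurableSet {t | L t = 0} := h.right.measurable (measurableSet_singleton 0)
    refine measurable_of_tendsto_metrizable (f := fun (n : ℕ) t => if L t = 0 then (g 0 : ℝ≥0∞) else
      (L t)⁻¹ * ∫⁻ x, g x ∂compoundPoisson L (c n) (ν n) t) (fun n => ?_) ?_
    · refine Measurable.ite hs measurable_const (h.right.measurable.inv.mul ?_)
      exact (Measure.measurable_lintegral (by fun_prop)).comp (h.measurable_compoundPoisson _ _)
    · rw [tendsto_pi_nhds]
      intro t
      by_cases ht : L t = 0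
      · simp only [Q, ht, if_true]
        rw [lintegral_dirac' _ (by fun_prop)]
        exact tendsto_const_nhds
      · simp only [Q, ht, if_false]
        exact hP2 t ht g
  · by_cases hLt : L t = 0
    · have : volterraResolvent L (m ξ) t = 0 :=
        le_antisymm ((h.resolvent_le _ t).trans hLt.le) bot_le
      simp [hLt, this]
    · have hne : ((L t).toReal : ℂ) ≠ 0 := by
        exact_mod_cast (ENNReal.toReal_ne_zero.2 ⟨hLt, h.right.ne_top t⟩)
      simp only [Q, hLt, if_false]
      rw [hP1 t hLt, mul_inv_cancel_left₀ hne]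

end transition

/-! ### The Lévy symbol -/

namespace IsLevyKernel

variable {N : ℕ} {J : EuclideanSpace ℝ (Fin N) → ℝ}

lemma one_sub_cos_inner_le (z ξ : EuclideanSpace ℝ (Fin N)) :
    1 - Real.cos (inner ℝ z ξ) ≤ (2 + ‖ξ‖ ^ 2) * min 1 (‖z‖ ^ 2) := by
  have h1 : 1 - Real.cos (inner ℝ z ξ) ≤ 2 := by linarith [Real.neg_one_le_cos (inner ℝ z ξ)]
  have h2 : 1 - Real.cos (inner ℝ z ξ) ≤ ‖z‖ ^ 2 * ‖ξ‖ ^ 2 := by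
    have h3 := Real.one_sub_sq_div_two_le_cos (x := inner ℝ z ξ)
    have h4 : (inner ℝ z ξ : ℝ) ^ 2 ≤ (‖z‖ * ‖ξ‖) ^ 2 := by
      rw [sq_le_sq, abs_of_nonneg (by positivity : 0 ≤ ‖z‖ * ‖ξ‖)]
      exact abs_real_inner_le_norm z ξ
    nlinarith
  rcases le_total 1 (‖z‖ ^ 2) with h | h
  · rw [min_eq_left h]
    nlinarith [sq_nonneg ‖ξ‖]
  · rw [min_eq_right h]
    nlinarith [sq_nonneg ‖z‖]

variable (hJ : IsLevyKernel J)
include hJ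

lemma integrable_symbol (ξ : EuclideanSpace ℝ (Fin N)) :
    Integrable fun z => (1 - Real.cos (inner ℝ z ξ)) * J z := by
  -- Measurability is known for `min 1 |z|² J` only. Dividing recovers it for the integrand, and
  -- both sides vanish at `z = 0`.
  have h1 : (fun z => (1 - Real.cos (inner ℝ z ξ)) * J z) = fun z =>
      ((1 - Real.cos (inner ℝ z ξ)) / min 1 (‖z‖ ^ 2)) * (min 1 (‖z‖ ^ 2) * J z) := by
    ext z
    rcases eq_or_ne z 0 with rfl | hz
    · simp
    · have : min 1 (‖z‖ ^ 2) ≠ 0 := by positivity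
      field_simp
  refine Integrable.mono' (hJ.integrable.const_mul (2 + ‖ξ‖ ^ 2)) ?_ (Eventually.of_forall fun z => ?_)
  · rw [h1]
    refine AEStronglyMeasurable.mul ?_ hJ.integrable.aestronglyMeasurable
    exact Measurable.aestronglyMeasurable (by fun_prop)
  · rw [Real.norm_of_nonneg (mul_nonneg (by linarith [Real.cos_le_one (inner ℝ z ξ)]) (hJ.nonneg z)),
      ← mul_assoc]
    exact mul_le_mul_of_nonneg_right (one_sub_cos_inner_le z ξ) (hJ.nonneg z)

lemma levySymbol_nonneg (ξ : EuclideanSpace ℝ (Fin N)) : 0 ≤ levySymbol J ξ :=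
  integral_nonneg fun z => mul_nonneg (by linarith [Real.cos_le_one (inner ℝ z ξ)]) (hJ.nonneg z)

/-- Lévy's theorem asks for continuity at the origin only. The constant `3` bounds `2 + ‖ξ‖ ^ 2` on
the unit ball. -/
lemma continuousAt_levySymbol : ContinuousAt (levySymbol J) 0 := by
  refine continuousAt_of_dominated (bound := fun z => 3 * (min 1 (‖z‖ ^ 2) * J z))
    (Eventually.of_forall fun ξ => (hJ.integrable_symbol ξ).aestronglyMeasurable) ?_
    (hJ.integrable.const_mul 3) (Eventually.of_forall fun z => ?_)
  · filter_upwards [Metric.ball_mem_nhds (0 : EuclideanSpace ℝ (Fin N)) one_pos] with ξ hξ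
    rw [mem_ball_zero_iff] at hξ
    refine Eventually.of_forall fun z => ?_
    rw [Real.norm_of_nonneg (mul_nonneg (by linarith [Real.cos_le_one (inner ℝ z ξ)]) (hJ.nonneg z)),
      ← mul_assoc]
    refine mul_le_mul_of_nonneg_right ((one_sub_cos_inner_le z ξ).trans ?_) (hJ.nonneg z)
    have : 0 ≤ min 1 (‖z‖ ^ 2) := by positivity
    gcongr
    nlinarith [norm_nonneg ξ]
  · exact Continuous.continuousAt (by fun_prop)

omit hJ in
lemma integrable_truncation_aux (n : ℕ) (z : EuclideanSpace ℝ (Fin N))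
    (hz : 1 / ((n : ℝ) + 1) < ‖z‖) : ((n + 1 : ℝ) ^ 2)⁻¹ ≤ min 1 (‖z‖ ^ 2) := by
  have h0 : (0 : ℝ) < 1 / ((n : ℝ) + 1) := by positivity
  refine le_min (inv_le_one_of_one_le₀ (one_le_pow₀ (by linarith [n.cast_nonneg (α := ℝ)]))) ?_
  have : ((n + 1 : ℝ) ^ 2)⁻¹ = (1 / ((n : ℝ) + 1)) ^ 2 := by simp
  rw [this]
  gcongr

lemma integrable_truncation (n : ℕ) :
    Integrable ({z | 1 / ((n : ℝ) + 1) < ‖z‖}.indicator J) := by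
  set S := {z : EuclideanSpace ℝ (Fin N) | 1 / ((n : ℝ) + 1) < ‖z‖} with hS
  have hSm : MeasurableSet S := measurableSet_lt measurable_const measurable_norm
  have h1 : S.indicator J = S.indicator fun z => (min 1 (‖z‖ ^ 2))⁻¹ * (min 1 (‖z‖ ^ 2) * J z) := by
    refine indicator_congr fun z hz => ?_
    have : 0 < min 1 (‖z‖ ^ 2) := lt_of_lt_of_le (by positivity) (integrable_truncation_aux n z hz)
    field_simp
  refine Integrable.mono' (hJ.integrable.const_mul ((n + 1 : ℝ) ^ 2)) ?_
    (Eventually.of_forall fun z => ?_)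
  · rw [h1]
    refine AEStronglyMeasurable.indicator ?_ hSm
    exact AEStronglyMeasurable.mul (Measurable.aestronglyMeasurable (by fun_prop))
      hJ.integrable.aestronglyMeasurable
  · have h0 : 0 ≤ min 1 (‖z‖ ^ 2) := by positivity
    by_cases hz : z ∈ S
    · rw [indicator_of_mem hz, Real.norm_of_nonneg (hJ.nonneg z), ← mul_assoc]
      refine le_mul_of_one_le_left (hJ.nonneg z) ?_
      have := integrable_truncation_aux n z hz
      rwa [inv_le_iff_one_le_mul₀ (by positivity), mul_comm] at this
    · rw [indicator_of_notMem hz, norm_zero]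
      exact mul_nonneg (by positivity) (mul_nonneg h0 (hJ.nonneg z))

/-- The symbol is the limit of the symbols of finite symmetric measures. -/
lemma exists_finite_approximation :
    ∃ (ν : ℕ → Measure (EuclideanSpace ℝ (Fin N))) (c : ℕ → ℝ≥0)
      (mn : ℕ → EuclideanSpace ℝ (Fin N) → ℝ≥0), (∀ n, ν n univ = c n) ∧
      (∀ n ξ, (c n : ℂ) - charFun (ν n) ξ = (mn n ξ : ℂ)) ∧
      ∀ ξ, Tendsto (fun n => mn n ξ) atTop (𝓝 ⟨levySymbol J ξ, hJ.levySymbol_nonneg ξ⟩) := by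
  set S : ℕ → Set (EuclideanSpace ℝ (Fin N)) := fun n => {z | 1 / ((n : ℝ) + 1) < ‖z‖} with hS
  have hJn : ∀ n, Integrable ((S n).indicator J) := hJ.integrable_truncation
  have hSm : ∀ n, MeasurableSet (S n) := fun n => measurableSet_lt measurable_const measurable_norm
  have hJ0 : ∀ n z, 0 ≤ (S n).indicator J z := fun n z => indicator_nonneg (fun z _ => hJ.nonneg z) z
  have hsymm : ∀ n z, (S n).indicator J (-z) = (S n).indicator J z := fun n z => by
    by_cases hz : z ∈ S n
    · rw [indicator_of_mem hz, indicator_of_mem (by simpa [hS] using hz), hJ.radial _ _ (norm_neg z)]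
    · rw [indicator_of_notMem hz, indicator_of_notMem (by simpa [hS] using hz)]
  have hnn : ∀ n ξ, 0 ≤ ∫ z, (1 - Real.cos (inner ℝ z ξ)) * (S n).indicator J z := fun n ξ =>
    integral_nonneg fun z => mul_nonneg (by linarith [Real.cos_le_one (inner ℝ z ξ)]) (hJ0 n z)
  refine ⟨fun n => volume.withDensity fun z => ENNReal.ofReal ((S n).indicator J z),
    fun n => ⟨∫ z, (S n).indicator J z, integral_nonneg (hJ0 n)⟩, fun n ξ => ⟨_, hnn n ξ⟩,
    fun n => ?_, fun n ξ => ?_, fun ξ => ?_⟩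
  · rw [withDensity_apply _ MeasurableSet.univ, setLIntegral_univ,
      ← ofReal_integral_eq_lintegral_ofReal (hJn n) (Eventually.of_forall (hJ0 n)),
      ENNReal.ofReal_eq_coe_nnreal (integral_nonneg (hJ0 n))]
    rfl
  · have hcosi : Integrable fun z => Real.cos (inner ℝ z ξ) * (S n).indicator J z :=
      (hJn n).bdd_mul (c := 1) (Measurable.aestronglyMeasurable (by fun_prop))
        (Eventually.of_forall fun z => Real.abs_cos_le_one _)
    have hsini : Integrable fun z => Real.sin (inner ℝ z ξ) * (S n).indicator J z :=
      (hJn n).bdd_mul (c := 1) (Measurable.aestronglyMeasurable (by fun_prop))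
        (Eventually.of_forall fun z => Real.abs_sin_le_one _)
    -- Radial symmetry makes the truncated kernel even, so its Fourier transform is real.
    have hsin : ∫ z, Real.sin (inner ℝ z ξ) * (S n).indicator J z = 0 := by
      have h1 := integral_neg_eq_self
        (fun z => Real.sin (inner ℝ z ξ) * (S n).indicator J z) volume
      simp only [inner_neg_left, Real.sin_neg, hsymm, neg_mul, integral_neg] at h1
      linarith
    have h1 : charFun (volume.withDensity fun z => ENNReal.ofReal ((S n).indicator J z)) ξ =
        ((∫ z, Real.cos (inner ℝ z ξ) * (S n).indicator J z : ℝ) : ℂ) +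
          ((∫ z, Real.sin (inner ℝ z ξ) * (S n).indicator J z : ℝ) : ℂ) * Complex.I := by
      rw [charFun_apply, integral_withDensity_eq_integral_toReal_smul₀
        (hJn n).aestronglyMeasurable.aemeasurable.ennreal_ofReal
        (Eventually.of_forall fun z => ENNReal.ofReal_lt_top), ← integral_complex_ofReal,
        ← integral_complex_ofReal, ← integral_mul_const, ← integral_add hcosi.ofReal
        (hsini.ofReal.mul_const _)]
      refine integral_congr_ae (Eventually.of_forall fun z => ?_)
      have h2 := ENNReal.toReal_ofReal (hJ0 n z)
      simp only [h2, Complex.exp_mul_I, Complex.real_smul]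
      push_cast
      ring
    rw [h1, hsin]
    have h2 : ∫ z, (1 - Real.cos (inner ℝ z ξ)) * (S n).indicator J z =
        (∫ z, (S n).indicator J z) - ∫ z, Real.cos (inner ℝ z ξ) * (S n).indicator J z := by
      rw [← integral_sub (hJn n) hcosi]
      exact integral_congr_ae (Eventually.of_forall fun z => by ring)
    change ((∫ z, (S n).indicator J z : ℝ) : ℂ) - _ =
      ((∫ z, (1 - Real.cos (inner ℝ z ξ)) * (S n).indicator J z : ℝ) : ℂ)
    rw [h2]
    push_cast
    ring
  · refine NNReal.tendsto_coe.1 ?_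
    change Tendsto (fun n => ∫ z, (1 - Real.cos (inner ℝ z ξ)) * (S n).indicator J z) atTop
      (𝓝 (∫ z, (1 - Real.cos (inner ℝ z ξ)) * J z))
    refine tendsto_integral_of_dominated_convergence
      (fun z => (1 - Real.cos (inner ℝ z ξ)) * J z) (fun n => ?_) (hJ.integrable_symbol ξ)
      (fun n => Eventually.of_forall fun z => ?_) (Eventually.of_forall fun z => ?_)
    · exact (Measurable.aestronglyMeasurable (by fun_prop)).mul (hJn n).aestronglyMeasurable
    · have h0 : 0 ≤ 1 - Real.cos (inner ℝ z ξ) := by linarith [Real.cos_le_one (inner ℝ z ξ)]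
      rw [Real.norm_of_nonneg (mul_nonneg h0 (hJ0 n z))]
      exact mul_le_mul_of_nonneg_left (indicator_le_self' (fun z _ => hJ.nonneg z) z) h0
    · rcases eq_or_ne z 0 with rfl | hz
      · simp
      · refine tendsto_const_nhds.congr' ?_
        filter_upwards [(tendsto_one_div_add_atTop_nhds_zero_nat (𝕜 := ℝ)).eventually_lt_const
          (norm_pos_iff.2 hz)] with n hn
        rw [indicator_of_mem (show z ∈ S n from hn)]

end IsLevyKernel

lemma IsLevyKernel.exists_transitionFamily {N : ℕ} {J : EuclideanSpace ℝ (Fin N) → ℝ}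
    (hJ : IsLevyKernel J) {K L : ℝ → ℝ≥0∞} (h : IsSoninePair K L) :
    ∃ Q, IsTransitionFamily L (fun ξ => (⟨levySymbol J ξ, hJ.levySymbol_nonneg ξ⟩ : ℝ≥0)) Q := by
  obtain ⟨ν, c, mn, hc, hmn, hlim⟩ := hJ.exists_finite_approximation
  have : ∀ n, IsFiniteMeasure (ν n) := fun n => ⟨by rw [hc n]; exact ENNReal.coe_lt_top⟩
  exact h.exists_transitionFamily (NNReal.tendsto_coe.1 hJ.continuousAt_levySymbol) hc hmn hlim

/-! ### The fundamental pair -/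

section pair

variable {E : Type*} [MeasurableSpace E]

/-- The measures `Y t` of the fundamental pair in terms of a transition family. -/
noncomputable def fundamentalY (L : ℝ → ℝ≥0∞) (Q : ℝ → Measure E) (t : ℝ) : Measure E := L t • Q t

/-- The measures `Z t = ∫ K (t - s) L(s) Q s ds` of the fundamental pair. -/
noncomputable def fundamentalZ (K L : ℝ → ℝ≥0∞) (Q : ℝ → Measure E) (t : ℝ) : Measure E :=
  (volume.withDensity fun s => K (t - s) * L s).bind Q

variable {K L : ℝ → ℝ≥0∞}

lemma lintegral_fundamentalZ {Q : ℝ → Measure E} (hK : Measurable K) (hL : Measurable L)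
    (hQ : Measurable Q) (t : ℝ) {f : E → ℝ≥0∞} (hf : Measurable f) :
    ∫⁻ x, f x ∂fundamentalZ K L Q t = ∫⁻ s, K (t - s) * L s * ∫⁻ x, f x ∂Q s := by
  have hQf : Measurable fun s => ∫⁻ x, f x ∂Q s := (Measure.measurable_lintegral hf).comp hQ
  rw [fundamentalZ, Measure.lintegral_bind hQ.aemeasurable hf.aemeasurable,
    lintegral_withDensity_eq_lintegral_mul _ (by fun_prop) hQf]
  rfl

variable [NormedAddCommGroup E] [InnerProductSpace ℝ E] [BorelSpace E] {m : E → ℝ≥0}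
  {Q : ℝ → Measure E}

/-- Each `Q s` has mass one, so the mass of the mixture is `(K ⋆ L) t`. -/
lemma fundamentalZ_univ (h : IsSoninePair K L) (hQ : IsTransitionFamily L m Q) (t : ℝ) :
    fundamentalZ K L Q t univ = heaviside t := by
  have h1 := lintegral_fundamentalZ h.left.measurable h.right.measurable hQ.measurable t
    (f := fun _ => 1) measurable_const
  have := hQ.isProbabilityMeasure
  simpa [← lconv_eq_lintegral_sub, h.lconv_eq] using h1

lemma isProbabilityMeasure_fundamentalZ (h : IsSoninePair K L) (hQ : IsTransitionFamily L m Q)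
    {t : ℝ} (ht : 0 < t) : IsProbabilityMeasure (fundamentalZ K L Q t) :=
  ⟨by rw [fundamentalZ_univ h hQ, heaviside_of_pos ht]⟩

lemma isFiniteMeasure_fundamentalZ (h : IsSoninePair K L) (hQ : IsTransitionFamily L m Q)
    (t : ℝ) : IsFiniteMeasure (fundamentalZ K L Q t) :=
  ⟨by rw [fundamentalZ_univ h hQ]; exact ((IsTimeKernel.heaviside h).ne_top t).lt_top⟩

lemma isFiniteMeasure_fundamentalY (h : IsSoninePair K L) (hQ : IsTransitionFamily L m Q)
    (t : ℝ) : IsFiniteMeasure (fundamentalY L Q t) := by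
  have := hQ.isProbabilityMeasure t
  exact ⟨by simpa [fundamentalY] using (h.right.ne_top t).lt_top⟩

lemma charFun_fundamentalY (hQ : IsTransitionFamily L m Q) {t : ℝ} (ht : 0 < t) (ξ : E) :
    charFun (fundamentalY L Q t) ξ = ((volterraResolvent L (m ξ) t).toReal : ℂ) := by
  rw [fundamentalY, charFun_apply, integral_smul_measure, ← charFun_apply, Complex.real_smul,
    hQ.charFun_eq t ht]

lemma charFun_fundamentalZ [SecondCountableTopology E] (h : IsSoninePair K L)
    (hQ : IsTransitionFamily L m Q) (t : ℝ) (ξ : E) :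
    charFun (fundamentalZ K L Q t) ξ =
      (((K ⋆ₗ volterraResolvent L (m ξ)) t).toReal : ℂ) := by
  have hKm := h.left.measurable
  have hLm := h.right.measurable
  have hrm := h.measurable_resolvent (m ξ)
  have hfin := isFiniteMeasure_fundamentalZ h hQ t
  -- As a composition of kernels, the mixture admits Fubini's theorem for the complex exponential:
  -- the transform is the integral of `K (t - s) L s Q̂_s(ξ)`, and `L s Q̂_s(ξ)` is the resolvent at
  -- `m ξ`.
  let η : ProbabilityTheory.Kernel ℝ E := ⟨Q, hQ.measurable⟩
  have hbind : fundamentalZ K L Q t = (η.comp (ProbabilityTheory.Kernel.const Unit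
      (volume.withDensity fun s => K (t - s) * L s))) () := rfl
  have hint : Integrable (fun x => Complex.exp (inner ℝ x ξ * Complex.I))
      (fundamentalZ K L Q t) := by
    refine Integrable.of_bound (C := 1) (Measurable.aestronglyMeasurable (by fun_prop))
      (Eventually.of_forall fun x => ?_)
    rw [Complex.norm_exp_ofReal_mul_I]
  rw [charFun_apply]
  rw [hbind] at hint ⊢
  rw [ProbabilityTheory.Kernel.integral_comp hint, ProbabilityTheory.Kernel.const_apply]
  change ∫ s, charFun (Q s) ξ ∂_ = _
  rw [integral_withDensity_eq_integral_toReal_smul (by fun_prop) (Eventually.of_forall fun s =>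
    ENNReal.mul_lt_top (h.left.ne_top _).lt_top (h.right.ne_top _).lt_top),
    lconv_eq_lintegral_sub, ← integral_toReal
    (f := fun s => K (t - s) * volterraResolvent L (m ξ) s) (Measurable.aemeasurable (by fun_prop))
    (Eventually.of_forall fun s =>
      ENNReal.mul_lt_top (h.left.ne_top _).lt_top (h.resolvent_ne_top _ _).lt_top),
    ← integral_complex_ofReal]
  refine integral_congr_ae (Eventually.of_forall fun s => ?_)
  simp only [ENNReal.toReal_mul, Complex.real_smul]
  rcases le_or_gt s 0 with hs | hs
  · simp [h.right.causal s hs, h.causal_resolvent (m ξ) s hs]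
  · push_cast
    rw [mul_assoc, hQ.charFun_eq s hs]

end pair

namespace IsMemoryKernelPair

variable {κ ℓ : ℝ → ℝ} (h : IsMemoryKernelPair κ ℓ)
include h

lemma volterra_complex {μ : ℝ} {g ρ : ℝ → ℝ} (hρ : IsVolterraSolution ℓ μ g ρ) {t : ℝ}
    (ht : 0 < t) : (ρ t : ℂ) + μ * ∫ s in (0 : ℝ)..t, ((timeKernel ℓ (t - s)).toReal : ℂ) * ρ s =
      g t := by
  rw [← h.intervalIntegral_ell ht, ← hρ.eqn t ht]
  push_cast
  rw [← intervalIntegral.integral_ofReal]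
  push_cast
  rfl

lemma volterra_unique {μ : ℝ} {g ρ ρ' : ℝ → ℝ} (hρ : IsVolterraSolution ℓ μ g ρ)
    (hρ' : IsVolterraSolution ℓ μ g ρ') {t : ℝ} (ht : 0 < t) : ρ t = ρ' t := by
  have := h.isSoninePair.right.volterra_unique (σ := fun t => (ρ t : ℂ)) (τ := fun t => (ρ' t : ℂ))
    (fun T hT => (hρ.integrableOn T hT).ofReal) (fun T hT => (hρ'.integrableOn T hT).ofReal)
    (μ := μ) (g := fun t => (g t : ℂ)) (fun t ht => h.volterra_complex hρ ht)
    (fun t ht => h.volterra_complex hρ' ht) ht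
  exact_mod_cast this

/-- Nonnegative solutions of the Volterra equation give real solutions. -/
lemma isVolterraSolution {X G : ℝ → ℝ≥0∞} {c : ℝ≥0} {g : ℝ → ℝ} (hX : Causal X)
    (hXm : Measurable X) (hXfin : ∀ T, ∫⁻ t in Ioc 0 T, X t < ∞) (hXt : ∀ t, X t ≠ ∞)
    (heq : X + (c : ℝ≥0∞) • (timeKernel ℓ ⋆ₗ X) = G) (hfin : ∀ t, (timeKernel ℓ ⋆ₗ X) t ≠ ∞)
    (hg : ∀ t, 0 < t → (G t).toReal = g t) :
    IsVolterraSolution ℓ c g fun t => (X t).toReal where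
  integrableOn T _ := integrable_toReal_of_lintegral_ne_top hXm.aemeasurable (hXfin T).ne
  eqn t ht := by
    have h1 := h.isSoninePair.right.volterra_toReal hX hXm heq ht (hfin t) (hXt t)
    rw [← h.intervalIntegral_ell ht, hg t ht] at h1
    have h2 : ∫ s in (0 : ℝ)..t, ((ℓ (t - s) : ℝ) : ℂ) * ((X s).toReal : ℂ) =
        ((∫ s in (0 : ℝ)..t, ℓ (t - s) * (X s).toReal : ℝ) : ℂ) := by
      rw [← intervalIntegral.integral_ofReal]
      push_cast
      rfl
    rw [h2] at h1
    exact_mod_cast h1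

variable {N : ℕ} {J : EuclideanSpace ℝ (Fin N) → ℝ} (hJ : IsLevyKernel J)
  {Q : ℝ → Measure (EuclideanSpace ℝ (Fin N))}
  (hQ : IsTransitionFamily (timeKernel ℓ)
    (fun ξ => (⟨levySymbol J ξ, hJ.levySymbol_nonneg ξ⟩ : ℝ≥0)) Q)
include hQ

lemma isFundamentalPair : IsFundamentalPair ℓ J
    (fundamentalZ (timeKernel κ) (timeKernel ℓ) Q) (fundamentalY (timeKernel ℓ) Q) where
  finite_Z t _ := isFiniteMeasure_fundamentalZ h.isSoninePair hQ t
  finite_Y t _ := isFiniteMeasure_fundamentalY h.isSoninePair hQ t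
  fourier_Z ξ := by
    have hS := h.isSoninePair
    set c : ℝ≥0 := ⟨levySymbol J ξ, hJ.levySymbol_nonneg ξ⟩ with hc
    have hKm := hS.left.measurable
    have hLm := hS.right.measurable
    have hrm := hS.measurable_resolvent c
    have hle := hS.kernel_lconv_resolvent_le c
    have hH := IsTimeKernel.heaviside hS
    refine ⟨_, h.isVolterraSolution (c := c) (g := fun _ => 1) (G := heaviside)
      (hS.left.causal.lconv (hS.causal_resolvent c)) (by fun_prop)
      (fun T => (lintegral_mono hle).trans_lt (hH.lintegral_Ioc_lt_top T))
      (fun t => ((hle t).trans_lt (hH.ne_top t).lt_top).ne) (hS.lconv_kernel_lconv_resolvent c)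
      (fun t => ?_) fun t ht => by simp [heaviside_of_pos ht],
      fun t ht => charFun_fundamentalZ hS hQ t ξ⟩
    rw [lconvolution_assoc hLm hKm hrm, lconvolution_comm (f := timeKernel ℓ), hS.lconv_eq,
      heaviside_lconv]
    exact ((lintegral_mono (hS.resolvent_le c)).trans_lt (hS.right.lintegral_lt_top t)).ne
  fourier_Y ξ := by
    have hS := h.isSoninePair
    set c : ℝ≥0 := ⟨levySymbol J ξ, hJ.levySymbol_nonneg ξ⟩ with hc
    refine ⟨_, h.isVolterraSolution (c := c) (g := ℓ) (G := timeKernel ℓ)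
      (hS.causal_resolvent c) (hS.measurable_resolvent c)
      (fun T => (lintegral_mono (hS.resolvent_le c)).trans_lt (hS.right.lintegral_Ioc_lt_top T))
      (hS.resolvent_ne_top c) (hS.resolvent_eq c) (hS.lconv_resolvent_ne_top c)
      fun t ht => h.toReal_ell ht, fun t ht => charFun_fundamentalY hQ ht ξ⟩

omit hQ in
-- Uniqueness for the Volterra equations fixes the Fourier transforms, which determine finite
-- measures.
lemma eq_of_isFundamentalPair {Z Y Z' Y' : ℝ → Measure (EuclideanSpace ℝ (Fin N))}
    (h₁ : IsFundamentalPair ℓ J Z Y) (h₂ : IsFundamentalPair ℓ J Z' Y') {t : ℝ} (ht : 0 < t) :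
    Z' t = Z t ∧ Y' t = Y t := by
  have := h₁.finite_Z t ht
  have := h₁.finite_Y t ht
  have := h₂.finite_Z t ht
  have := h₂.finite_Y t ht
  refine ⟨Measure.ext_of_charFun (funext fun ξ => ?_), Measure.ext_of_charFun (funext fun ξ => ?_)⟩
  · obtain ⟨ρ, hρ, h3⟩ := h₁.fourier_Z ξ
    obtain ⟨ρ', hρ', h4⟩ := h₂.fourier_Z ξ
    rw [h3 t ht, h4 t ht, h.volterra_unique hρ hρ' ht]
  · obtain ⟨ρ, hρ, h3⟩ := h₁.fourier_Y ξ
    obtain ⟨ρ', hρ', h4⟩ := h₂.fourier_Y ξ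
    rw [h3 t ht, h4 t ht, h.volterra_unique hρ hρ' ht]

end IsMemoryKernelPair

/-! ### Convolution with families of measures -/

section mixture

variable {E : Type*} [MeasureSpace E] [AddCommGroup E]

/-- The convolution of a measure and a nonnegative function. -/
noncomputable def measureConv (μ : Measure E) (f : E → ℝ≥0∞) (x : E) : ℝ≥0∞ := ∫⁻ y, f (x - y) ∂μ

/-- The mixture `∫ a(s) (Q s * F s) dν(s)`. -/
noncomputable def mixture {α : Type*} [MeasurableSpace α] (ν : Measure α) (Q : α → Measure E)
    (a : α → ℝ≥0∞) (F : α → E → ℝ≥0∞) (x : E) : ℝ≥0∞ :=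
  ∫⁻ s, a s * measureConv (Q s) (F s) x ∂ν

/-- `f` is bounded by `c` pointwise and in `L¹`. -/
def IsBoundX (f : E → ℝ≥0∞) (c : ℝ≥0∞) : Prop := (∀ x, f x ≤ c) ∧ ∫⁻ x, f x ≤ c

lemma IsBoundX.mono {f g : E → ℝ≥0∞} {c d : ℝ≥0∞} (h : IsBoundX f c) (hg : g ≤ f) (hc : c ≤ d) :
    IsBoundX g d :=
  ⟨fun x => ((hg x).trans (h.1 x)).trans hc, ((lintegral_mono hg).trans h.2).trans hc⟩

lemma IsBoundX.add {f g : E → ℝ≥0∞} {c d : ℝ≥0∞} (hf : IsBoundX f c) (hg : IsBoundX g d)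
    (hfm : Measurable f) : IsBoundX (f + g) (c + d) :=
  ⟨fun x => add_le_add (hf.1 x) (hg.1 x), (lintegral_add_left hfm g).trans_le (add_le_add hf.2 hg.2)⟩

lemma IsBoundX.const_mul {f : E → ℝ≥0∞} {c : ℝ≥0∞} (hf : IsBoundX f c) (hfm : Measurable f)
    (k : ℝ≥0∞) : IsBoundX (fun x => k * f x) (k * c) :=
  ⟨fun x => mul_le_mul_right (hf.1 x) k,
    (lintegral_const_mul k hfm).trans_le (mul_le_mul_right hf.2 k)⟩

lemma isBoundX_zero (c : ℝ≥0∞) : IsBoundX (0 : E → ℝ≥0∞) c := ⟨fun x => by simp, by simp⟩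

lemma measureConv_mono (μ : Measure E) {f g : E → ℝ≥0∞} (h : f ≤ g) (x : E) :
    measureConv μ f x ≤ measureConv μ g x := lintegral_mono fun _ => h _

variable {α : Type*} [MeasurableSpace α] {ν : Measure α} {Q : α → Measure E} {a b : α → ℝ≥0∞}
  {F G : α → E → ℝ≥0∞}

lemma mixture_mono (h : ∀ s, a s ≠ 0 → F s ≤ G s) (x : E) :
    mixture ν Q a F x ≤ mixture ν Q a G x := by
  refine lintegral_mono fun s => ?_
  rcases eq_or_ne (a s) 0 with ha | ha
  · simp [ha]
  · exact mul_le_mul_right (measureConv_mono _ (h s ha) x) _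

variable [MeasurableAdd₂ E] [MeasurableNeg E] [∀ s, IsProbabilityMeasure (Q s)]

lemma measurable_measureConv (hQ : Measurable Q) (hF : Measurable (Function.uncurry F)) :
    Measurable fun q : α × E => measureConv (Q q.1) (F q.1) q.2 := by
  let κ : ProbabilityTheory.Kernel (α × E) E := ⟨fun q => Q q.1, hQ.comp measurable_fst⟩
  have : ProbabilityTheory.IsMarkovKernel κ := ⟨fun q => by
    change IsProbabilityMeasure (Q q.1); infer_instance⟩
  have h1 : Measurable fun r : (α × E) × E => F r.1.1 (r.1.2 - r.2) :=
    hF.comp (by fun_prop : Measurable fun r : (α × E) × E => (r.1.1, r.1.2 - r.2))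
  exact h1.lintegral_kernel_prod_right' (κ := κ)

lemma measurable_measureConv_left (hQ : Measurable Q) (hF : Measurable (Function.uncurry F))
    (x : E) : Measurable fun s => measureConv (Q s) (F s) x :=
  (measurable_measureConv hQ hF).comp (measurable_id.prodMk measurable_const)

lemma measurable_mul_measureConv (hQ : Measurable Q) (ha : Measurable a)
    (hF : Measurable (Function.uncurry F)) (x : E) :
    Measurable fun s => a s * measureConv (Q s) (F s) x :=
  ha.mul (measurable_measureConv_left hQ hF x)

lemma measurable_mixture [SFinite ν] {β : Type*} [MeasurableSpace β] (hQ : Measurable Q)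
    {a : β → α → ℝ≥0∞} {F : β → α → E → ℝ≥0∞} (ha : Measurable fun q : β × α => a q.1 q.2)
    (hF : Measurable fun q : β × α × E => F q.1 q.2.1 q.2.2) :
    Measurable fun q : β × E => mixture ν Q (a q.1) (F q.1) q.2 := by
  have h1 : Measurable fun r : (β × α) × E => measureConv (Q r.1.2) (F r.1.1 r.1.2) r.2 := by
    refine measurable_measureConv (Q := fun r : β × α => Q r.2)
      (F := fun r : β × α => F r.1 r.2) (hQ.comp measurable_snd) ?_
    exact hF.comp (by fun_prop : Measurable fun r : (β × α) × E => (r.1.1, r.1.2, r.2))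
  refine Measurable.lintegral_prod_right' (f := fun r : (β × E) × α =>
    a r.1.1 r.2 * measureConv (Q r.2) (F r.1.1 r.2) r.1.2) ?_
  exact (ha.comp (by fun_prop : Measurable fun r : (β × E) × α => (r.1.1, r.2))).mul
    (h1.comp (by fun_prop : Measurable fun r : (β × E) × α => ((r.1.1, r.2), r.1.2)))

lemma measureConv_le (s : α) {f : E → ℝ≥0∞} {c : ℝ≥0∞} (h : ∀ x, f x ≤ c) (x : E) :
    measureConv (Q s) f x ≤ c :=
  (lintegral_mono fun y => h (x - y)).trans (by simp)

lemma mixture_add (hQ : Measurable Q) (ha : Measurable a) (hF : Measurable (Function.uncurry F))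
    (G : α → E → ℝ≥0∞) (x : E) :
    mixture ν Q a (F + G) x = mixture ν Q a F x + mixture ν Q a G x := by
  rw [mixture, mixture, mixture,
    ← lintegral_add_left (measurable_mul_measureConv hQ ha hF x)]
  refine lintegral_congr fun s => ?_
  rw [← mul_add]
  congr 1
  have h1 : Measurable (F s) := hF.comp (by fun_prop : Measurable fun y => (s, y))
  exact lintegral_add_left (h1.comp (measurable_const.sub measurable_id)) _

/-- Truncated subtraction on `[0, ∞]` is only subadditive, so linearity is used in this one-sided
form. The next lemma does the same for the weight. -/
lemma mixture_sub_le (hQ : Measurable Q) (ha : Measurable a)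
    (hG : Measurable (Function.uncurry G)) (x : E) :
    mixture ν Q a F x - mixture ν Q a G x ≤ mixture ν Q a (F - G) x := by
  rw [tsub_le_iff_left, ← mixture_add hQ ha hG]
  exact mixture_mono (fun s _ y => le_add_tsub) x

lemma mixture_weight_sub_le (hQ : Measurable Q) (hb : Measurable b)
    (hF : Measurable (Function.uncurry F)) (x : E) :
    mixture ν Q a F x - mixture ν Q b F x ≤ mixture ν Q (a - b) F x := by
  rw [tsub_le_iff_left, mixture, mixture, mixture,
    ← lintegral_add_left (measurable_mul_measureConv hQ hb hF x)]
  refine lintegral_mono fun s => ?_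
  rw [← add_mul]
  exact mul_le_mul_left le_add_tsub _

variable [SFinite (volume : Measure E)] [(volume : Measure E).IsAddRightInvariant]

lemma lintegral_measureConv (μ : Measure E) [IsProbabilityMeasure μ] {f : E → ℝ≥0∞}
    (hf : Measurable f) : ∫⁻ x, measureConv μ f x = ∫⁻ x, f x := by
  simp only [measureConv]
  rw [lintegral_lintegral_swap]
  · simp [lintegral_sub_right_eq_self]
  · exact (hf.comp (by fun_prop : Measurable fun q : E × E => q.1 - q.2)).aemeasurable

lemma lintegral_mixture [SFinite ν] (hQ : Measurable Q) (ha : Measurable a)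
    (hF : Measurable (Function.uncurry F)) :
    ∫⁻ x, mixture ν Q a F x = ∫⁻ s, a s * (∫⁻ x, F s x) ∂ν := by
  simp only [mixture]
  have hm := measurable_measureConv hQ hF
  rw [lintegral_lintegral_swap]
  · refine lintegral_congr fun s => ?_
    have h1 : Measurable fun x => measureConv (Q s) (F s) x :=
      hm.comp (by fun_prop : Measurable fun x : E => (s, x))
    rw [lintegral_const_mul _ h1, lintegral_measureConv _ hF.of_uncurry_left]
  · exact ((ha.comp measurable_snd).mul (hm.comp measurable_swap)).aemeasurable

lemma IsBoundX.mixture [SFinite ν] (hQ : Measurable Q) (ha : Measurable a)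
    (hF : Measurable (Function.uncurry F)) {c : α → ℝ≥0∞} (h : ∀ s, a s ≠ 0 → IsBoundX (F s) (c s)) :
    IsBoundX (mixture ν Q a F) (∫⁻ s, a s * c s ∂ν) := by
  refine ⟨fun x => lintegral_mono fun s => ?_, ?_⟩
  · rcases eq_or_ne (a s) 0 with hs | hs
    · simp [hs]
    · exact mul_le_mul_right (measureConv_le s (h s hs).1 x) _
  · rw [lintegral_mixture hQ ha hF]
    refine lintegral_mono fun s => ?_
    rcases eq_or_ne (a s) 0 with hs | hs
    · simp [hs]
    · exact mul_le_mul_right (h s hs).2 _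

/-- Properties which hold almost everywhere are preserved under translations by almost every
point. -/
lemma ae_ae_ae_sub [SFinite ν] (hQ : Measurable Q) {P : α → E → Prop}
    (h : ∀ᵐ q ∂ν.prod volume, P q.1 q.2) : ∀ᵐ x, ∀ᵐ s ∂ν, ∀ᵐ y ∂Q s, P s (x - y) := by
  -- By translation invariance, averaging the indicator of a null set over the translations leaves
  -- its integral zero. The averaged indicator thus vanishes for almost every `x`, even when the
  -- measures `Q s` have atoms.
  obtain ⟨B, hB, hBm, hB0⟩ := exists_measurable_superset_of_null (ae_iff.1 h)
  have hF : Measurable (Function.uncurry fun s y => B.indicator (1 : α × E → ℝ≥0∞) (s, y)) :=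
    (measurable_one.indicator hBm)
  have h1 := lintegral_mixture (ν := ν) (a := fun _ => 1) hQ measurable_const hF
  have h2 : ∫⁻ s, (∫⁻ x, B.indicator (1 : α × E → ℝ≥0∞) (s, x)) ∂ν = 0 := by
    rw [← lintegral_prod (fun q => B.indicator (1 : α × E → ℝ≥0∞) q)
      (measurable_one.indicator hBm).aemeasurable, lintegral_indicator_one hBm, hB0]
  simp only [one_mul, h2] at h1
  have hmm := measurable_measureConv hQ hF
  have h3 : Measurable fun x => mixture ν Q (fun _ => 1)
      (fun s y => B.indicator (1 : α × E → ℝ≥0∞) (s, y)) x :=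
    (measurable_mixture (β := Unit) (a := fun _ _ => 1)
      (F := fun _ s y => B.indicator (1 : α × E → ℝ≥0∞) (s, y)) hQ measurable_const
      (hF.comp (measurable_snd))).comp (by fun_prop : Measurable fun x : E => ((), x))
  filter_upwards [(lintegral_eq_zero_iff h3).1 h1] with x hx
  have h4 : Measurable fun s => measureConv (Q s)
      (fun y => B.indicator (1 : α × E → ℝ≥0∞) (s, y)) x := measurable_measureConv_left hQ hF x
  simp only [mixture, one_mul, Pi.zero_apply] at hx
  filter_upwards [(lintegral_eq_zero_iff h4).1 hx] with s hs
  have h5 : Measurable fun y => B.indicator (1 : α × E → ℝ≥0∞) (s, x - y) :=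
    hF.comp (by fun_prop : Measurable fun y => (s, x - y))
  filter_upwards [(lintegral_eq_zero_iff h5).1 hs] with y hy
  by_contra hcon
  have : (s, x - y) ∈ B := hB hcon
  simp [this] at hy

end mixture

/-! ### Monotone iteration for the Duhamel formula -/

lemma Real.rpow_sub_rpow_le {p M x y : ℝ} (hp : 1 ≤ p) (hy : 0 ≤ y) (hyx : y ≤ x) (hx : x ≤ M) :
    x ^ p - y ^ p ≤ p * M ^ (p - 1) * (x - y) := by
  have hM : 0 ≤ M := (hy.trans hyx).trans hx
  have h1 : ∀ z ∈ Icc 0 M, ‖p * z ^ (p - 1)‖ ≤ p * M ^ (p - 1) := fun z hz => by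
    rw [Real.norm_of_nonneg (mul_nonneg (by linarith) (Real.rpow_nonneg hz.1 _))]
    have := Real.rpow_le_rpow hz.1 hz.2 (by linarith : 0 ≤ p - 1)
    gcongr
  have h2 := Convex.norm_image_sub_le_of_norm_hasDerivWithin_le (f := fun z : ℝ => z ^ p)
    (fun z _ => (Real.hasDerivAt_rpow_const (Or.inr hp)).hasDerivWithinAt) h1
    (convex_Icc 0 M) ⟨hy, hyx.trans hx⟩ ⟨hy.trans hyx, hx⟩
  rw [Real.norm_of_nonneg (sub_nonneg.2 (Real.rpow_le_rpow hy hyx (by linarith))),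
    Real.norm_of_nonneg (sub_nonneg.2 hyx)] at h2
  exact h2

/-- The Lipschitz constant of `x ↦ x ^ p` on `[0, M]`. -/
noncomputable def powLip (p : ℝ) (M : ℝ≥0) : ℝ≥0 := p.toNNReal * M ^ (p - 1)

lemma ENNReal.rpow_sub_rpow_le {p : ℝ} (hp : 1 ≤ p) {M : ℝ≥0} {x y : ℝ≥0∞} (hx : x ≤ M) :
    x ^ p - y ^ p ≤ powLip p M * (x - y) := by
  -- For `x ≤ y` the truncated difference vanishes; this is why only `x` has to be bounded.
  rcases le_total x y with hxy | hxy
  · rw [tsub_eq_zero_of_le (ENNReal.rpow_le_rpow hxy (by linarith))]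
    exact bot_le
  lift x to ℝ≥0 using (hx.trans_lt ENNReal.coe_lt_top).ne
  lift y to ℝ≥0 using (hxy.trans_lt ENNReal.coe_lt_top).ne
  rw [← ENNReal.coe_rpow_of_nonneg _ (by linarith), ← ENNReal.coe_rpow_of_nonneg _ (by linarith)]
  norm_cast
  norm_cast at hx hxy
  rw [← NNReal.coe_le_coe, NNReal.coe_sub (NNReal.rpow_le_rpow hxy (by linarith)), powLip]
  push_cast
  rw [NNReal.coe_sub hxy, Real.coe_toNNReal p (by linarith)]
  exact Real.rpow_sub_rpow_le hp y.2 hxy hx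

section picard

variable {E : Type*} [MeasureSpace E] [AddCommGroup E]

/-- The Duhamel integral `∫₀ᵗ Y_{t-s} * F(s) ds`. -/
noncomputable def duhamelIntegral (L : ℝ → ℝ≥0∞) (Q : ℝ → Measure E) (F : ℝ → E → ℝ≥0∞) (t : ℝ) :
    -- The time variable is reversed, so the weights and measures do not depend on `t` and the time
    -- enters through `F` alone.
    E → ℝ≥0∞ := mixture volume Q L fun s => F (t - s)

/-- The free evolution `Z_t * f`. -/
noncomputable def freeEvolution (K L : ℝ → ℝ≥0∞) (Q : ℝ → Measure E) (f : E → ℝ≥0∞) (t : ℝ) :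
    E → ℝ≥0∞ := mixture volume Q (fun s => K (t - s) * L s) fun _ => f

/-- The Picard iterates for the Duhamel formula. -/
noncomputable def picard (K L : ℝ → ℝ≥0∞) (Q : ℝ → Measure E) (p : ℝ) (f : E → ℝ≥0∞) :
    ℕ → ℝ → E → ℝ≥0∞
  | 0 => 0
  | n + 1 => fun t => freeEvolution K L Q f t + duhamelIntegral L Q (fun s y => picard K L Q p f n s y ^ p) t

/-- The limit of the Picard iterates. -/
noncomputable def picardLimit (K L : ℝ → ℝ≥0∞) (Q : ℝ → Measure E) (p : ℝ) (f : E → ℝ≥0∞)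
    (t : ℝ) (x : E) : ℝ≥0∞ := ⨆ n, picard K L Q p f n t x

variable {K L : ℝ → ℝ≥0∞} {Q : ℝ → Measure E} {p : ℝ} {f : E → ℝ≥0∞}

lemma IsTimeKernel.pos_of_ne_zero (hL : IsTimeKernel L) {s : ℝ} (hs : L s ≠ 0) : 0 < s := by
  by_contra hcon
  exact hs (hL.causal s (not_lt.1 hcon))

lemma duhamel_of_nonpos (hL : IsTimeKernel L) {F : ℝ → E → ℝ≥0∞} (hF : ∀ t ≤ 0, F t = 0) {t : ℝ}
    (ht : t ≤ 0) : duhamelIntegral L Q F t = 0 := by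
  ext x
  refine (lintegral_congr fun s => ?_).trans lintegral_zero
  rcases eq_or_ne (L s) 0 with hs | hs
  · simp [hs]
  · have := hL.pos_of_ne_zero hs
    simp [measureConv, hF (t - s) (by linarith)]

lemma freeEvolution_of_nonpos (hK : IsTimeKernel K) (hL : IsTimeKernel L) {t : ℝ}
    (ht : t ≤ 0) : freeEvolution K L Q f t = 0 := by
  ext x
  refine (lintegral_congr fun s => ?_).trans lintegral_zero
  rcases eq_or_ne (L s) 0 with hs | hs
  · simp [hs]
  · have := hL.pos_of_ne_zero hs
    simp [hK.causal (t - s) (by linarith)]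

lemma picard_of_nonpos (h : IsSoninePair K L) (hp : 0 < p) (n : ℕ) : ∀ t ≤ 0,
    picard K L Q p f n t = 0 := by
  induction n with
  | zero => exact fun _ _ => rfl
  | succ n ih =>
    intro t ht
    simp only [picard]
    rw [freeEvolution_of_nonpos h.left h.right ht, duhamel_of_nonpos h.right _ ht, add_zero]
    intro s hs
    ext y
    simp [ih s hs, hp]

lemma duhamel_mono (hL : IsTimeKernel L) {F G : ℝ → E → ℝ≥0∞} {t : ℝ} (h : ∀ s < t, F s ≤ G s)
    (x : E) : duhamelIntegral L Q F t x ≤ duhamelIntegral L Q G t x :=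
  mixture_mono (fun s hs => h _ (by linarith [hL.pos_of_ne_zero hs])) x

lemma picard_mono (h : IsSoninePair K L) (hp : 0 ≤ p) :
    Monotone fun n => picard K L Q p f n := by
  refine monotone_nat_of_le_succ fun n => ?_
  induction n with
  | zero => exact fun t x => bot_le
  | succ n ih =>
    intro t x
    exact add_le_add le_rfl (duhamel_mono h.right
      (fun s _ y => ENNReal.rpow_le_rpow (ih s y) hp) x)

variable [MeasurableAdd₂ E] [MeasurableNeg E] [∀ s, IsProbabilityMeasure (Q s)]

lemma measurable_duhamel (hL : Measurable L) (hQ : Measurable Q) {F : ℝ → E → ℝ≥0∞}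
    (hF : Measurable (Function.uncurry F)) : Measurable (Function.uncurry (duhamelIntegral L Q F)) :=
  measurable_mixture (β := ℝ) (a := fun _ => L) (F := fun t s => F (t - s)) hQ
    (hL.comp measurable_snd)
    (hF.comp (by fun_prop : Measurable fun q : ℝ × ℝ × E => (q.1 - q.2.1, q.2.2)))

lemma measurable_freeEvolution (hK : Measurable K) (hL : Measurable L) (hQ : Measurable Q)
    (hf : Measurable f) : Measurable (Function.uncurry (freeEvolution K L Q f)) :=
  measurable_mixture (β := ℝ) (a := fun t s => K (t - s) * L s) (F := fun _ _ => f) hQ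
    (by fun_prop) (by fun_prop)

lemma measurable_picard (hK : Measurable K) (hL : Measurable L) (hQ : Measurable Q)
    (hf : Measurable f) (n : ℕ) : Measurable (Function.uncurry (picard K L Q p f n)) := by
  induction n with
  | zero => exact measurable_const
  | succ n ih =>
    exact (measurable_freeEvolution hK hL hQ hf).add
      (measurable_duhamel hL hQ (F := fun s y => picard K L Q p f n s y ^ p) (ih.pow_const p))

lemma measurable_picardLimit (hK : Measurable K) (hL : Measurable L) (hQ : Measurable Q)
    (hf : Measurable f) : Measurable (Function.uncurry (picardLimit K L Q p f)) :=
  Measurable.iSup fun n => measurable_picard hK hL hQ hf n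

/-- The limit solves the Duhamel formula. -/
lemma picardLimit_eq (h : IsSoninePair K L) (hQ : Measurable Q) (hf : Measurable f) (hp : 0 < p)
    (t : ℝ) (x : E) : picardLimit K L Q p f t x = freeEvolution K L Q f t x +
      duhamelIntegral L Q (fun s y => picardLimit K L Q p f s y ^ p) t x := by
  have hmono := picard_mono (Q := Q) (f := f) h hp.le
  have hm : ∀ n, Measurable (Function.uncurry fun s y => picard K L Q p f n s y ^ p) := fun n =>
    (measurable_picard h.left.measurable h.right.measurable hQ hf n).pow_const p
  have hm' : ∀ n, Measurable (Function.uncurry fun s y => picard K L Q p f n (t - s) y ^ p) :=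
    fun n => (hm n).comp (by fun_prop : Measurable fun q : ℝ × E => (t - q.1, q.2))
  -- Monotone convergence is applied in both integrals; the power `p > 0`, an order isomorphism of
  -- `[0, ∞]`, commutes with suprema.
  have h1 : duhamelIntegral L Q (fun s y => picardLimit K L Q p f s y ^ p) t x =
      ⨆ n, duhamelIntegral L Q (fun s y => picard K L Q p f n s y ^ p) t x := by
    simp only [duhamelIntegral, mixture]
    rw [← lintegral_iSup (fun n => measurable_mul_measureConv hQ h.right.measurable (hm' n) x)]
    · refine lintegral_congr fun s => ?_
      rw [← ENNReal.mul_iSup]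
      congr 1
      simp only [measureConv]
      rw [← lintegral_iSup (fun n => ?_)]
      · refine lintegral_congr fun y => ?_
        exact (ENNReal.orderIsoRpow p hp).map_iSup _
      · intro n m hnm y
        exact ENNReal.rpow_le_rpow (hmono hnm _ _) hp.le
      · exact (hm' n).comp (by fun_prop : Measurable fun y : E => (s, x - y))
    · intro n m hnm s
      exact mul_le_mul_right (measureConv_mono _ (fun y =>
        ENNReal.rpow_le_rpow (hmono hnm _ _) hp.le) x) _
  rw [h1, ENNReal.add_iSup, picardLimit]
  refine le_antisymm (iSup_le fun n => ?_) (iSup_le fun n => ?_)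
  · refine (hmono (Nat.le_succ n) t x).trans (le_iSup_of_le n le_rfl)
  · exact le_iSup_of_le (n + 1) le_rfl

/-- The Lipschitz estimate for the nonlinear Duhamel integral at two different times. -/
lemma duhamel_rpow_sub_le (hL : IsTimeKernel L) (hQ : Measurable Q) (hp : 1 ≤ p)
    {V W : ℝ → E → ℝ≥0∞} (hW : Measurable (Function.uncurry W)) {M : ℝ≥0} {a : ℝ}
    (hVM : ∀ s < a, ∀ x, V s x ≤ M) (b : ℝ) (x : E) :
    duhamelIntegral L Q (fun s y => V s y ^ p) a x - duhamelIntegral L Q (fun s y => W s y ^ p) b x ≤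
      mixture volume Q L (fun s y => powLip p M * (V (a - s) y - W (b - s) y)) x := by
  have hW' : Measurable fun q : ℝ × E => W (b - q.1) q.2 :=
    hW.comp (by fun_prop : Measurable fun q : ℝ × E => (b - q.1, q.2))
  have hWp : Measurable (Function.uncurry fun s y => W (b - s) y ^ p) := hW'.pow_const p
  refine (mixture_sub_le hQ hL.measurable hWp x).trans (mixture_mono (fun s hs y => ?_) x)
  exact ENNReal.rpow_sub_rpow_le hp (hVM _ (by linarith [hL.pos_of_ne_zero hs]) y)

variable [SFinite (volume : Measure E)] [(volume : Measure E).IsAddRightInvariant]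

lemma IsBoundX.freeEvolution (h : IsSoninePair K L) (hQ : Measurable Q) (hf : Measurable f)
    {A : ℝ≥0∞} (hA : IsBoundX f A) (t : ℝ) : IsBoundX (freeEvolution K L Q f t) A := by
  have hKm := h.left.measurable
  have hLm := h.right.measurable
  refine (IsBoundX.mixture (ν := volume) (a := fun s => K (t - s) * L s) (F := fun _ => f)
    (c := fun _ => A) hQ (by fun_prop) (by fun_prop) fun _ _ => hA).mono le_rfl ?_
  rw [lintegral_mul_const _ (by fun_prop), ← lconv_eq_lintegral_sub, h.lconv_eq]
  exact mul_le_of_le_one_left' (indicator_le_self' (fun _ _ => bot_le) t)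

/-- The estimate behind all that follows: `W = 0` bounds the Duhamel term, `a = b` gives the
contraction, and `a ≠ b` the modulus of continuity in time. -/
lemma isBoundX_duhamel_rpow_sub (hL : IsTimeKernel L) (hQ : Measurable Q) (hp : 1 ≤ p)
    {V W : ℝ → E → ℝ≥0∞} (hV : Measurable (Function.uncurry V))
    (hW : Measurable (Function.uncurry W)) {M : ℝ≥0} {a b : ℝ}
    (hVM : ∀ s < a, ∀ x, V s x ≤ M) {c : ℝ → ℝ≥0∞} (hcm : Measurable c)
    (hc : ∀ s, 0 < s → IsBoundX (V (a - s) - W (b - s)) (c s)) :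
    IsBoundX (duhamelIntegral L Q (fun s y => V s y ^ p) a - duhamelIntegral L Q (fun s y => W s y ^ p) b)
      (powLip p M * ∫⁻ s, L s * c s) := by
  have hV' : Measurable fun q : ℝ × E => V (a - q.1) q.2 :=
    hV.comp (by fun_prop : Measurable fun q : ℝ × E => (a - q.1, q.2))
  have hW' : Measurable fun q : ℝ × E => W (b - q.1) q.2 :=
    hW.comp (by fun_prop : Measurable fun q : ℝ × E => (b - q.1, q.2))
  have hLm := hL.measurable
  have h1 := IsBoundX.mixture (ν := volume) (Q := Q) (a := L)
    (F := fun s y => powLip p M * (V (a - s) y - W (b - s) y)) (c := fun s => powLip p M * c s) hQ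
    hLm ((hV'.sub hW').const_mul _) fun s hs =>
      (hc s (hL.pos_of_ne_zero hs)).const_mul 
        ((hV'.sub hW').comp (by fun_prop : Measurable fun y : E => (s, y))) _
  refine h1.mono (duhamel_rpow_sub_le hL hQ hp hW hVM b) (le_of_eq ?_)
  rw [← lintegral_const_mul _ (by fun_prop)]
  exact lintegral_congr fun s => by ring

end picard

/-! ### Bounds for the iterates -/

section bounds

variable {E : Type*} [MeasureSpace E] [AddCommGroup E] {K L : ℝ → ℝ≥0∞} {Q : ℝ → Measure E} {p : ℝ}
  {f : E → ℝ≥0∞} [MeasurableAdd₂ E] [MeasurableNeg E] [∀ s, IsProbabilityMeasure (Q s)]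
  [SFinite (volume : Measure E)] [(volume : Measure E).IsAddRightInvariant]

lemma IsTimeKernel.lintegral_mul_indicator (hL : IsTimeKernel L) (T : ℝ) (c : ℝ≥0∞) :
    ∫⁻ s, L s * (Iio T).indicator (fun _ => c) s = c * ∫⁻ s in Iio T, L s := by
  rw [← lintegral_const_mul _ hL.measurable, ← lintegral_indicator measurableSet_Iio]
  refine lintegral_congr fun s => ?_
  by_cases hs : s ∈ Iio T <;> simp [hs, mul_comm]

/-- The bound of the Duhamel integral in terms of a bound of the data. -/
lemma isBoundX_duhamel_rpow (hL : IsTimeKernel L) (hQ : Measurable Q) (hp : 1 ≤ p)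
    {V : ℝ → E → ℝ≥0∞} (hV : Measurable (Function.uncurry V)) (hV0 : ∀ t ≤ 0, V t = 0) {M : ℝ≥0}
    {t : ℝ} (hVM : ∀ s < t, IsBoundX (V s) M) :
    IsBoundX (duhamelIntegral L Q (fun s y => V s y ^ p) t) (powLip p M * M * ∫⁻ s in Iio t, L s) := by
  have hpos : 0 < p := by linarith
  have h1 := isBoundX_duhamel_rpow_sub hL hQ hp hV (W := 0) measurable_const (M := M)
    (a := t) (b := t) (fun s hs => (hVM s hs).1) (c := (Iio t).indicator fun _ => (M : ℝ≥0∞))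
    (measurable_const.indicator measurableSet_Iio) fun s hs => by
      rw [Pi.zero_apply, tsub_zero]
      by_cases hst : s < t
      · simpa [hst] using hVM (t - s) (by linarith)
      · rw [hV0 _ (by linarith)]
        exact isBoundX_zero _
  rw [hL.lintegral_mul_indicator, ← mul_assoc] at h1
  refine h1.mono (fun x => ?_) le_rfl
  have h0 : duhamelIntegral L Q (fun s y => (0 : ℝ → E → ℝ≥0∞) s y ^ p) t x = 0 := by
    simp [duhamelIntegral, mixture, measureConv, hpos]
  rw [Pi.sub_apply, h0, tsub_zero]

variable {A : ℝ≥0} {T : ℝ}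

/-- If an iterate is bounded by `2 A`, the next Duhamel term is at most half of that by the choice
of `T`, and the free evolution contributes at most `A`. -/
lemma isBoundX_picard (h : IsSoninePair K L) (hQ : Measurable Q) (hp : 1 ≤ p) (hf : Measurable f)
    (hA : IsBoundX f A) (hT : powLip p (2 * A) * ∫⁻ s in Iio T, L s ≤ 2⁻¹) (n : ℕ) :
    ∀ t < T, IsBoundX (picard K L Q p f n t) (2 * A : ℝ≥0) := by
  have hpos : 0 < p := by linarith
  induction n with
  | zero => exact fun t _ => isBoundX_zero _
  | succ n ih =>
    intro t ht
    have hz := IsBoundX.freeEvolution h hQ hf hA t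
    have hd := isBoundX_duhamel_rpow h.right hQ hp
      (measurable_picard h.left.measurable h.right.measurable hQ hf n)
      (picard_of_nonpos h hpos n) (M := 2 * A) (t := t) fun s hs => ih s (hs.trans ht)
    refine (hz.add hd (measurable_freeEvolution h.left.measurable h.right.measurable hQ
      hf).of_uncurry_left).mono le_rfl ?_
    calc (A : ℝ≥0∞) + powLip p (2 * A) * (2 * A : ℝ≥0) * ∫⁻ s in Iio t, L s
        ≤ A + (2 * A : ℝ≥0) * (powLip p (2 * A) * ∫⁻ s in Iio T, L s) := by
          rw [mul_right_comm, mul_comm _ ((2 * A : ℝ≥0) : ℝ≥0∞)]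
          gcongr
      _ ≤ A + (2 * A : ℝ≥0) * 2⁻¹ := by gcongr
      _ = (2 * A : ℝ≥0) := by
          push_cast
          rw [mul_right_comm, ENNReal.mul_inv_cancel (by simp) (by simp), one_mul, two_mul]

lemma isBoundX_picardLimit (h : IsSoninePair K L) (hQ : Measurable Q) (hp : 1 ≤ p)
    (hf : Measurable f) (hA : IsBoundX f A)
    (hT : powLip p (2 * A) * ∫⁻ s in Iio T, L s ≤ 2⁻¹) {t : ℝ} (ht : t < T) :
    IsBoundX (picardLimit K L Q p f t) (2 * A : ℝ≥0) := by
  have hb := fun n => isBoundX_picard h hQ hp hf hA hT n t ht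
  refine ⟨fun x => iSup_le fun n => (hb n).1 x, ?_⟩
  simp only [picardLimit]
  rw [lintegral_iSup (fun n => (measurable_picard h.left.measurable h.right.measurable hQ hf
    n).of_uncurry_left) fun n m hnm => picard_mono h (by linarith) hnm t]
  exact iSup_le fun n => (hb n).2

lemma picardLimit_of_nonpos (h : IsSoninePair K L) (hp : 0 < p) {t : ℝ} (ht : t ≤ 0) :
    picardLimit K L Q p f t = 0 := by
  ext x
  simp [picardLimit, picard_of_nonpos h hp _ t ht]

/-- The iterates converge geometrically. -/
lemma isBoundX_picardLimit_sub (h : IsSoninePair K L) (hQ : Measurable Q) (hp : 1 ≤ p)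
    (hf : Measurable f) (hA : IsBoundX f A)
    (hT : powLip p (2 * A) * ∫⁻ s in Iio T, L s ≤ 2⁻¹) (n : ℕ) : ∀ t < T,
    IsBoundX (picardLimit K L Q p f t - picard K L Q p f n t) ((2 * A : ℝ≥0) * 2⁻¹ ^ n) := by
  have hpos : 0 < p := by linarith
  have hLm := h.right.measurable
  have hKm := h.left.measurable
  induction n with
  | zero =>
    intro t ht
    exact (isBoundX_picardLimit h hQ hp hf hA hT ht).mono (fun x => tsub_le_self) (by simp)
  | succ n ih =>
    intro t ht
    -- The free evolutions cancel, and each application of the Duhamel integral gains the factor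
    -- `1/2`.
    have h1 := isBoundX_duhamel_rpow_sub h.right hQ hp
      (measurable_picardLimit (p := p) hKm hLm hQ hf) (measurable_picard (p := p) hKm hLm hQ hf n)
      (M := 2 * A) (a := t) (b := t)
      (fun s hs => (isBoundX_picardLimit h hQ hp hf hA hT (hs.trans ht)).1)
      (c := (Iio t).indicator fun _ => (2 * A : ℝ≥0) * 2⁻¹ ^ n)
      (measurable_const.indicator measurableSet_Iio) fun s hs => by
        by_cases hst : s < t
        · simpa [hst] using ih (t - s) (by linarith)
        · rw [picardLimit_of_nonpos h hpos (by linarith)]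
          exact (isBoundX_zero _).mono (fun x => by simp) le_rfl
    rw [h.right.lintegral_mul_indicator] at h1
    refine h1.mono (fun x => ?_) ?_
    · simp only [Pi.sub_apply, picard, Pi.add_apply]
      rw [picardLimit_eq h hQ hf hpos]
      exact add_tsub_add_le_tsub_left
    · calc (powLip p (2 * A) : ℝ≥0∞) * ((2 * A : ℝ≥0) * 2⁻¹ ^ n * ∫⁻ s in Iio t, L s)
          ≤ (2 * A : ℝ≥0) * 2⁻¹ ^ n * (powLip p (2 * A) * ∫⁻ s in Iio T, L s) := by
            rw [mul_left_comm]
            gcongr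
          _ ≤ (2 * A : ℝ≥0) * 2⁻¹ ^ (n + 1) :=
            (mul_le_mul_right hT _).trans_eq (by rw [pow_succ, mul_assoc])

end bounds

/-! ### Continuity in time -/

section modulus

variable {K L : ℝ → ℝ≥0∞}

/-- The total variation of `K(a - ·) L - K(b - ·) L`. -/
noncomputable def kernelVariation (K L : ℝ → ℝ≥0∞) (a b : ℝ) : ℝ≥0∞ :=
  ∫⁻ s, (K (a - s) * L s - K (b - s) * L s) + (K (b - s) * L s - K (a - s) * L s)

lemma kernelVariation_comm (a b : ℝ) : kernelVariation K L a b = kernelVariation K L b a :=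
  lintegral_congr fun _ => add_comm _ _

lemma measurable_kernelVariation (hK : Measurable K) (hL : Measurable L) :
    Measurable (Function.uncurry (kernelVariation K L)) :=
  Measurable.lintegral_prod_right' (f := fun q : (ℝ × ℝ) × ℝ =>
    (K (q.1.1 - q.2) * L q.2 - K (q.1.2 - q.2) * L q.2) +
      (K (q.1.2 - q.2) * L q.2 - K (q.1.1 - q.2) * L q.2)) (by fun_prop)

/-- Scheffé's lemma for the kernels `K(t - ·) L`, whose integrals are all equal to `1`. -/
lemma IsSoninePair.tendsto_kernelVariation (h : IsSoninePair K L) {t : ℝ} (ht : 0 < t) :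
    Tendsto (kernelVariation K L t) (𝓝 t) (𝓝 0) := by
  have hKm := h.left.measurable
  have hLm := h.right.measurable
  have hint : ∀ b, 0 < b → ∫⁻ s, K (b - s) * L s = 1 := fun b hb => by
    rw [← lconv_eq_lintegral_sub, h.lconv_eq, heaviside_of_pos hb]
  -- The difference taken in this order is dominated by `K (t - ·) L`, independently of `b`.
  have hI : Tendsto (fun b => ∫⁻ s, (K (t - s) * L s - K (b - s) * L s)) (𝓝 t) (𝓝 0) := by
    have h1 := tendsto_lintegral_filter_of_dominated_convergence (μ := volume) (l := 𝓝 t)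
      (F := fun b s => K (t - s) * L s - K (b - s) * L s) (f := fun _ => 0)
      (fun s => K (t - s) * L s) (Eventually.of_forall fun b => by fun_prop)
      (Eventually.of_forall fun b => Eventually.of_forall fun s => tsub_le_self)
      (by rw [hint t ht]; exact ENNReal.one_ne_top) (by
        filter_upwards [h.left.ae_tendsto_comp_sub t] with s hs
        have h2 : Tendsto (fun b => K (b - s) * L s) (𝓝 t) (𝓝 (K (t - s) * L s)) :=
          ENNReal.Tendsto.mul_const hs (Or.inr (h.right.ne_top s))
        have h3 := ENNReal.Tendsto.sub (tendsto_const_nhds (x := K (t - s) * L s)) h2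
          (Or.inl (ENNReal.mul_ne_top (h.left.ne_top _) (h.right.ne_top s)))
        simpa using h3)
    simpa using h1
  -- Both kernels have integral one, so the positive and negative parts of their difference have
  -- equal integrals.
  have heq : ∀ b, 0 < b → kernelVariation K L t b =
      2 * ∫⁻ s, (K (t - s) * L s - K (b - s) * L s) := fun b hb => by
    have h1 : ∀ s, K (b - s) * L s + (K (t - s) * L s - K (b - s) * L s) =
        K (t - s) * L s + (K (b - s) * L s - K (t - s) * L s) := fun s => by
      rw [add_tsub_eq_max, add_tsub_eq_max, max_comm]
    have h2 := lintegral_congr (μ := volume) h1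
    rw [lintegral_add_left (by fun_prop), lintegral_add_left (by fun_prop), hint b hb,
      hint t ht] at h2
    have h3 := (ENNReal.add_right_inj ENNReal.one_ne_top).1 h2
    rw [kernelVariation, lintegral_add_left (by fun_prop), ← h3, two_mul]
  have h4 : Tendsto (fun b => 2 * ∫⁻ s, (K (t - s) * L s - K (b - s) * L s)) (𝓝 t) (𝓝 0) := by
    simpa using ENNReal.Tendsto.const_mul hI (Or.inr ENNReal.ofNat_ne_top)
  refine h4.congr' ?_
  filter_upwards [lt_mem_nhds ht] with b hb
  exact (heq b hb).symm

end modulus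

section continuity

variable {E : Type*} [MeasureSpace E] [AddCommGroup E] {K L : ℝ → ℝ≥0∞} {Q : ℝ → Measure E} {p : ℝ}
  {f : E → ℝ≥0∞} {A : ℝ≥0} {T : ℝ}

lemma kernelVariation_of_nonpos (h : IsSoninePair K L) {a b : ℝ} (ha : a ≤ 0) (hb : b ≤ 0) :
    kernelVariation K L a b = 0 := by
  refine (lintegral_congr fun s => ?_).trans lintegral_zero
  rcases eq_or_ne (L s) 0 with hs | hs
  · simp [hs]
  · have := h.right.pos_of_ne_zero hs
    simp [h.left.causal (a - s) (by linarith), h.left.causal (b - s) (by linarith)]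

/-- Dominated convergence with majorant `M L` before `T`. For `s < t` the modulus is small at the
positive time `t - s`, for `s > t` both times are eventually negative, and `s = t` is a null set. -/
lemma IsTimeKernel.tendsto_lintegral_modulus (hL : IsTimeKernel L) {ω : ℝ → ℝ → ℝ≥0∞}
    (hm : Measurable (Function.uncurry ω)) {M : ℝ≥0} (hM : ∀ a b, ω a b ≤ M)
    (h0 : ∀ a ≤ 0, ∀ b ≤ 0, ω a b = 0)
    (hlim : ∀ t, 0 < t → t < T → Tendsto (ω t) (𝓝 t) (𝓝 0)) {t : ℝ} (htT : t < T) :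
    Tendsto (fun b => ∫⁻ s, L s * ω (t - s) (b - s)) (𝓝 t) (𝓝 0) := by
  have hLm := hL.measurable
  have h1 := tendsto_lintegral_filter_of_dominated_convergence (μ := volume) (l := 𝓝 t)
    (F := fun b s => L s * ω (t - s) (b - s)) (f := fun _ => 0)
    (fun s => L s * (Iio T).indicator (fun _ => (M : ℝ≥0∞)) s)
    (Eventually.of_forall fun b => hLm.mul
      (hm.comp (by fun_prop : Measurable fun s : ℝ => (t - s, b - s)))) (by
      filter_upwards [gt_mem_nhds htT] with b hb
      refine Eventually.of_forall fun s => ?_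
      by_cases hs : s < T
      · simpa [hs] using mul_le_mul_right (hM _ _) (L s)
      · rw [h0 _ (by linarith) _ (by linarith), mul_zero]
        exact bot_le)
    (by
      rw [hL.lintegral_mul_indicator]
      exact ENNReal.mul_ne_top ENNReal.coe_ne_top (hL.lintegral_lt_top T).ne) (by
      filter_upwards [Measure.ae_ne volume t] with s hs
      rcases eq_or_ne (L s) 0 with hs0 | hs0
      · simp [hs0]
      have hspos := hL.pos_of_ne_zero hs0
      rcases lt_or_gt_of_ne hs with hst | hst
      · have h2 : Tendsto (fun b => ω (t - s) (b - s)) (𝓝 t) (𝓝 0) :=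
          (hlim (t - s) (by linarith) (by linarith)).comp
            (Continuous.tendsto (by fun_prop : Continuous fun b : ℝ => b - s) t)
        simpa using ENNReal.Tendsto.const_mul h2 (Or.inr (hL.ne_top s))
      · refine tendsto_const_nhds.congr' ?_
        filter_upwards [gt_mem_nhds hst] with b hb
        rw [h0 _ (by linarith) _ (by linarith), mul_zero])
  simpa using h1

variable [MeasurableAdd₂ E] [MeasurableNeg E] [∀ s, IsProbabilityMeasure (Q s)]
  [SFinite (volume : Measure E)] [(volume : Measure E).IsAddRightInvariant]

lemma isBoundX_freeEvolution_sub (h : IsSoninePair K L) (hQ : Measurable Q) (hf : Measurable f)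
    (hA : IsBoundX f A) (a b : ℝ) : IsBoundX (freeEvolution K L Q f a - freeEvolution K L Q f b)
      (A * kernelVariation K L a b) := by
  have hKm := h.left.measurable
  have hLm := h.right.measurable
  have h1 := IsBoundX.mixture (ν := volume) (Q := Q)
    (a := (fun s => K (a - s) * L s) - fun s => K (b - s) * L s)
    (F := fun _ => f) (c := fun _ => A) hQ (by fun_prop) (by fun_prop) fun _ _ => hA
  refine h1.mono (fun x => mixture_weight_sub_le hQ (by fun_prop) (by fun_prop) x) ?_
  rw [lintegral_mul_const _ (by fun_prop), mul_comm]
  exact mul_le_mul_right (lintegral_mono fun s => le_self_add) _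

/-- The Picard iterates have a measurable modulus of continuity in time. -/
lemma exists_modulus (h : IsSoninePair K L) (hQ : Measurable Q) (hp : 1 ≤ p) (hf : Measurable f)
    (hA : IsBoundX f A) (hT : powLip p (2 * A) * ∫⁻ s in Iio T, L s ≤ 2⁻¹) (n : ℕ) :
    ∃ ω : ℝ → ℝ → ℝ≥0∞, Measurable (Function.uncurry ω) ∧ (∀ a b, ω a b = ω b a) ∧
      (∀ a b, ω a b ≤ (2 * A : ℝ≥0)) ∧ (∀ a ≤ 0, ∀ b ≤ 0, ω a b = 0) ∧
      (∀ a < T, ∀ b < T, IsBoundX (picard K L Q p f n a - picard K L Q p f n b) (ω a b)) ∧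
      ∀ t, 0 < t → t < T → Tendsto (ω t) (𝓝 t) (𝓝 0) := by
  have hKm := h.left.measurable
  have hLm := h.right.measurable
  induction n with
  | zero =>
    refine ⟨fun _ _ => 0, measurable_const, fun _ _ => rfl, fun _ _ => bot_le, fun _ _ _ _ => rfl,
      fun a _ b _ => ?_, fun _ _ _ => tendsto_const_nhds⟩
    exact (isBoundX_zero _).mono (fun x => by simp [picard]) le_rfl
  | succ n ih =>
    obtain ⟨ω, hm, hsymm, hle, h0, hb, hlim⟩ := ih
    -- The free evolution varies with the total variation of its weights, the Duhamel term with the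
    -- average of the previous modulus against `L`. The minimum with the uniform bound `2 A` keeps
    -- the modulus bounded for the next dominated convergence.
    refine ⟨fun a b => min (2 * A : ℝ≥0) (A * kernelVariation K L a b +
      powLip p (2 * A) * ∫⁻ s, L s * ω (a - s) (b - s)), ?_, fun a b => ?_, fun a b => min_le_left _ _,
      fun a ha b hb => ?_, fun a ha b hbT => ?_, fun t ht htT => ?_⟩
    · have h1 : Measurable fun q : ℝ × ℝ => ∫⁻ s, L s * ω (q.1 - s) (q.2 - s) :=
        Measurable.lintegral_prod_right' (f := fun q : (ℝ × ℝ) × ℝ =>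
          L q.2 * ω (q.1.1 - q.2) (q.1.2 - q.2)) ((hLm.comp measurable_snd).mul
          (hm.comp (by fun_prop : Measurable fun q : (ℝ × ℝ) × ℝ => (q.1.1 - q.2, q.1.2 - q.2))))
      exact measurable_const.min (((measurable_kernelVariation hKm hLm).const_mul _).add
        (h1.const_mul _))
    · simp only [kernelVariation_comm a b, hsymm (a - _) (b - _)]
    · have h1 : ∀ s, L s * ω (a - s) (b - s) = 0 := fun s => by
        rcases eq_or_ne (L s) 0 with hs | hs
        · simp [hs]
        · have := h.right.pos_of_ne_zero hs
          rw [h0 _ (by linarith) _ (by linarith), mul_zero]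
      simp [h1, kernelVariation_of_nonpos h ha hb]
    · have hM := isBoundX_picard h hQ hp hf hA hT
      have hz := isBoundX_freeEvolution_sub h hQ hf hA a b
      have hd := isBoundX_duhamel_rpow_sub h.right hQ hp (measurable_picard hKm hLm hQ hf n)
        (measurable_picard (p := p) hKm hLm hQ hf n) (M := 2 * A) (a := a) (b := b)
        (fun s hs => (hM n s (hs.trans ha)).1) (c := fun s => ω (a - s) (b - s))
        (hm.comp (by fun_prop : Measurable fun s : ℝ => (a - s, b - s)))
        fun s hs => hb _ (by linarith) _ (by linarith)
      have hzm := measurable_freeEvolution (f := f) hKm hLm hQ hf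
      have hs := (hz.add hd (hzm.of_uncurry_left.sub hzm.of_uncurry_left)).mono
        (g := picard K L Q p f (n + 1) a - picard K L Q p f (n + 1) b)
        (fun x => add_tsub_add_le_tsub_add_tsub) le_rfl
      have h2 := hM (n + 1) a ha
      exact ⟨fun x => le_min (tsub_le_self.trans (h2.1 x)) (hs.1 x),
        le_min ((lintegral_mono fun x => tsub_le_self).trans h2.2) hs.2⟩
    · have h1 : Tendsto (fun b => A * kernelVariation K L t b) (𝓝 t) (𝓝 (A * 0)) :=
        ENNReal.Tendsto.const_mul (h.tendsto_kernelVariation ht) (Or.inr ENNReal.coe_ne_top)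
      have h2 : Tendsto (fun b => powLip p (2 * A) * ∫⁻ s, L s * ω (t - s) (b - s)) (𝓝 t)
          (𝓝 (powLip p (2 * A) * 0)) :=
        ENNReal.Tendsto.const_mul (h.right.tendsto_lintegral_modulus hm hle h0 hlim htT)
          (Or.inr ENNReal.coe_ne_top)
      have h3 := h1.add h2
      rw [mul_zero, mul_zero, add_zero] at h3
      exact tendsto_of_tendsto_of_tendsto_of_le_of_le tendsto_const_nhds h3 (fun _ => bot_le)
        fun b => min_le_right _ _

/-- The limit of the iterates is continuous in time. -/
lemma exists_modulus_picardLimit (h : IsSoninePair K L) (hQ : Measurable Q) (hp : 1 ≤ p)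
    (hf : Measurable f) (hA : IsBoundX f A)
    (hT : powLip p (2 * A) * ∫⁻ s in Iio T, L s ≤ 2⁻¹) {t : ℝ} (ht : 0 < t) (htT : t < T) :
    ∃ ω : ℝ → ℝ≥0∞, Tendsto ω (𝓝 t) (𝓝 0) ∧ ∀ b < T,
      IsBoundX (picardLimit K L Q p f t - picardLimit K L Q p f b) (ω b) ∧
      IsBoundX (picardLimit K L Q p f b - picardLimit K L Q p f t) (ω b) := by
  have hKm := h.left.measurable
  have hLm := h.right.measurable
  choose ω hm hsymm hle h0 hb hlim using exists_modulus h hQ hp hf hA hT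
  have hpow : Tendsto (fun n : ℕ => ((2 * A : ℝ≥0) : ℝ≥0∞) * 2⁻¹ ^ n) atTop (𝓝 0) := by
    simpa using ENNReal.Tendsto.const_mul
      (ENNReal.tendsto_pow_atTop_nhds_zero_of_lt_one (r := 2⁻¹) (by simp))
      (Or.inr (ENNReal.coe_ne_top (r := 2 * A)))
  have key : ∀ a < T, ∀ b < T, ∀ n, IsBoundX (picardLimit K L Q p f a - picardLimit K L Q p f b)
      ((2 * A : ℝ≥0) * 2⁻¹ ^ n + ω n a b) := by
    intro a ha b hbT n
    have hUm := (measurable_picardLimit (p := p) hKm hLm hQ hf).of_uncurry_left (x := a)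
    have hPm := (measurable_picard (p := p) hKm hLm hQ hf n).of_uncurry_left (x := a)
    refine ((isBoundX_picardLimit_sub h hQ hp hf hA hT n a ha).add (hb n a ha b hbT)
      (hUm.sub hPm)).mono (fun x => ?_) le_rfl
    refine (tsub_le_tsub_add_tsub (b := picard K L Q p f n a x)).trans (add_le_add le_rfl ?_)
    -- The iterates lie below their limit, so the one-sided difference needs an approximation error
    -- at time `a` only.
    exact tsub_le_tsub_left (le_iSup (fun n => picard K L Q p f n b x) n) _
  -- Each `n` gives a valid bound. Fixing `n` for the geometric error and then letting `b → t` shows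
  -- that the infimum tends to zero.
  refine ⟨fun b => ⨅ n, ((2 * A : ℝ≥0) * 2⁻¹ ^ n + ω n t b), ?_, fun b hbT => ⟨?_, ?_⟩⟩
  · rw [ENNReal.tendsto_nhds_zero]
    intro ε hε
    have hε2 : 0 < ε / 2 := ENNReal.half_pos hε.ne'
    obtain ⟨n, hn⟩ := (hpow.eventually_le_const hε2).exists
    filter_upwards [(hlim n t ht htT).eventually_le_const hε2] with b hb'
    exact (iInf_le _ n).trans ((add_le_add hn hb').trans_eq (ENNReal.add_halves ε))
  · exact ⟨fun x => le_iInf fun n => (key t htT b hbT n).1 x,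
      le_iInf fun n => (key t htT b hbT n).2⟩
  · have key' : ∀ n, IsBoundX (picardLimit K L Q p f b - picardLimit K L Q p f t)
        ((2 * A : ℝ≥0) * 2⁻¹ ^ n + ω n t b) := fun n => by
      rw [hsymm]
      exact key b hbT t htT n
    exact ⟨fun x => le_iInf fun n => (key' n).1 x, le_iInf fun n => (key' n).2⟩

end continuity

/-! ### Norms of differences -/

section norms

variable {E : Type*} [MeasureSpace E]

lemma enorm_toReal_sub_toReal {x y : ℝ≥0∞} (hx : x ≠ ∞) (hy : y ≠ ∞) :
    ‖x.toReal - y.toReal‖ₑ = (x - y) + (y - x) := by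
  wlog hxy : x ≤ y generalizing x y
  · rw [← enorm_neg, neg_sub, add_comm]
    exact this hy hx (not_le.1 hxy).le
  rw [tsub_eq_zero_of_le hxy, zero_add, ← enorm_neg, neg_sub, ← ENNReal.toReal_sub_of_le hxy hy,
    Real.enorm_of_nonneg ENNReal.toReal_nonneg, ENNReal.ofReal_toReal]
  exact (tsub_le_self.trans_lt hy.lt_top).ne

lemma eLpNorm_toReal_sub_le {f g : E → ℝ≥0∞} (hf : Measurable f) (hg : Measurable g)
    (hf' : ∀ x, f x ≠ ∞) (hg' : ∀ x, g x ≠ ∞) {c d : ℝ≥0∞} (h₁ : IsBoundX (f - g) c)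
    (h₂ : IsBoundX (g - f) d) :
    eLpNorm (fun x => (f x).toReal - (g x).toReal) 1 volume ≤ c + d ∧
      eLpNorm (fun x => (f x).toReal - (g x).toReal) ⊤ volume ≤ c + d := by
  constructor
  · have hfg : Measurable fun x => f x - g x := hf.sub hg
    rw [eLpNorm_one_eq_lintegral_enorm, lintegral_congr fun x => enorm_toReal_sub_toReal (hf' x)
      (hg' x), lintegral_add_left hfg]
    exact add_le_add h₁.2 h₂.2
  · rw [eLpNorm_exponent_top]
    refine eLpNormEssSup_le_of_ae_enorm_bound (Eventually.of_forall fun x => ?_)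
    rw [enorm_toReal_sub_toReal (hf' x) (hg' x)]
    exact add_le_add (h₁.1 x) (h₂.1 x)

end norms

/-! ### Representation of mild solutions by nonnegative measurable functions -/

section bridge

variable {N : ℕ} {K L : ℝ → ℝ≥0∞} {Q : ℝ → Measure (EuclideanSpace ℝ (Fin N))}

/-- Changing `f` on a null set changes its convolution with `μ` on a null set only, so measurable
representatives may be used even if `μ` has an atom. -/
lemma spaceConv_ae_eq (μ : Measure (EuclideanSpace ℝ (Fin N))) [IsProbabilityMeasure μ]
    {f : EuclideanSpace ℝ (Fin N) → ℝ} {g : EuclideanSpace ℝ (Fin N) → ℝ≥0∞}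
    (hfg : ∀ᵐ y, f y = (g y).toReal) (hg : Measurable g) (hg' : ∀ y, g y ≠ ∞) :
    ∀ᵐ x, spaceConv μ f x = (measureConv μ g x).toReal := by
  have h1 := ae_ae_ae_sub (α := Unit) (ν := Measure.dirac ()) (Q := fun _ => μ) measurable_const
    (P := fun _ y => f y = (g y).toReal)
    (Measure.quasiMeasurePreserving_snd.ae hfg)
  filter_upwards [h1] with x hx
  rw [ae_dirac_eq, eventually_pure] at hx
  rw [spaceConv, measureConv, integral_congr_ae hx, integral_toReal]
  · exact (hg.comp (measurable_const.sub measurable_id)).aemeasurable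
  · exact Eventually.of_forall fun y => (hg' _).lt_top

variable [∀ s, IsProbabilityMeasure (Q s)]

lemma spaceConv_fundamentalZ_ae_eq (h : IsSoninePair K L) (hQ : Measurable Q)
    {f : EuclideanSpace ℝ (Fin N) → ℝ} {g : EuclideanSpace ℝ (Fin N) → ℝ≥0∞}
    (hfg : ∀ᵐ y, f y = (g y).toReal) (hg : Measurable g) (hg' : ∀ y, g y ≠ ∞) {t : ℝ}
    [IsProbabilityMeasure (fundamentalZ K L Q t)] :
    ∀ᵐ x, spaceConv (fundamentalZ K L Q t) f x = (freeEvolution K L Q g t x).toReal := by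
  filter_upwards [spaceConv_ae_eq (fundamentalZ K L Q t) hfg hg hg'] with x hx
  have hgx : Measurable fun y => g (x - y) := hg.comp (measurable_const.sub measurable_id)
  rw [hx, measureConv, lintegral_fundamentalZ h.left.measurable h.right.measurable hQ t hgx]
  rfl

lemma integral_spaceConv_fundamentalY_ae_eq (hL : IsTimeKernel L) (hQ : Measurable Q)
    {f : ℝ → EuclideanSpace ℝ (Fin N) → ℝ} {F : ℝ → EuclideanSpace ℝ (Fin N) → ℝ≥0∞}
    (hF : Measurable (Function.uncurry F)) (hF0 : ∀ s ≤ 0, F s = 0) {M : ℝ≥0}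
    (hFM : ∀ s x, F s x ≤ M) {t : ℝ} (ht : 0 ≤ t)
    (hfF : ∀ᵐ q ∂(volume.restrict (Ioc 0 t)).prod volume, f q.1 q.2 = (F q.1 q.2).toReal) :
    ∀ᵐ x, ∫ τ in (0 : ℝ)..t, spaceConv (fundamentalY L Q (t - τ)) (f τ) x =
      (duhamelIntegral L Q F t x).toReal := by
  have hQ' : Measurable fun τ => Q (t - τ) := hQ.comp (measurable_const.sub measurable_id)
  have hLm := hL.measurable
  filter_upwards [ae_ae_ae_sub (Q := fun τ => Q (t - τ))
    (P := fun s y => f s y = (F s y).toReal) hQ' hfF] with x hx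
  have hm := measurable_measureConv_left hQ' hF x
  have hfin : ∀ τ, measureConv (Q (t - τ)) (F τ) x < ∞ := fun τ =>
    (measureConv_le (t - τ) (hFM τ) x).trans_lt ENNReal.coe_lt_top
  have h1 : ∫ τ in Ioc 0 t, spaceConv (fundamentalY L Q (t - τ)) (f τ) x =
      ∫ τ in Ioc 0 t, (L (t - τ) * measureConv (Q (t - τ)) (F τ) x).toReal := by
    refine integral_congr_ae ?_
    filter_upwards [hx] with τ hτ
    rw [spaceConv, fundamentalY, integral_smul_measure, integral_congr_ae hτ, integral_toReal,
      ENNReal.toReal_mul, smul_eq_mul]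
    · rfl
    · exact (hF.comp (by fun_prop : Measurable fun y => (τ, x - y))).aemeasurable
    · exact Eventually.of_forall fun y => (hFM _ _).trans_lt ENNReal.coe_lt_top
  rw [intervalIntegral.integral_of_le ht, h1, integral_toReal (by fun_prop)
    (Eventually.of_forall fun τ => ENNReal.mul_lt_top (hL.ne_top _).lt_top (hfin τ))]
  congr 1
  rw [← lintegral_indicator measurableSet_Ioc]
  -- The substitution `s = t - τ` passes to the reversed form of the Duhamel integral; outside `(0,
  -- t]` the integrand vanishes because `L` is causal and `F` is zero for nonpositive times.
  refine Eq.trans ?_ (lintegral_sub_left_eq_self (μ := volume)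
    (fun s => L s * measureConv (Q s) (F (t - s)) x) t)
  refine lintegral_congr fun τ => ?_
  simp only [sub_sub_cancel]
  by_cases hτ : τ ∈ Ioc 0 t
  · rw [indicator_of_mem hτ]
  · rw [indicator_of_notMem hτ]
    rcases le_or_gt τ 0 with h0 | h0
    · simp [measureConv, hF0 τ h0]
    · have : t < τ := by
        by_contra hcon
        exact hτ ⟨h0, not_lt.1 hcon⟩
      simp [hL.causal (t - τ) (by linarith)]

end bridge

/-! ### Bounded measurable representatives of data and solutions. -/

section representation

variable {N : ℕ}

lemma MemX.exists_rep {w : EuclideanSpace ℝ (Fin N) → ℝ} (hw : MemX w) (hw0 : ∀ᵐ x, 0 ≤ w x) :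
    ∃ (f : EuclideanSpace ℝ (Fin N) → ℝ≥0∞) (A : ℝ≥0), Measurable f ∧ IsBoundX f A ∧
      ∀ᵐ x, w x = (f x).toReal := by
  set w' := hw.1.aestronglyMeasurable.mk w with hw'
  have hm : Measurable w' := hw.1.aestronglyMeasurable.stronglyMeasurable_mk.measurable
  have hae : w =ᵐ[volume] w' := hw.1.aestronglyMeasurable.ae_eq_mk
  set A : ℝ≥0 := (normX w).toNNReal with hA
  have hfin : normX w ≠ ∞ := ENNReal.add_ne_top.2 ⟨hw.1.eLpNorm_ne_top, hw.2.eLpNorm_ne_top⟩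
  have hAe : (A : ℝ≥0∞) = normX w := ENNReal.coe_toNNReal hfin
  -- Cutting off at the norm alters a null set and turns an almost everywhere bound into a pointwise
  -- one.
  refine ⟨fun x => min (ENNReal.ofReal (w' x)) A, A, by fun_prop, ⟨fun x => min_le_right _ _, ?_⟩, ?_⟩
  · calc ∫⁻ x, min (ENNReal.ofReal (w' x)) A ≤ ∫⁻ x, ‖w' x‖ₑ :=
          lintegral_mono fun x => (min_le_left _ _).trans (Real.ofReal_le_enorm _)
      _ = eLpNorm w 1 volume := by
          rw [← eLpNorm_one_eq_lintegral_enorm, eLpNorm_congr_ae hae]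
      _ ≤ A := by rw [hAe]; exact le_self_add
  · have h1 := enorm_ae_le_eLpNormEssSup w volume
    filter_upwards [hae, hw0, h1] with x hx h0 hle
    rw [← eLpNorm_exponent_top, Real.enorm_of_nonneg h0] at hle
    have h2 : ENNReal.ofReal (w x) ≤ A := hle.trans (by rw [hAe]; exact le_add_self)
    rw [← hx, min_eq_left h2, ENNReal.toReal_ofReal h0]

lemma mem_timeInterval_of_le {T : EReal} {s t : ℝ} (ht : t ∈ timeInterval T) (hs : 0 < s)
    (hst : s ≤ t) : s ∈ timeInterval T :=
  ⟨hs, (EReal.coe_le_coe_iff.2 hst).trans_lt ht.2⟩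

lemma normX_le_add {f g : EuclideanSpace ℝ (Fin N) → ℝ} (hf : MemX f) (hg : MemX g) :
    normX f ≤ normX (f - g) + normX g := by
  have h1 : f = (f - g) + g := (sub_add_cancel f g).symm
  have h2 : ∀ q : ℝ≥0∞, 1 ≤ q →
      eLpNorm f q volume ≤ eLpNorm (f - g) q volume + eLpNorm g q volume := fun q hq => by
    conv_lhs => rw [h1]
    exact eLpNorm_add_le (hf.1.aestronglyMeasurable.sub hg.1.aestronglyMeasurable)
      hg.1.aestronglyMeasurable hq
  exact (add_le_add (h2 1 le_rfl) (h2 ⊤ le_top)).trans_eq (add_add_add_comm _ _ _ _)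

namespace IsMildSolution

variable {Z Y : ℝ → Measure (EuclideanSpace ℝ (Fin N))} {p : ℝ}
  {u₀ : EuclideanSpace ℝ (Fin N) → ℝ} {T : EReal} {u : ℝ → EuclideanSpace ℝ (Fin N) → ℝ}
  (hu : IsMildSolution Z Y p u₀ T u)
include hu

/-- Near the origin this is part of the definition; on the remaining compact interval it follows
from continuity and a finite cover. -/
lemma exists_bound {t : ℝ} (ht : t ∈ timeInterval T) :
    ∃ M : ℝ≥0, ∀ s ∈ Ioc 0 t, normX (u s) ≤ M := by
  obtain ⟨δ, hδ, C, hC⟩ := hu.bounded_near_zero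
  have h1 : ∃ M : ℝ≥0, ∀ s ∈ Icc (min δ t / 2) t, normX (u s) ≤ M := by
    have hpos : 0 < min δ t / 2 := half_pos (lt_min hδ ht.1)
    have hsub : Icc (min δ t / 2) t ⊆ timeInterval T := fun s hs =>
      mem_timeInterval_of_le ht (hpos.trans_le hs.1) hs.2
    refine isCompact_Icc.induction_on (p := fun S => ∃ M : ℝ≥0, ∀ s ∈ S, normX (u s) ≤ M)
      ⟨0, fun s hs => hs.elim⟩ (fun S S' hSS' ⟨M, hM⟩ => ⟨M, fun s hs => hM s (hSS' hs)⟩) ?_ ?_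
    · rintro S S' ⟨M, hM⟩ ⟨M', hM'⟩
      refine ⟨max M M', fun s hs => ?_⟩
      rcases hs with hs | hs
      · exact (hM s hs).trans (by exact_mod_cast le_max_left _ _)
      · exact (hM' s hs).trans (by exact_mod_cast le_max_right _ _)
    · intro s hs
      have hsX := hu.memX s (hsub hs)
      have hfin : normX (u s) ≠ ∞ :=
        ENNReal.add_ne_top.2 ⟨hsX.1.eLpNorm_ne_top, hsX.2.eLpNorm_ne_top⟩
      have h2 := ((hu.continuous s (hsub hs)).mono_left (nhdsWithin_mono s hsub)).eventually_le_const
        (zero_lt_one)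
      refine ⟨_, inter_mem h2 self_mem_nhdsWithin, 1 + (normX (u s)).toNNReal, fun r hr => ?_⟩
      refine (normX_le_add (hu.memX r (hsub hr.2)) hsX).trans ?_
      push_cast
      rw [ENNReal.coe_toNNReal hfin]
      exact add_le_add hr.1 le_rfl
  obtain ⟨M, hM⟩ := h1
  refine ⟨max M C, fun s hs => ?_⟩
  rcases lt_or_ge s δ with hsδ | hsδ
  · exact (hC s (mem_timeInterval_of_le ht hs.1 hs.2) hsδ).trans (by exact_mod_cast le_max_right _ _)
  · have : min δ t / 2 ≤ s := by linarith [min_le_left δ t]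
    exact (hM s ⟨this, hs.2⟩).trans (by exact_mod_cast le_max_left _ _)

/-- The curve is replaced by a jointly measurable function bounded everywhere and cut off outside
`(0, t]`. It agrees with `u` for almost every `(s, x)` only; statements at every single time come
back through the Duhamel formula. -/
lemma exists_rep {t : ℝ} (ht : t ∈ timeInterval T) :
    ∃ (U : ℝ → EuclideanSpace ℝ (Fin N) → ℝ≥0∞) (M : ℝ≥0), Measurable (Function.uncurry U) ∧
      (∀ s ≤ 0, U s = 0) ∧ (∀ s x, U s x ≤ M) ∧ (∀ᵐ s, ∫⁻ x, U s x ≤ M) ∧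
      ∀ᵐ q ∂(volume.restrict (Ioc 0 t)).prod volume, u q.1 q.2 = (U q.1 q.2).toReal := by
  obtain ⟨M, hM⟩ := hu.exists_bound ht
  have hsub : Ioc 0 t ⊆ timeInterval T := fun s hs => mem_timeInterval_of_le ht hs.1 hs.2
  have hum := hu.aestronglyMeasurable.mono_ac
    ((Measure.restrict_mono hsub le_rfl).absolutelyContinuous.prod
      (Measure.AbsolutelyContinuous.refl volume))
  set u' := hum.mk _ with hu'
  have hm : Measurable u' := hum.stronglyMeasurable_mk.measurable
  have hae := hum.ae_eq_mk
  have hgood : ∀ᵐ q ∂(volume.restrict (Ioc 0 t)).prod volume, 0 ≤ u' q ∧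
      ENNReal.ofReal (u' q) ≤ M := by
    refine (Measure.ae_prod_iff_ae_ae ?_).2 ?_
    · exact (measurableSet_le measurable_const hm).inter
        (measurableSet_le hm.ennreal_ofReal measurable_const)
    · filter_upwards [Measure.ae_ae_of_ae_prod hae, ae_restrict_mem measurableSet_Ioc] with s hs hst
      filter_upwards [hs, hu.nonneg s (hsub hst), enorm_ae_le_eLpNormEssSup (u s) volume] with x hx
        h0 hle
      have hx' : u s x = u' (s, x) := hx
      rw [← eLpNorm_exponent_top, Real.enorm_of_nonneg h0] at hle
      rw [← hx']
      exact ⟨h0, (hle.trans le_add_self).trans (hM s hst)⟩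
  set U : ℝ → EuclideanSpace ℝ (Fin N) → ℝ≥0∞ := fun s x =>
    (Ioc 0 t).indicator (fun _ => min (ENNReal.ofReal (u' (s, x))) M) s with hU
  have hUae : ∀ᵐ q ∂(volume.restrict (Ioc 0 t)).prod volume, u q.1 q.2 = (U q.1 q.2).toReal := by
    have hmem : ∀ᵐ q ∂(volume.restrict (Ioc 0 t)).prod
        (volume : Measure (EuclideanSpace ℝ (Fin N))), q.1 ∈ Ioc 0 t :=
      Measure.quasiMeasurePreserving_fst.ae (ae_restrict_mem measurableSet_Ioc)
    filter_upwards [hae, hgood, hmem] with q h1 h2 h3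
    simp only [hU, indicator_of_mem h3]
    rw [min_eq_left h2.2, ENNReal.toReal_ofReal h2.1]
    exact h1
  refine ⟨U, M, ?_, fun s hs => ?_, fun s x => ?_, ?_, hUae⟩
  · have : Function.uncurry U = (Ioc 0 t ×ˢ univ).indicator fun q => min (ENNReal.ofReal (u' q)) M := by
      ext ⟨s, x⟩
      simp only [Function.uncurry, hU, indicator, mem_prod, mem_univ, and_true]
    rw [this]
    exact (hm.ennreal_ofReal.min measurable_const).indicator (measurableSet_Ioc.prod .univ)
  · ext x
    simp [hU, hs]
  · exact indicator_le (fun s _ => min_le_right _ _) s |>.trans le_rfl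
  · have h1 := (ae_restrict_iff' measurableSet_Ioc).1 (Measure.ae_ae_of_ae_prod hUae)
    filter_upwards [h1] with s hs
    by_cases hst : s ∈ Ioc 0 t
    · have h2 : ∫⁻ x, U s x = eLpNorm (u s) 1 volume := by
        rw [eLpNorm_one_eq_lintegral_enorm]
        refine lintegral_congr_ae ?_
        filter_upwards [hs hst] with x hx
        have hx' : u s x = (U s x).toReal := hx
        rw [hx', Real.enorm_of_nonneg ENNReal.toReal_nonneg, ENNReal.ofReal_toReal]
        simp only [hU, indicator_of_mem hst]
        exact ((min_le_right _ _).trans_lt ENNReal.coe_lt_top).ne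
      rw [h2]
      exact le_self_add.trans (hM s hst)
    · simp [hU, hst]

end IsMildSolution

end representation

/-! ### The comparison principle -/

section comparison

variable {N : ℕ} {K L : ℝ → ℝ≥0∞} {Q : ℝ → Measure (EuclideanSpace ℝ (Fin N))} {p : ℝ}
  {m : EuclideanSpace ℝ (Fin N) → ℝ≥0} {T : EReal}

lemma duhamel_rpow_le [∀ s, IsProbabilityMeasure (Q s)] (hL : IsTimeKernel L)
    {U : ℝ → EuclideanSpace ℝ (Fin N) → ℝ≥0∞} {M : ℝ≥0} (hp : 0 ≤ p) (h0 : ∀ s ≤ 0, ∀ x, U s x ^ p = 0)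
    {t : ℝ} (hM : ∀ s < t, ∀ x, U s x ≤ M) (x : EuclideanSpace ℝ (Fin N)) :
    duhamelIntegral L Q (fun s y => U s y ^ p) t x ≤ (M : ℝ≥0∞) ^ p * ∫⁻ s in Iio t, L s := by
  rw [← hL.lintegral_mul_indicator]
  refine lintegral_mono fun s => ?_
  rcases eq_or_ne (L s) 0 with hs | hs
  · simp [hs]
  have hpos := hL.pos_of_ne_zero hs
  by_cases hst : s < t
  · rw [indicator_of_mem (mem_Iio.2 hst)]
    exact mul_le_mul_right (measureConv_le s
      (fun y => ENNReal.rpow_le_rpow (hM _ (by linarith) y) hp) x) _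
  · simp [measureConv, h0 (t - s) (by linarith)]

/-- The Duhamel formula for a nonnegative measurable representative of a mild solution. -/
lemma IsMildSolution.ae_eq_duhamel (h : IsSoninePair K L) (hQ : IsTransitionFamily L m Q)
    (hp : 0 < p) {u₀ : EuclideanSpace ℝ (Fin N) → ℝ} {u : ℝ → EuclideanSpace ℝ (Fin N) → ℝ}
    (hu : IsMildSolution (fundamentalZ K L Q) (fundamentalY L Q) p u₀ T u) {t : ℝ}
    (ht : t ∈ timeInterval T) {U : ℝ → EuclideanSpace ℝ (Fin N) → ℝ≥0∞} {M : ℝ≥0}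
    (hUm : Measurable (Function.uncurry U)) (hU0 : ∀ s ≤ 0, U s = 0) (hUM : ∀ s x, U s x ≤ M)
    (hUu : ∀ᵐ q ∂(volume.restrict (Ioc 0 t)).prod volume, u q.1 q.2 = (U q.1 q.2).toReal)
    {f : EuclideanSpace ℝ (Fin N) → ℝ≥0∞} (hf : Measurable f) (hf' : ∀ x, f x ≠ ∞)
    (hfu : ∀ᵐ x, u₀ x = (f x).toReal) {s : ℝ} (hs : s ∈ Ioc 0 t) :
    ∀ᵐ x, u s x = (freeEvolution K L Q f s x).toReal +
      (duhamelIntegral L Q (fun r y => U r y ^ p) s x).toReal := by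
  have := hQ.isProbabilityMeasure
  have := isProbabilityMeasure_fundamentalZ h hQ hs.1
  have hac : (volume.restrict (Ioc 0 s)).prod (volume : Measure (EuclideanSpace ℝ (Fin N))) ≪
      (volume.restrict (Ioc 0 t)).prod volume :=
    (Measure.restrict_mono (Ioc_subset_Ioc_right hs.2) le_rfl).absolutelyContinuous.prod
      (Measure.AbsolutelyContinuous.refl volume)
  have h1 := integral_spaceConv_fundamentalY_ae_eq (f := fun τ y => u τ y ^ p)
    (F := fun τ y => U τ y ^ p) (M := M ^ p) h.right hQ.measurable (hUm.pow_const p)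
    (fun s hs => by ext y; simp [hU0 s hs, hp]) (fun s x => by
      rw [ENNReal.coe_rpow_of_nonneg _ hp.le]
      exact ENNReal.rpow_le_rpow (hUM s x) hp.le) hs.1.le (by
      filter_upwards [hac.ae_le hUu] with q hq
      rw [hq, ENNReal.toReal_rpow])
  filter_upwards [h1, spaceConv_fundamentalZ_ae_eq h hQ.measurable hfu hf hf' (t := s),
    hu.duhamel s (mem_timeInterval_of_le ht hs.1 hs.2)] with x hx1 hx2 hx3
  rw [hx3, hx1, hx2]

/-- The Duhamel formulas, the order of the free evolutions and the Lipschitz bound for the power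
give `φ ≤ C (L ⋆ φ)` for `φ(s) = ∫ (U s - V s)₊`, because convolution with `Q s` preserves
integrals. Gronwall's lemma then yields `φ = 0`. -/
lemma IsMildSolution.ae_le (h : IsSoninePair K L) (hQ : IsTransitionFamily L m Q) (hp : 1 < p)
    {u₀ v₀ : EuclideanSpace ℝ (Fin N) → ℝ} {u v : ℝ → EuclideanSpace ℝ (Fin N) → ℝ}
    (hu₀ : MemX u₀) (hv₀ : MemX v₀) (h0 : ∀ᵐ x, 0 ≤ u₀ x) (h0v : ∀ᵐ x, u₀ x ≤ v₀ x)
    (hu : IsMildSolution (fundamentalZ K L Q) (fundamentalY L Q) p u₀ T u)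
    (hv : IsMildSolution (fundamentalZ K L Q) (fundamentalY L Q) p v₀ T v) {t : ℝ}
    (ht : t ∈ timeInterval T) : ∀ᵐ x, u t x ≤ v t x := by
  have hpr := hQ.isProbabilityMeasure
  have hQm := hQ.measurable
  have hKm := h.left.measurable
  have hLm := h.right.measurable
  have hpos : 0 < p := by linarith
  obtain ⟨f, A, hf, hfA, hfu⟩ := hu₀.exists_rep h0
  obtain ⟨g, B, hg, hgB, hgv⟩ := hv₀.exists_rep (by
    filter_upwards [h0, h0v] with x h1 h2 using h1.trans h2)
  obtain ⟨U, M, hUm, hU0, hUM, hUi, hUu⟩ := hu.exists_rep ht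
  obtain ⟨V, M', hVm, hV0, hVM, -, hVv⟩ := hv.exists_rep ht
  have hft : ∀ x, f x ≠ ∞ := fun x => ((hfA.1 x).trans_lt ENNReal.coe_lt_top).ne
  have hgt : ∀ x, g x ≠ ∞ := fun x => ((hgB.1 x).trans_lt ENNReal.coe_lt_top).ne
  -- Representing `u₀` by the minimum orders the data everywhere, hence the free evolutions
  -- pointwise.
  have hfu' : ∀ᵐ x, u₀ x = (min (f x) (g x)).toReal := by
    filter_upwards [hfu, hgv, h0v] with x h1 h2 h3
    rw [h1, h2, ENNReal.toReal_le_toReal (hft x) (hgt x)] at h3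
    rw [min_eq_left h3, h1]
  have hUd := fun s hs => hu.ae_eq_duhamel h hQ hpos ht hUm hU0 hUM hUu (hf.min hg)
    (fun x => ((min_le_left _ _).trans_lt (hft x).lt_top).ne) hfu' (s := s) hs
  have hVd := fun s hs => hv.ae_eq_duhamel h hQ hpos ht hVm hV0 hVM hVv hg hgt hgv (s := s) hs
  have hfin : ∀ (W : ℝ → EuclideanSpace ℝ (Fin N) → ℝ≥0∞) (C : ℝ≥0), (∀ s ≤ 0, W s = 0) →
      (∀ s x, W s x ≤ C) → ∀ s x, duhamelIntegral L Q (fun r y => W r y ^ p) s x ≠ ∞ := fun W C hW hC s x =>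
    ((duhamel_rpow_le h.right hpos.le (fun s hs x => by simp [hW s hs, hpos])
      (fun s _ => hC s) x).trans_lt (ENNReal.mul_lt_top
        (ENNReal.rpow_lt_top_of_nonneg hpos.le ENNReal.coe_ne_top)
        (h.right.lintegral_lt_top s))).ne
  have hzfin : ∀ s x, freeEvolution K L Q g s x ≠ ∞ := fun s x =>
    (((IsBoundX.freeEvolution h hQm hg hgB s).1 x).trans_lt ENNReal.coe_lt_top).ne
  set φ : ℝ → ℝ≥0∞ := fun s => ∫⁻ x, (U s x - V s x) with hφ
  have hUV : Measurable fun q : ℝ × EuclideanSpace ℝ (Fin N) => U q.1 q.2 - V q.1 q.2 := hUm.sub hVm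
  have hφm : Measurable φ := hUV.lintegral_prod_right'
  have hφ0 : Causal φ := fun s hs => by simp [hφ, hU0 s hs]
  -- the basic estimate, at every time
  have key : ∀ s ∈ Ioc 0 t, ∫⁻ x, ENNReal.ofReal (u s x - v s x) ≤ powLip p M * (L ⋆ₗ φ) s := by
    intro s hs
    have hUV' : Measurable (Function.uncurry fun r y => (powLip p M : ℝ≥0∞) * (U (s - r) y - V (s - r) y)) :=
      (hUV.comp (by fun_prop : Measurable fun q : ℝ × EuclideanSpace ℝ (Fin N) =>
        (s - q.1, q.2))).const_mul _
    calc ∫⁻ x, ENNReal.ofReal (u s x - v s x)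
        ≤ ∫⁻ x, mixture volume Q L (fun r y => powLip p M * (U (s - r) y - V (s - r) y)) x := by
          refine lintegral_mono_ae ?_
          filter_upwards [hUd s hs, hVd s hs] with x hx hx'
          refine le_trans ?_ (duhamel_rpow_sub_le h.right hQm hp.le hVm (fun r _ => hUM r) s x)
          have hz : freeEvolution K L Q (fun x => min (f x) (g x)) s x ≤ freeEvolution K L Q g s x :=
            mixture_mono (fun _ _ y => min_le_right _ _) x
          have hz' := ENNReal.toReal_mono (hzfin s x) hz
          have hU' := hfin U M hU0 hUM s x
          have hV' := hfin V M' hV0 hVM s x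
          rw [hx, hx']
          refine (ENNReal.ofReal_le_ofReal (q :=
            (duhamelIntegral L Q (fun r y => U r y ^ p) s x).toReal -
              (duhamelIntegral L Q (fun r y => V r y ^ p) s x).toReal) (by linarith)).trans ?_
          rw [ENNReal.ofReal_sub _ ENNReal.toReal_nonneg, ENNReal.ofReal_toReal hU',
            ENNReal.ofReal_toReal hV']
      _ = powLip p M * (L ⋆ₗ φ) s := by
          rw [lintegral_mixture hQm hLm hUV', lconv_eq_lintegral, ← lintegral_const_mul _ (by fun_prop)]
          refine lintegral_congr fun r => ?_
          have hr : Measurable fun x => U (s - r) x - V (s - r) x :=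
            hUV.comp (by fun_prop : Measurable fun y : EuclideanSpace ℝ (Fin N) => (s - r, y))
          rw [lintegral_const_mul _ hr]
          ring
  have hφle : ∀ᵐ s, s < t → φ s ≤ powLip p M * (L ⋆ₗ φ) s := by
    have h1 := (ae_restrict_iff' measurableSet_Ioc).1 (Measure.ae_ae_of_ae_prod hUu)
    have h2 := (ae_restrict_iff' measurableSet_Ioc).1 (Measure.ae_ae_of_ae_prod hVv)
    filter_upwards [h1, h2] with s hs1 hs2 hst
    rcases le_or_gt s 0 with hs0 | hs0
    · rw [hφ0 s hs0]; exact bot_le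
    have hs : s ∈ Ioc 0 t := ⟨hs0, hst.le⟩
    refine le_trans (lintegral_mono_ae ?_) (key s hs)
    filter_upwards [hs1 hs, hs2 hs] with x hx hx'
    have hx1 : u s x = (U s x).toReal := hx
    have hx2 : v s x = (V s x).toReal := hx'
    rw [hx1, hx2, ENNReal.ofReal_sub _ ENNReal.toReal_nonneg,
      ENNReal.ofReal_toReal ((hUM s x).trans_lt ENNReal.coe_lt_top).ne,
      ENNReal.ofReal_toReal ((hVM s x).trans_lt ENNReal.coe_lt_top).ne]
  have hφfin : ∫⁻ s in Iio t, φ s < ∞ := by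
    rw [hφ0.setLIntegral_Iio]
    refine (lintegral_mono_ae (g := fun _ => (M : ℝ≥0∞)) ?_).trans_lt ?_
    · refine ae_restrict_of_ae ?_
      filter_upwards [hUi] with s hs
      exact (lintegral_mono fun x => tsub_le_self).trans hs
    · rw [setLIntegral_const]
      exact ENNReal.mul_lt_top ENNReal.coe_lt_top (by simp)
  have hzero := h.right.gronwall hφ0 hφm hφfin ENNReal.coe_ne_top hφle
  -- The estimate `key` concerns `u` and `v` themselves at the given time `t`, while its right-hand
  -- side sees `φ` at almost every earlier time only. This gives the conclusion at every `t` and not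
  -- just almost every one.
  have h1 := key t ⟨ht.1, le_rfl⟩
  have h2 : (L ⋆ₗ φ) t = 0 := by
    rw [h.right.causal.lconv_eq_setLIntegral hφ0, ← setLIntegral_congr Ioo_ae_eq_Ioc]
    refine (setLIntegral_congr_fun_ae measurableSet_Ioo ?_).trans (lintegral_zero)
    filter_upwards [hzero] with s hs hst
    rw [hs hst.2, mul_zero]
  rw [h2, mul_zero, nonpos_iff_eq_zero, lintegral_eq_zero_iff'] at h1
  · filter_upwards [h1] with x hx
    have := ENNReal.ofReal_eq_zero.1 hx
    linarith
  · exact ((hu.memX t ht).1.aestronglyMeasurable.sub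
      (hv.memX t ht).1.aestronglyMeasurable).aemeasurable.ennreal_ofReal

end comparison

/-! ### Behaviour at the initial time -/

section initial

lemma IsTimeKernel.tendsto_setLIntegral_Iio {L : ℝ → ℝ≥0∞} (hL : IsTimeKernel L) :
    Tendsto (fun t => ∫⁻ s in Iio t, L s) (𝓝[>] 0) (𝓝 0) := by
  have h1 : Tendsto (fun t : ℝ => ∫⁻ s in Ioo 0 t, (Iio (1 : ℝ)).indicator L s) (𝓝[>] 0) (𝓝 0) := by
    refine tendsto_setLIntegral_zero
      (by rw [lintegral_indicator measurableSet_Iio]; exact (hL.lintegral_lt_top 1).ne) ?_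
    have h2 : Tendsto (fun t : ℝ => ENNReal.ofReal (t - 0)) (𝓝 0) (𝓝 0) := by
      have := (ENNReal.continuous_ofReal.comp (continuous_id.sub continuous_const)).tendsto (0 : ℝ)
        (f := fun t : ℝ => ENNReal.ofReal (t - 0))
      simpa using this
    refine (h2.mono_left nhdsWithin_le_nhds).congr fun t => ?_
    rw [Function.comp, Real.volume_Ioo]
  refine h1.congr' ?_
  filter_upwards [nhdsWithin_le_nhds (gt_mem_nhds (zero_lt_one' ℝ))] with t ht
  rw [hL.causal.setLIntegral_Iio]
  refine setLIntegral_congr_fun measurableSet_Ioo fun s hs => ?_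
  rw [indicator_of_mem (mem_Iio.2 (hs.2.trans ht))]

variable {N : ℕ}

open BoundedContinuousFunction in
/-- Translation is continuous in `L¹`. -/
lemma exists_translation_modulus {w : EuclideanSpace ℝ (Fin N) → ℝ} (hw : MemLp w 1 volume) :
    ∃ G : EuclideanSpace ℝ (Fin N) →ᵇ ℝ≥0, G 0 = 0 ∧
      ∀ y, ∫⁻ x, ‖w (x - y) - w x‖ₑ = G y := by
  set W : Lp ℝ 1 (volume : Measure (EuclideanSpace ℝ (Fin N))) := hw.toLp w with hW
  have hmp : ∀ y : EuclideanSpace ℝ (Fin N), MeasurePreserving (fun x => x - y) volume volume :=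
    fun y => measurePreserving_sub_right volume y
  let g : C(EuclideanSpace ℝ (Fin N),
      C(EuclideanSpace ℝ (Fin N), EuclideanSpace ℝ (Fin N))) :=
    (ContinuousMap.mk (fun a : EuclideanSpace ℝ (Fin N) × EuclideanSpace ℝ (Fin N) => a.2 - a.1)
      (by fun_prop)).curry
  have hcont : Continuous fun y => Lp.compMeasurePreserving (fun x => x - y) (hmp y) W :=
    (continuous_const (y := W)).compMeasurePreservingLp g.continuous hmp ENNReal.one_ne_top
  have hle : ∀ y, ‖Lp.compMeasurePreserving (fun x => x - y) (hmp y) W - W‖ ≤ 2 * ‖W‖ := fun y => by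
    refine (norm_sub_le _ _).trans ?_
    rw [Lp.norm_compMeasurePreserving, two_mul]
  refine ⟨BoundedContinuousFunction.mkOfBound
    ⟨fun y => ‖Lp.compMeasurePreserving (fun x => x - y) (hmp y) W - W‖₊,
      (hcont.sub continuous_const).nnnorm⟩ (2 * ‖W‖) fun y z => ?_, ?_, fun y => ?_⟩
  · rw [NNReal.dist_eq]
    exact abs_sub_le_of_nonneg_of_le (norm_nonneg _) (hle y) (norm_nonneg _) (hle z)
  · have h0 : Lp.compMeasurePreserving (fun x => x - 0) (hmp 0) W = W := by
      rw [hW, Lp.toLp_compMeasurePreserving]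
      congr 1
      ext x
      simp
    change ‖Lp.compMeasurePreserving (fun x => x - 0) (hmp 0) W - W‖₊ = 0
    rw [h0, sub_self, nnnorm_zero]
  · simp only [mkOfBound_coe, ContinuousMap.coe_mk]
    rw [← enorm_eq_nnnorm, hW, Lp.toLp_compMeasurePreserving, ← MemLp.toLp_sub, Lp.enorm_toLp,
      eLpNorm_one_eq_lintegral_enorm]
    rfl

/-- As `μ` has mass one, the difference is the `μ`-average of `w (x - y) - w x`; the triangle
inequality and Tonelli's theorem conclude. -/
lemma lintegral_enorm_spaceConv_sub_le (μ : Measure (EuclideanSpace ℝ (Fin N)))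
    [IsProbabilityMeasure μ] {w : EuclideanSpace ℝ (Fin N) → ℝ} (hw : Measurable w) {C : ℝ}
    (hC : ∀ x, ‖w x‖ ≤ C) :
    ∫⁻ x, ‖spaceConv μ w x - w x‖ₑ ≤ ∫⁻ y, (∫⁻ x, ‖w (x - y) - w x‖ₑ) ∂μ := by
  have hm : Measurable fun q : EuclideanSpace ℝ (Fin N) × EuclideanSpace ℝ (Fin N) =>
      ‖w (q.1 - q.2) - w q.1‖ₑ := by fun_prop
  rw [← lintegral_lintegral_swap hm.aemeasurable]
  refine lintegral_mono fun x => ?_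
  have hint : Integrable (fun y => w (x - y)) μ :=
    Integrable.of_bound (Measurable.aestronglyMeasurable (by fun_prop)) C
      (Eventually.of_forall fun y => hC _)
  have h1 : spaceConv μ w x - w x = ∫ y, (w (x - y) - w x) ∂μ := by
    rw [integral_sub hint (integrable_const _), integral_const]
    simp [spaceConv]
  rw [h1]
  exact enorm_integral_le_lintegral_enorm _

variable {K L : ℝ → ℝ≥0∞} {Q : ℝ → Measure (EuclideanSpace ℝ (Fin N))}
  {m : EuclideanSpace ℝ (Fin N) → ℝ≥0}

/-- The equation `K ⋆ r + m (H ⋆ r) = H` and `r ≤ L` trap the transform between `1 - m ∫₀ᵗ L` and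
`1`. -/
lemma tendsto_charFun_fundamentalZ (h : IsSoninePair K L) (hQ : IsTransitionFamily L m Q)
    (ξ : EuclideanSpace ℝ (Fin N)) :
    Tendsto (fun t => charFun (fundamentalZ K L Q t) ξ) (𝓝[>] 0) (𝓝 1) := by
  simp only [charFun_fundamentalZ h hQ]
  have h1 : Tendsto (fun t => (m ξ : ℝ≥0∞) * ∫⁻ s in Iio t, L s) (𝓝[>] 0) (𝓝 0) := by
    simpa using ENNReal.Tendsto.const_mul h.right.tendsto_setLIntegral_Iio
      (Or.inr (ENNReal.coe_ne_top (r := m ξ)))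
  have h2 : Tendsto (fun t => 1 - (m ξ : ℝ≥0∞) * ∫⁻ s in Iio t, L s) (𝓝[>] 0) (𝓝 1) := by
    simpa using ENNReal.Tendsto.sub (tendsto_const_nhds (x := (1 : ℝ≥0∞))) h1
      (Or.inl ENNReal.one_ne_top)
  have h3 : Tendsto (K ⋆ₗ volterraResolvent L (m ξ)) (𝓝[>] 0) (𝓝 1) := by
    refine tendsto_of_tendsto_of_tendsto_of_le_of_le' h2 tendsto_const_nhds ?_ ?_
    · filter_upwards [self_mem_nhdsWithin] with t ht
      have h4 := congrFun (h.kernel_lconv_resolvent (m ξ)) t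
      rw [heaviside_of_pos ht, Pi.add_apply, Pi.smul_apply, smul_eq_mul, heaviside_lconv] at h4
      rw [← h4, tsub_le_iff_right]
      exact add_le_add le_rfl (mul_le_mul_right (lintegral_mono (h.resolvent_le _)) _)
    · filter_upwards [self_mem_nhdsWithin] with t ht
      exact (h.kernel_lconv_resolvent_le (m ξ) t).trans (heaviside_of_pos ht).le
  have h5 := (Complex.continuous_ofReal.tendsto _).comp
    ((ENNReal.tendsto_toReal ENNReal.one_ne_top).comp h3)
  simpa [Function.comp_def] using h5

/-- The free evolution attains its initial value in `L¹`. -/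
lemma tendsto_eLpNorm_spaceConv_fundamentalZ_sub (h : IsSoninePair K L)
    (hQ : IsTransitionFamily L m Q) {u₀ : EuclideanSpace ℝ (Fin N) → ℝ} (hu₀ : MemX u₀)
    (h0 : ∀ᵐ x, 0 ≤ u₀ x) :
    Tendsto (fun t => eLpNorm (spaceConv (fundamentalZ K L Q t) u₀ - u₀) 1 volume) (𝓝[>] 0)
      (𝓝 0) := by
  obtain ⟨f, A, hf, hfA, hfu⟩ := hu₀.exists_rep h0
  have hft : ∀ x, f x ≠ ∞ := fun x => ((hfA.1 x).trans_lt ENNReal.coe_lt_top).ne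
  obtain ⟨G, hG0, hG⟩ := exists_translation_modulus (w := fun x => (f x).toReal)
    ((memLp_congr_ae hfu).1 hu₀.1)
  refine tendsto_of_seq_tendsto fun τ hτ => ?_
  -- A sequence tending to `0` from the right is eventually positive; the Dirac mass is a filler for
  -- the finitely many other indices.
  have hex : ∀ n, ∃ μ : ProbabilityMeasure (EuclideanSpace ℝ (Fin N)), 0 < τ n →
      (μ : Measure (EuclideanSpace ℝ (Fin N))) = fundamentalZ K L Q (τ n) := fun n => by
    by_cases hn : 0 < τ n
    · exact ⟨⟨_, isProbabilityMeasure_fundamentalZ h hQ hn⟩, fun _ => rfl⟩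
    · exact ⟨⟨Measure.dirac 0, inferInstance⟩, fun hn' => absurd hn' hn⟩
  choose μ hμ using hex
  have hpos : ∀ᶠ n in atTop, 0 < τ n := hτ.eventually self_mem_nhdsWithin
  have hlim : Tendsto μ atTop (𝓝 (⟨Measure.dirac 0, inferInstance⟩ :
      ProbabilityMeasure (EuclideanSpace ℝ (Fin N)))) := by
    refine ProbabilityMeasure.tendsto_of_tendsto_charFun fun ξ => ?_
    have h1 := (tendsto_charFun_fundamentalZ h hQ ξ).comp hτ
    simp only [ProbabilityMeasure.coe_mk, charFun_dirac, inner_zero_left, Complex.ofReal_zero,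
      zero_mul, Complex.exp_zero]
    refine h1.congr' ?_
    filter_upwards [hpos] with n hn
    rw [hμ n hn, Function.comp]
  -- The translation modulus `G` is bounded and continuous, so weak convergence to the Dirac mass
  -- sends its integrals to `G 0 = 0`.
  have hlimG := ProbabilityMeasure.tendsto_iff_forall_lintegral_tendsto.1 hlim G
  simp only [ProbabilityMeasure.coe_mk] at hlimG
  rw [lintegral_dirac' _ (by fun_prop), hG0, ENNReal.coe_zero] at hlimG
  refine tendsto_of_tendsto_of_tendsto_of_le_of_le' tendsto_const_nhds hlimG
    (Eventually.of_forall fun _ => bot_le) ?_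
  filter_upwards [hpos] with n hn
  have hZ := isProbabilityMeasure_fundamentalZ h hQ hn
  rw [hμ n hn, Function.comp, eLpNorm_one_eq_lintegral_enorm]
  have h2 := lintegral_enorm_spaceConv_sub_le (fundamentalZ K L Q (τ n))
    (w := fun x => (f x).toReal) hf.ennreal_toReal (C := A) fun x => by
      rw [Real.norm_of_nonneg ENNReal.toReal_nonneg]
      exact ENNReal.toReal_le_coe_of_le_coe (hfA.1 x)
  simp only [hG] at h2
  refine le_trans (le_of_eq (lintegral_congr_ae ?_)) h2
  filter_upwards [spaceConv_ae_eq (fundamentalZ K L Q (τ n)) hfu hf hft,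
    spaceConv_ae_eq (fundamentalZ K L Q (τ n)) (f := fun x => (f x).toReal)
      (Eventually.of_forall fun x => rfl) hf hft, hfu] with x hx1 hx2 hx3
  rw [Pi.sub_apply, hx1, hx2, hx3]

end initial

/-! ### Local existence -/

section existence

variable {N : ℕ} {K L : ℝ → ℝ≥0∞} {Q : ℝ → Measure (EuclideanSpace ℝ (Fin N))} {p : ℝ}
  {m : EuclideanSpace ℝ (Fin N) → ℝ≥0}

lemma mem_timeInterval_coe {T t : ℝ} : t ∈ timeInterval (T : EReal) ↔ 0 < t ∧ t < T := by
  simp [timeInterval]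

lemma IsBoundX.memX {f : EuclideanSpace ℝ (Fin N) → ℝ≥0∞} {c : ℝ≥0} (hf : Measurable f)
    (h : IsBoundX f c) : MemX (fun x => (f x).toReal) ∧ normX (fun x => (f x).toReal) ≤ 2 * c := by
  have h1 := eLpNorm_toReal_sub_le (g := 0) (c := c) (d := 0) hf measurable_const
    (fun x => ((h.1 x).trans_lt ENNReal.coe_lt_top).ne) (fun x => by simp)
    (h.mono (fun x => by simp) le_rfl) ((isBoundX_zero 0).mono (fun x => by simp) le_rfl)
  simp only [Pi.zero_apply, ENNReal.toReal_zero, sub_zero, add_zero] at h1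
  have hm := (hf.ennreal_toReal).aestronglyMeasurable (μ := volume)
  exact ⟨⟨⟨hm, h1.1.trans_lt ENNReal.coe_lt_top⟩, ⟨hm, h1.2.trans_lt ENNReal.coe_lt_top⟩⟩,
    (add_le_add h1.1 h1.2).trans_eq (two_mul _).symm⟩

lemma normX_toReal_sub_le {f g : EuclideanSpace ℝ (Fin N) → ℝ≥0∞} (hf : Measurable f)
    (hg : Measurable g) (hf' : ∀ x, f x ≠ ∞) (hg' : ∀ x, g x ≠ ∞) {c d : ℝ≥0∞}
    (h₁ : IsBoundX (f - g) c) (h₂ : IsBoundX (g - f) d) :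
    normX (fun x => (f x).toReal - (g x).toReal) ≤ 2 * (c + d) := by
  have h := eLpNorm_toReal_sub_le hf hg hf' hg' h₁ h₂
  exact (add_le_add h.1 h.2).trans_eq (two_mul _).symm

lemma normX_congr_ae {f g : EuclideanSpace ℝ (Fin N) → ℝ} (h : f =ᵐ[volume] g) :
    normX f = normX g := by
  rw [normX, normX, eLpNorm_congr_ae h, eLpNorm_congr_ae h]

lemma IsTimeKernel.exists_time (hL : IsTimeKernel L) (c : ℝ≥0) :
    ∃ T : ℝ, 0 < T ∧ c * ∫⁻ s in Iio T, L s ≤ 2⁻¹ := by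
  have h1 : Tendsto (fun t => (c : ℝ≥0∞) * ∫⁻ s in Iio t, L s) (𝓝[>] 0) (𝓝 0) := by
    simpa using ENNReal.Tendsto.const_mul hL.tendsto_setLIntegral_Iio
      (Or.inr (ENNReal.coe_ne_top (r := c)))
  obtain ⟨T, hT, hT0⟩ := ((h1.eventually_le_const (by simp : (0 : ℝ≥0∞) < 2⁻¹)).and
    self_mem_nhdsWithin).exists
  exact ⟨T, hT0, hT⟩

variable {f : EuclideanSpace ℝ (Fin N) → ℝ≥0∞} {A : ℝ≥0} {T : ℝ}
  {u₀ : EuclideanSpace ℝ (Fin N) → ℝ}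

lemma isMildSolution_picardLimit (h : IsSoninePair K L) (hQ : IsTransitionFamily L m Q)
    (hp : 1 ≤ p) (hf : Measurable f) (hA : IsBoundX f A)
    (hT : powLip p (2 * A) * ∫⁻ s in Iio T, L s ≤ 2⁻¹) (hfu : ∀ᵐ x, u₀ x = (f x).toReal) :
    IsMildSolution (fundamentalZ K L Q) (fundamentalY L Q) p u₀ T
      fun t x => (picardLimit K L Q p f t x).toReal := by
  have hpr := hQ.isProbabilityMeasure
  have hQm := hQ.measurable
  have hpos : 0 < p := by linarith
  have hUm := measurable_picardLimit (p := p) h.left.measurable h.right.measurable hQm hf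
  have hUs : ∀ t, Measurable (picardLimit K L Q p f t) := fun t => hUm.of_uncurry_left
  have hb : ∀ t < T, IsBoundX (picardLimit K L Q p f t) (2 * A : ℝ≥0) := fun t ht =>
    isBoundX_picardLimit h hQm hp hf hA hT ht
  have hfin : ∀ t < T, ∀ x, picardLimit K L Q p f t x ≠ ∞ := fun t ht x =>
    (((hb t ht).1 x).trans_lt ENNReal.coe_lt_top).ne
  refine ⟨hUm.ennreal_toReal.aestronglyMeasurable, fun t ht => ?_, fun t ht => ?_, fun t ht => ?_,
    ⟨1, one_pos, 2 * (2 * A), fun t ht _ => ?_⟩, fun t ht => ?_⟩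
  · exact (IsBoundX.memX (hUs t) (hb t (mem_timeInterval_coe.1 ht).2)).1
  · exact Eventually.of_forall fun x => ENNReal.toReal_nonneg
  · obtain ⟨ht0, htT⟩ := mem_timeInterval_coe.1 ht
    obtain ⟨ω, hω, hωb⟩ := exists_modulus_picardLimit h hQm hp hf hA hT ht0 htT
    have h1 : Tendsto (fun s => 2 * (ω s + ω s)) (𝓝[timeInterval T] t) (𝓝 0) := by
      have h2 := ENNReal.Tendsto.const_mul (a := 2) (hω.add hω) (Or.inr ENNReal.ofNat_ne_top)
      rw [add_zero, mul_zero] at h2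
      exact h2.mono_left nhdsWithin_le_nhds
    refine tendsto_of_tendsto_of_tendsto_of_le_of_le' tendsto_const_nhds h1
      (Eventually.of_forall fun _ => bot_le) ?_
    filter_upwards [self_mem_nhdsWithin] with s hs
    have hsT := (mem_timeInterval_coe.1 hs).2
    exact normX_toReal_sub_le (hUs s) (hUs t) (hfin s hsT) (hfin t htT) (hωb s hsT).2 (hωb s hsT).1
  · refine (IsBoundX.memX (hUs t) (hb t (mem_timeInterval_coe.1 ht).2)).2.trans_eq ?_
    push_cast
    rfl
  · obtain ⟨ht0, htT⟩ := mem_timeInterval_coe.1 ht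
    have hZ := isProbabilityMeasure_fundamentalZ h hQ ht0
    -- The limit is controlled only before `T`. The cut-off gives the global bound needed for the
    -- representation formula and is invisible at times before `T`.
    set V : ℝ → EuclideanSpace ℝ (Fin N) → ℝ≥0∞ := fun s x =>
      (Iio T).indicator (fun s => picardLimit K L Q p f s x) s with hV
    have hVm : Measurable (Function.uncurry V) := by
      have h1 : Function.uncurry V = (Iio T ×ˢ univ).indicator
          (Function.uncurry (picardLimit K L Q p f)) := by
        ext ⟨s, x⟩
        simp only [Function.uncurry, hV, indicator, mem_prod, mem_univ, and_true]
      rw [h1]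
      exact hUm.indicator (measurableSet_Iio.prod .univ)
    have hVU : ∀ s < T, V s = picardLimit K L Q p f s := fun s hs => by
      ext x
      simp only [hV, indicator_of_mem (mem_Iio.2 hs)]
    have hVM : ∀ s x, V s x ≤ (2 * A : ℝ≥0) := fun s x => by
      by_cases hs : s < T
      · rw [hVU s hs]
        exact (hb s hs).1 x
      · simp only [hV, indicator_of_notMem (show s ∉ Iio T from hs)]
        exact bot_le
    have hV0 : ∀ s ≤ 0, V s = 0 := fun s hs => by
      rw [hVU s (by linarith), picardLimit_of_nonpos h hpos hs]
    have h1 := integral_spaceConv_fundamentalY_ae_eq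
      (f := fun τ y => (picardLimit K L Q p f τ y).toReal ^ p)
      (F := fun τ y => V τ y ^ p) (M := (2 * A) ^ p) h.right hQm (hVm.pow_const p)
      (fun s hs => by ext y; simp [hV0 s hs, hpos]) (fun s x => by
        rw [ENNReal.coe_rpow_of_nonneg _ hpos.le]
        exact ENNReal.rpow_le_rpow (hVM s x) hpos.le) ht0.le (by
        have hmem : ∀ᵐ q ∂(volume.restrict (Ioc 0 t)).prod
            (volume : Measure (EuclideanSpace ℝ (Fin N))), q.1 ∈ Ioc 0 t :=
          Measure.quasiMeasurePreserving_fst.ae (ae_restrict_mem measurableSet_Ioc)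
        filter_upwards [hmem] with q hq
        rw [hVU q.1 (hq.2.trans_lt htT), ENNReal.toReal_rpow])
    filter_upwards [h1, spaceConv_fundamentalZ_ae_eq h hQm hfu hf
      (fun x => ((hA.1 x).trans_lt ENNReal.coe_lt_top).ne) (t := t)] with x hx1 hx2
    have h2 : duhamelIntegral L Q (fun τ y => V τ y ^ p) t x =
        duhamelIntegral L Q (fun τ y => picardLimit K L Q p f τ y ^ p) t x :=
      le_antisymm
        (duhamel_mono h.right (fun s hs y => by simp only [hVU s (hs.trans htT), le_refl]) x)
        (duhamel_mono h.right (fun s hs y => by simp only [hVU s (hs.trans htT), le_refl]) x)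
    have h3 := picardLimit_eq h hQm hf hpos t x
    have h4 := hfin t htT x
    rw [h3] at h4
    rw [hx1, hx2, h2, h3, ENNReal.toReal_add (ENNReal.add_ne_top.1 h4).1 (ENNReal.add_ne_top.1 h4).2]

/-- The difference is exactly the Duhamel term, whose norm is bounded by a constant times `∫₀ᵗ L`.
-/
lemma tendsto_normX_picardLimit_sub (h : IsSoninePair K L) (hQ : IsTransitionFamily L m Q)
    (hp : 1 ≤ p) (hf : Measurable f) (hA : IsBoundX f A) (hT0 : 0 < T)
    (hT : powLip p (2 * A) * ∫⁻ s in Iio T, L s ≤ 2⁻¹) (hfu : ∀ᵐ x, u₀ x = (f x).toReal) :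
    Tendsto (fun t => normX ((fun x => (picardLimit K L Q p f t x).toReal) -
      spaceConv (fundamentalZ K L Q t) u₀)) (𝓝[>] 0) (𝓝 0) := by
  have hpr := hQ.isProbabilityMeasure
  have hQm := hQ.measurable
  have hpos : 0 < p := by linarith
  have hUm := measurable_picardLimit (p := p) h.left.measurable h.right.measurable hQm hf
  have h1 : Tendsto (fun t => 2 * (((powLip p (2 * A) * (2 * A : ℝ≥0)) * ∫⁻ s in Iio t, L s) + 0))
      (𝓝[>] 0) (𝓝 0) := by
    have h2 := ENNReal.Tendsto.const_mul (a := 2)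
      ((ENNReal.Tendsto.const_mul (a := powLip p (2 * A) * (2 * A : ℝ≥0))
        h.right.tendsto_setLIntegral_Iio
        (Or.inr (ENNReal.mul_ne_top ENNReal.coe_ne_top ENNReal.coe_ne_top))).add_const 0)
      (Or.inr ENNReal.ofNat_ne_top)
    simpa using h2
  refine tendsto_of_tendsto_of_tendsto_of_le_of_le' tendsto_const_nhds h1
    (Eventually.of_forall fun _ => bot_le) ?_
  filter_upwards [self_mem_nhdsWithin, nhdsWithin_le_nhds (gt_mem_nhds hT0)] with t ht htT
  have hZ := isProbabilityMeasure_fundamentalZ h hQ ht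
  have hb : ∀ s < T, IsBoundX (picardLimit K L Q p f s) (2 * A : ℝ≥0) := fun s hs =>
    isBoundX_picardLimit h hQm hp hf hA hT hs
  have hz := IsBoundX.freeEvolution h hQm hf hA t
  have hae : ((fun x => (picardLimit K L Q p f t x).toReal) -
      spaceConv (fundamentalZ K L Q t) u₀) =ᵐ[volume] fun x =>
        (picardLimit K L Q p f t x).toReal - (freeEvolution K L Q f t x).toReal := by
    filter_upwards [spaceConv_fundamentalZ_ae_eq h hQm hfu hf
      (fun x => ((hA.1 x).trans_lt ENNReal.coe_lt_top).ne) (t := t)] with x hx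
    rw [Pi.sub_apply, hx]
  rw [normX_congr_ae hae]
  have hd := isBoundX_duhamel_rpow h.right hQm hp hUm
    (fun s hs => picardLimit_of_nonpos h hpos hs) (M := 2 * A) (t := t)
    fun s hs => hb s (hs.trans htT)
  refine normX_toReal_sub_le hUm.of_uncurry_left
    (measurable_freeEvolution h.left.measurable h.right.measurable hQm hf).of_uncurry_left
    (fun x => (((hb t htT).1 x).trans_lt ENNReal.coe_lt_top).ne)
    (fun x => ((hz.1 x).trans_lt ENNReal.coe_lt_top).ne)
    (hd.mono (fun x => ?_) le_rfl) ((isBoundX_zero 0).mono (fun x => ?_) le_rfl)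
  · rw [Pi.sub_apply, picardLimit_eq h hQm hf hpos, tsub_le_iff_left]
  · rw [Pi.sub_apply, picardLimit_eq h hQm hf hpos, tsub_eq_zero_of_le le_self_add]
    rfl

end existence

/-! ### The main theorem. -/

theorem mainTheorem7 {N : ℕ} (hN : 1 ≤ N) (κ ℓ : ℝ → ℝ) (hκ : IsMemoryKernelPair κ ℓ)
    (J : EuclideanSpace ℝ (Fin N) → ℝ) (hJ : IsLevyKernel J) (p : ℝ) (hp : 1 < p) :
    ∃ Z Y : ℝ → Measure (EuclideanSpace ℝ (Fin N)),
      -- `(Z, Y)` is the one and only fundamental pair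
      IsFundamentalPair ℓ J Z Y ∧
      (∀ Z' Y' : ℝ → Measure (EuclideanSpace ℝ (Fin N)), IsFundamentalPair ℓ J Z' Y' →
        ∀ t : ℝ, 0 < t → Z' t = Z t ∧ Y' t = Y t) ∧
      -- local existence and uniqueness
      (∀ u₀ : EuclideanSpace ℝ (Fin N) → ℝ, MemX u₀ → (∀ᵐ x, 0 ≤ u₀ x) →
        ∃ T₀ : ℝ, 0 < T₀ ∧ ∃ u : ℝ → EuclideanSpace ℝ (Fin N) → ℝ,
          IsMildSolution Z Y p u₀ T₀ u ∧
          (∀ v : ℝ → EuclideanSpace ℝ (Fin N) → ℝ, IsMildSolution Z Y p u₀ T₀ v →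
            ∀ t ∈ timeInterval T₀, v t =ᵐ[volume] u t) ∧
          -- the initial value is attained
          Tendsto (fun t => eLpNorm (u t - u₀) 1 volume) (𝓝[>] 0) (𝓝 0) ∧
          Tendsto (fun t => normX (u t - spaceConv (Z t) u₀)) (𝓝[>] 0) (𝓝 0)) ∧
      -- comparison principle
      (∀ (T : EReal) (u₀ v₀ : EuclideanSpace ℝ (Fin N) → ℝ)
        (u v : ℝ → EuclideanSpace ℝ (Fin N) → ℝ),
        MemX u₀ → MemX v₀ → (∀ᵐ x, 0 ≤ u₀ x) → (∀ᵐ x, u₀ x ≤ v₀ x) →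
        IsMildSolution Z Y p u₀ T u → IsMildSolution Z Y p v₀ T v →
        ∀ t ∈ timeInterval T, ∀ᵐ x, u t x ≤ v t x) := by
  have hS := hκ.isSoninePair
  obtain ⟨Q, hQ⟩ := hJ.exists_transitionFamily hS
  have hpair := hκ.isFundamentalPair hJ hQ
  have hpr := hQ.isProbabilityMeasure
  refine ⟨fundamentalZ (timeKernel κ) (timeKernel ℓ) Q, fundamentalY (timeKernel ℓ) Q, hpair,
    fun Z' Y' h' t ht => hκ.eq_of_isFundamentalPair hpair h' ht, fun u₀ hu₀ h0 => ?_,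
    fun T u₀ v₀ u v hu₀ hv₀ h0 h0v hu hv t ht => hu.ae_le hS hQ hp hu₀ hv₀ h0 h0v hv ht⟩
  obtain ⟨f, A, hf, hA, hfu⟩ := hu₀.exists_rep h0
  -- The existence time is chosen so that the Duhamel map contracts by `1/2` on the ball of radius
  -- `2 A`.
  obtain ⟨T₀, hT₀, hT⟩ := hS.right.exists_time (powLip p (2 * A))
  have hu := isMildSolution_picardLimit hS hQ hp.le hf hA hT hfu
  have hX := tendsto_normX_picardLimit_sub hS hQ hp.le hf hA hT₀ hT hfu
  refine ⟨T₀, hT₀, fun t x => (picardLimit (timeKernel κ) (timeKernel ℓ) Q p f t x).toReal, hu,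
    fun v hv t ht => ?_, ?_, hX⟩
  · have hle : ∀ᵐ x, u₀ x ≤ u₀ x := Eventually.of_forall fun _ => le_rfl
    filter_upwards [hu.ae_le hS hQ hp hu₀ hu₀ h0 hle hv ht,
      hv.ae_le hS hQ hp hu₀ hu₀ h0 hle hu ht] with x h1 h2 using le_antisymm h2 h1
  -- Triangle inequality in `L¹` through the free evolution `Z_t * u₀`.
  · have h1 := hX.add (tendsto_eLpNorm_spaceConv_fundamentalZ_sub hS hQ hu₀ h0)
    rw [add_zero] at h1
    refine tendsto_of_tendsto_of_tendsto_of_le_of_le' tendsto_const_nhds h1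
      (Eventually.of_forall fun _ => bot_le) ?_
    filter_upwards [self_mem_nhdsWithin, nhdsWithin_le_nhds (gt_mem_nhds hT₀)] with t ht htT
    have hZ := isProbabilityMeasure_fundamentalZ hS hQ ht
    have hft : ∀ x, f x ≠ ⊤ := fun x => ((hA.1 x).trans_lt ENNReal.coe_lt_top).ne
    have hzm : AEStronglyMeasurable (spaceConv (fundamentalZ (timeKernel κ) (timeKernel ℓ) Q t) u₀)
        volume :=
      (measurable_freeEvolution hS.left.measurable hS.right.measurable hQ.measurable
        hf).of_uncurry_left.ennreal_toReal.aestronglyMeasurable.congr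
        (EventuallyEq.symm (spaceConv_fundamentalZ_ae_eq hS hQ.measurable hfu hf hft (t := t)))
    have hum := (hu.memX t (mem_timeInterval_coe.2 ⟨ht, htT⟩)).1.aestronglyMeasurable
    refine le_trans ?_ (add_le_add (le_self_add (b := eLpNorm _ ⊤ volume)) le_rfl)
    have h2 := eLpNorm_add_le (hum.sub hzm) (hzm.sub hu₀.1.aestronglyMeasurable) le_rfl
    rwa [sub_add_sub_cancel] at h2
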